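/- Let $G$ be a finite, simple, connected graph with vertex set $\mathcal V(G)$ and edges $e_1,\dots,e_m$, satisfying the condition $(\sharp)$: no induced subgraph of $G$ consists of two vertex-disjoint odd cycles joined by a path of length $\ge 1$. Let $K$ be any field. For an edge $e=\{p,q\}$ let $\mathbf a_e\in\mathbb Z^{\mathcal V(G)}$ be the vector with entries $1$ at $p$ and $q$ and $0$ elsewhere, write $\mathbf a_i=\mathbf a_{e_i}$ and $\mathcal A_G=\{\mathbf a_1,\dots,\mathbf a_m\}$, and let $$I_{\mathcal A_G}=\bigl(\mathbf x^{\mathbf u_+}-\mathbf x^{\mathbf u_-} : \mathbf u\in\mathbb Z^m,\ u_1\mathbf a_1+\cdots+u_m\mathbf a_m=\mathbf 0\bigr)\subset K[x_1,\dots,x_m]$$ be the toric ideal of $G$. The $\mathcal A_G$-degree of $\mathbf x^{\mathbf u}$ is $u_1\mathbf a_1+\cdots+u_m\mathbf a_m$, and ${\rm supp}(\mathbf x^{\mathbf u})=\{i : u_i\ne 0\}$. A binomial is a difference of two monomials. A monomial $M$ is indispensable of $I_{\mathcal A_G}$ if every system of binomial generators of $I_{\mathcal A_G}$ contains a binomial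 $B$ such that $M$ is a monomial of $B$. Let $\mathcal T_{\min}$ be the set of inclusion-minimal elements of the set of supports of indispensable monomials. The simplicial complex $\Gamma_G$ has vertex set $\mathcal T_{\min}$, and $\{E_1,\dots,E_k\}\subset\mathcal T_{\min}$ is a face if there are monomials $M_1,\dots,M_k$ of the same $\mathcal A_G$-degree with ${\rm supp}(M_i)=E_i$ for all $i$. For an even closed walk $w=(e_{i_1},\dots,e_{i_{2s}})$ of $G$, with $e_{i_k}=\{v_k,v_{k+1}\}$ and $v_{2s+1}=v_1$, put $B_w=\prod_{k=1}^s x_{i_{2k-1}}-\prod_{k=1}^s x_{i_{2k}}$; the edges $e_{i_k}$ with $k$ odd (even) are the odd (even) edges of $w$. View $w$ also as a subgraph of $G$; its blocks are its maximal connected subgraphs without a cut vertex. A chord $\{v_k,v_l\}$ of $w$, $k<l\le 2s$, is an edge of $G$ that is not an edge of $w$; it is a bridge if $v_k\in\mathcal B_1$ and $v_l\in\mathcal B_2$ for two different blocks $\mathcal B_1,\mathcal B_2$ of $w$, and it is odd if it is not a bridge and the closed walks $(e_{i_1},\dots,e_{i_{k-1}},\{v_k,v_l\},e_{i_l},\dots,e_{i_{2s}})$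 and $(e_{i_k},\dots,e_{i_{l-1}},\{v_k,v_l\})$ both have odd length. Odd chords $\{v_t,v_j\}$ ($t<j$) and $\{v_{t'},v_{j'}\}$ ($t'<j'$) cross effectively if $t'-t$ is odd and either $t<t'<j<j'$ or $t'<t<j'<j$. An $\mathcal F_4$ of $w$ is a cycle $(e,f,e',f')$ of length $4$ in $G$ such that $e,e'$ are edges of $w$, both even or both odd, and $f,f'$ are odd chords of $w$ which cross effectively. Then: (1) If $M$ is an indispensable monomial of $I_{\mathcal A_G}$ that is not quadratic (i.e. not of total degree $2$), then $\{{\rm supp}(M)\}$ is a connected component of $\Gamma_G$ if and only if every even closed walk $w$ of $G$ such that $M$ is a monomial of $B_w$ has an $\mathcal F_4$. (2) Every connected component of $\Gamma_G$ is either a vertex, an edge or a $2$-simplex. -/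

import Mathlib

noncomputable section

namespace GraphToric

/-! ### Toric ideals, indispensable monomials -/

section Toric

variable {σ ι : Type*}

/-- `ker_ℤ(A)`: the lattice of integer relations among the vectors `A i`, for `i : σ`. -/
def kerZ (A : σ → ι → ℤ) : Submodule ℤ (σ →₀ ℤ) :=
  LinearMap.ker (Finsupp.linearCombination ℤ A)

/-- The positive part `u₊` of an integer vector; the negative part of `u` is `posPart (-u)`. -/
def posPart (u : σ →₀ ℤ) : σ →₀ ℕ :=
  u.mapRange Int.toNat Int.toNat_zero

/-- The lattice ideal `I_L`, generated by all `x^{u₊} - x^{u₋}` with `u ∈ L`. -/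
def latticeIdeal (K : Type*) [Field K] (L : Submodule ℤ (σ →₀ ℤ)) :
    Ideal (MvPolynomial σ K) :=
  Ideal.span {f | ∃ u ∈ L, f = MvPolynomial.monomial (posPart u) (1 : K)
    - MvPolynomial.monomial (posPart (-u)) (1 : K)}

/-- The toric ideal `I_A` of a vector configuration. -/
def toricIdeal (K : Type*) [Field K] (A : σ → ι → ℤ) : Ideal (MvPolynomial σ K) :=
  latticeIdeal K (kerZ A)

/-- The `A`-degree `u₁ a₁ + ⋯ + uₘ aₘ` of the monomial `x^u`. -/
def degA (A : σ → ι → ℤ) (u : σ →₀ ℕ) : ι → ℤ :=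
  Finsupp.linearCombination ℕ A u

/-- A binomial is a difference of two monomials. -/
def IsBinomial {K : Type*} [Field K] (f : MvPolynomial σ K) : Prop :=
  ∃ u v : σ →₀ ℕ, f = MvPolynomial.monomial u (1 : K) - MvPolynomial.monomial v (1 : K)

/-- `S` is a system of binomial generators of `I`. -/
def IsBinomialGenerators {K : Type*} [Field K] (I : Ideal (MvPolynomial σ K))
    (S : Set (MvPolynomial σ K)) : Prop :=
  (∀ f ∈ S, IsBinomial f) ∧ Ideal.span S = I

/-- The monomial `x^u` is indispensable of `I`: every system of binomial generators of `I`
contains a binomial in which `x^u` occurs. -/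
def IsIndispensableMonomial {K : Type*} [Field K] (I : Ideal (MvPolynomial σ K))
    (u : σ →₀ ℕ) : Prop :=
  ∀ S : Set (MvPolynomial σ K), IsBinomialGenerators I S → ∃ B ∈ S, u ∈ B.support

/-- The set `𝒯` of supports of indispensable monomials of `I`. -/
def indispensableSupports {K : Type*} [Field K] (I : Ideal (MvPolynomial σ K)) :
    Set (Finset σ) :=
  {E | ∃ u : σ →₀ ℕ, IsIndispensableMonomial I u ∧ u.support = E}

/-- The set `𝒯_min` of inclusion-minimal elements of `𝒯`. -/
def minimalSupports {K : Type*} [Field K] (I : Ideal (MvPolynomial σ K)) : Set (Finset σ) :=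
  {E | Minimal (fun E' => E' ∈ indispensableSupports I) E}

/-- The simplicial complex `Γ_L` of the lattice `L = ker_ℤ(A)`: its vertices are the elements of
`𝒯_min`, and a nonempty finite set of vertices is a face when its elements are the supports of
monomials that all have the same `A`-degree. -/
def gammaComplex (K : Type*) [Field K] (A : σ → ι → ℤ) :
    PreAbstractSimplicialComplex (Finset σ) where
  faces := {T | T.Nonempty ∧ (∀ E ∈ T, E ∈ minimalSupports (toricIdeal K A)) ∧
    ∃ M : Finset σ → (σ →₀ ℕ), (∀ E ∈ T, (M E).support = E) ∧
      ∀ E ∈ T, ∀ E' ∈ T, degA A (M E) = degA A (M E')}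
  isRelLowerSet_faces := by
    rintro T ⟨hT, hmin, M, hM, hdeg⟩
    refine ⟨hT, fun T' hT' hne => ⟨hne, fun E hE => hmin E (hT' hE), M,
      fun E hE => hM E (hT' hE), fun E hE E' hE' => hdeg E (hT' hE) E' (hT' hE')⟩⟩

end Toric

/-! ### Connected components of a simplicial complex -/

section Complex

variable {α : Type*}

/-- Two vertices that lie in a common face (equivalently, equal or joined by an edge). -/
def CommonFace (Δ : PreAbstractSimplicialComplex α) (a b : α) : Prop :=
  ∃ s ∈ Δ.faces, a ∈ s ∧ b ∈ s

/-- The subcomplex of all faces whose vertices can be reached from `a` along edges. -/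
def componentAt (Δ : PreAbstractSimplicialComplex α) (a : α) :
    PreAbstractSimplicialComplex α where
  faces := {s | s ∈ Δ.faces ∧ ∀ b ∈ s, Relation.ReflTransGen (CommonFace Δ) a b}
  isRelLowerSet_faces := by
    rintro s ⟨hs, hr⟩
    refine ⟨(Δ.isRelLowerSet_faces hs).1, fun t hts ht =>
      ⟨(Δ.isRelLowerSet_faces hs).2 hts ht, fun b hb => hr b (hts hb)⟩⟩

/-- `H` is a connected component of `Δ`. -/
def IsConnectedComponent (Δ H : PreAbstractSimplicialComplex α) : Prop :=
  ∃ a : α, {a} ∈ Δ.faces ∧ H = componentAt Δ a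

/-- The simplex with vertex set `s` (all nonempty subsets of `s` are faces); it is a vertex, an
edge, a `2`-simplex when `s` has `1`, `2`, `3` elements. -/
def simplexOn (s : Finset α) : PreAbstractSimplicialComplex α where
  faces := {t | t.Nonempty ∧ t ⊆ s}
  isRelLowerSet_faces := by
    rintro t ⟨ht, hts⟩
    exact ⟨ht, fun r hrt hr => ⟨hr, fun x hx => hts (hrt hx)⟩⟩

end Complex

/-! ### Graphs and closed walks -/

section Graph

variable {V : Type*}

/-- The vector `a_e`, with entry `1` at the two endpoints of `e` and `0` elsewhere. -/
def edgeVec (G : SimpleGraph V) (e : G.edgeSet) : V → ℤ :=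
  Set.indicator {v | v ∈ (e : Sym2 V)} 1

/-- The condition `(♯)`: no induced subgraph of `G` consists of two vertex disjoint odd cycles
`c₁`, `c₂` joined by a path `p` of length at least `1` (which meets the cycles only in its
endpoints). -/
def CondSharp (G : SimpleGraph V) : Prop :=
  ∀ (u v : V) (c₁ : G.Walk u u) (c₂ : G.Walk v v) (p : G.Walk u v),
    c₁.IsCycle → Odd c₁.length → c₂.IsCycle → Odd c₂.length →
    (∀ x ∈ c₁.support, x ∉ c₂.support) →
    p.IsPath → 1 ≤ p.length →
    (∀ x ∈ p.support, x ∈ c₁.support → x = u) →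
    (∀ x ∈ p.support, x ∈ c₂.support → x = v) →
    ¬ (c₁.toSubgraph ⊔ p.toSubgraph ⊔ c₂.toSubgraph).IsInduced

variable {G : SimpleGraph V} {u : V}

/-- The edge of `w` at position `i`, where positions are counted from `0`. -/
def walkEdge (w : G.Walk u u) (i : Fin w.length) : G.edgeSet :=
  ⟨s(w.getVert i, w.getVert (i + 1)), w.adj_getVert_succ i.2⟩

/-- The binomial `B_w = B_w^{(+)} - B_w^{(-)}`: with positions counted from `0`, the first product
runs over the 1st, 3rd, 5th, … edges of `w` and the second over the 2nd, 4th, 6th, … edges. -/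
def walkBinomial (K : Type*) [Field K] (w : G.Walk u u) : MvPolynomial G.edgeSet K :=
  (∏ i : Fin w.length with Even i.val, MvPolynomial.X (walkEdge w i))
    - ∏ i : Fin w.length with Odd i.val, MvPolynomial.X (walkEdge w i)

/-- A biconnected subgraph: connected, without a cut vertex (for a connected graph, a cut vertex
is one whose removal leaves a disconnected graph). -/
def IsBiconnected (H : G.Subgraph) : Prop :=
  H.Connected ∧ ∀ v ∈ H.verts, (H.deleteVerts {v}).Preconnected

/-- A block of the walk `w`: a maximal biconnected subgraph of `w`, regarded as a subgraph. -/
def IsBlock (w : G.Walk u u) (B : G.Subgraph) : Prop :=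
  Maximal (fun H : G.Subgraph => H ≤ w.toSubgraph ∧ IsBiconnected H) B

/-- With `v₀, v₁, …` the successive vertices of `w`: the vertices `v_k`, `v_l` lie in two different
blocks of `w`. A chord `{v_k, v_l}` with this property is a bridge of `w`. -/
def IsBridgeAt (w : G.Walk u u) (k l : ℕ) : Prop :=
  ∃ B₁ B₂ : G.Subgraph, IsBlock w B₁ ∧ IsBlock w B₂ ∧ B₁ ≠ B₂ ∧
    w.getVert k ∈ B₁.verts ∧ w.getVert l ∈ B₂.verts

/-- `{v_k, v_l}` (with `k < l`) is an odd chord of the even closed walk `w`: it is an edge of `G`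
that is not an edge of `w`, it is not a bridge, and both closed walks into which it breaks `w`
have odd length. -/
def IsOddChord (w : G.Walk u u) (k l : ℕ) : Prop :=
  k < l ∧ l < w.length ∧ G.Adj (w.getVert k) (w.getVert l) ∧
    s(w.getVert k, w.getVert l) ∉ w.edges ∧ ¬ IsBridgeAt w k l ∧
    Odd ((l - k) + 1) ∧ Odd ((w.length - (l - k)) + 1)

/-- The odd chords `{v_t, v_j}` and `{v_t', v_j'}` (`t < j`, `t' < j'`) cross effectively. -/
def CrossEffectively (t j t' j' : ℕ) : Prop :=
  Odd ((t' : ℤ) - (t : ℤ)) ∧ ((t < t' ∧ t' < j ∧ j < j') ∨ (t' < t ∧ t < j' ∧ j' < j))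

/-- `w` has an `𝓕₄`: there is a cycle `ξ = (e, f, e', f')` of length `4` in `G` in which `e`, `e'`
are edges of `w`, both odd or both even, and `f`, `f'` are odd chords of `w` which cross
effectively. -/
def HasF4 (w : G.Walk u u) : Prop :=
  ∃ (i i' : Fin w.length) (t j t' j' : ℕ) (a : V) (ξ : G.Walk a a),
    (Even (i : ℕ) ↔ Even (i' : ℕ)) ∧
    IsOddChord w t j ∧ IsOddChord w t' j' ∧ CrossEffectively t j t' j' ∧
    ξ.IsCycle ∧
    ξ.edges = [(walkEdge w i : Sym2 V), s(w.getVert t, w.getVert j),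
      (walkEdge w i' : Sym2 V), s(w.getVert t', w.getVert j')]

/-- The simplicial complex `Γ_G` of the toric ideal of the graph `G`. -/
def gammaGraph (K : Type*) [Field K] (G : SimpleGraph V) :
    PreAbstractSimplicialComplex (Finset G.edgeSet) :=
  gammaComplex K (edgeVec G)

end Graph

end GraphToric

end

/-!
An indispensable monomial is a *critical* one: a monomial which, minimally for divisibility, shares
its degree with some other monomial. If `M` is critical and `N` is another monomial of its degree,
then `x^M - x^N` is primitive, hence the binomial of an even closed walk `w`. Under `(♯)` the
critical monomials are squarefree, their supports form an antichain, and two of them have the same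
degree as soon as some monomials with their supports do. So the connected components of `Γ_G` are
the simplices on the critical monomials of a fixed degree.

If the degree of `M` contains a third monomial `Q`, then `Q` is made of chords of `w`, no chord of
`w` between simple vertices is a bridge, and a shortest chord in `Q` is crossed by another one so
that both span a square with two edges of `N`. This square is an `𝓕₄`, and exchanging its
opposite sides shows that the product of the two edges of `N` shares its degree with another
monomial. Hence either `N` is not critical and `w` has an `𝓕₄`, or `N` is critical and quadratic;
in the latter case `w` has length `4` and its four vertices carry at most three perfect matchings.
-/

noncomputable section

namespace GraphToric

/-! ### Critical monomials and primitive binomials -/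

section Fibres

variable {σ ι : Type*} {A : σ → ι → ℤ} {u v w : σ →₀ ℕ}

theorem degA_zero : degA A 0 = 0 :=
  map_zero _

theorem degA_add (u v : σ →₀ ℕ) : degA A (u + v) = degA A u + degA A v :=
  map_add _ u v

theorem degA_single (e : σ) (n : ℕ) : degA A (Finsupp.single e n) = n • A e :=
  Finsupp.linearCombination_single ℕ n e

theorem degA_sub (h : v ≤ u) : degA A (u - v) = degA A u - degA A v := by
  rw [eq_sub_iff_add_eq, ← degA_add, tsub_add_cancel_of_le h]

theorem eq_of_le_of_degA_eq (hA : ∀ u, degA A u = 0 → u = 0) (hle : u ≤ v)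
    (h : degA A u = degA A v) : u = v :=
  hle.antisymm <| tsub_eq_zero_iff_le.1 <| hA _ <| by rw [degA_sub hle, h, sub_self]

/-- `x^u` is the only monomial of its `A`-degree. -/
def IsRigid (A : σ → ι → ℤ) (u : σ →₀ ℕ) : Prop :=
  ∀ v, degA A v = degA A u → v = u

/-- `x^u` is, for divisibility, a minimal monomial that shares its `A`-degree with another one.
For a positive grading these are exactly the indispensable monomials. -/
def IsCritical (A : σ → ι → ℤ) (u : σ →₀ ℕ) : Prop :=
  Minimal (fun v => ¬ IsRigid A v) u

theorem not_isRigid_iff : ¬ IsRigid A u ↔ ∃ v, degA A v = degA A u ∧ v ≠ u := by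
  simp [IsRigid]

theorem not_isRigid_of_degA_eq (h : degA A u = degA A v) (hne : u ≠ v) : ¬ IsRigid A u :=
  fun hu => hne (hu v h.symm).symm

theorem IsCritical.not_isRigid (hu : IsCritical A u) : ¬ IsRigid A u :=
  hu.1

theorem IsCritical.isRigid_of_lt (hu : IsCritical A u) (h : v < u) : IsRigid A v :=
  not_not.1 (hu.not_prop_of_lt h)

theorem IsCritical.eq_of_le (hu : IsCritical A u) (hv : ¬ IsRigid A v) (hle : v ≤ u) : v = u :=
  Minimal.eq_of_le hu hv hle

theorem exists_isCritical_le (hu : ¬ IsRigid A u) : ∃ v ≤ u, IsCritical A v :=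
  exists_minimal_le_of_wellFoundedLT _ u hu

/-- The exponent vector of a monomial as an integer vector. -/
def toIntVec : (σ →₀ ℕ) →+ (σ →₀ ℤ) :=
  Finsupp.mapRange.addMonoidHom (Nat.castAddMonoidHom ℤ)

theorem toIntVec_apply (u : σ →₀ ℕ) (i : σ) : toIntVec u i = u i :=
  rfl

theorem posPart_toIntVec_sub (u v : σ →₀ ℕ) : posPart (toIntVec u - toIntVec v) = u - v := by
  ext i
  simp [posPart, toIntVec_apply]

theorem toIntVec_posPart_sub (z : σ →₀ ℤ) :
    toIntVec (posPart z) - toIntVec (posPart (-z)) = z := by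
  ext i
  simp [posPart, toIntVec_apply]

theorem linearCombination_toIntVec (u : σ →₀ ℕ) :
    Finsupp.linearCombination ℤ A (toIntVec u) = degA A u := by
  induction u using Finsupp.induction_linear with
  | zero => simp [degA_zero]
  | add f g hf hg => rw [map_add, map_add, hf, hg, degA_add]
  | single e n => simp [toIntVec, degA_single]

theorem toIntVec_sub_mem_kerZ :
    toIntVec u - toIntVec v ∈ kerZ A ↔ degA A u = degA A v := by
  rw [kerZ, LinearMap.mem_ker, map_sub, linearCombination_toIntVec, linearCombination_toIntVec,
    sub_eq_zero]

theorem degA_posPart_eq {z : σ →₀ ℤ} (hz : z ∈ kerZ A) :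
    degA A (posPart z) = degA A (posPart (-z)) := by
  rwa [← toIntVec_sub_mem_kerZ, toIntVec_posPart_sub]

open MvPolynomial

theorem mem_support_monomial_sub {R : Type*} [CommRing R] [Nontrivial R] :
    w ∈ (monomial u (1 : R) - monomial v 1).support ↔ u ≠ v ∧ (w = u ∨ w = v) := by
  classical
  rw [mem_support_iff, coeff_sub, coeff_monomial, coeff_monomial]
  by_cases hu : u = w <;> by_cases hv : v = w <;> simp [hu, hv, eq_comm]

variable {K : Type*} [Field K]

theorem aeval_monomial_eq_single_degA {R : Type*} [CommSemiring R] (u : σ →₀ ℕ) :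
    aeval (fun e => AddMonoidAlgebra.single (A e) (1 : R)) (monomial u (1 : R))
      = AddMonoidAlgebra.single (degA A u) (1 : R) := by
  induction u using Finsupp.induction_linear with
  | zero => rw [monomial_zero', map_one, map_one, degA_zero, AddMonoidAlgebra.one_def]
  | add f g hf hg =>
    have hmul : monomial (f + g) (1 : R) = monomial f 1 * monomial g 1 := by
      rw [monomial_mul, one_mul]
    rw [hmul, map_mul, hf, hg, AddMonoidAlgebra.single_mul_single, degA_add, one_mul]
  | single e n =>
    rw [← X_pow_eq_monomial, map_pow, aeval_X, AddMonoidAlgebra.single_pow, one_pow, degA_single]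

theorem aeval_eq_zero_of_mem_toricIdeal {f : MvPolynomial σ K} (hf : f ∈ toricIdeal K A) :
    aeval (fun e => AddMonoidAlgebra.single (A e) (1 : K)) f = 0 := by
  suffices toricIdeal K A ≤ RingHom.ker
      (aeval (R := K) (fun e => AddMonoidAlgebra.single (A e) (1 : K))) from this hf
  refine Ideal.span_le.2 ?_
  rintro _ ⟨z, hz, rfl⟩
  simp only [SetLike.mem_coe, RingHom.mem_ker, map_sub, aeval_monomial_eq_single_degA,
    degA_posPart_eq hz, sub_self]

theorem monomial_sub_mem_toricIdeal :
    monomial u (1 : K) - monomial v 1 ∈ toricIdeal K A ↔ degA A u = degA A v := by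
  constructor
  · intro h
    have := aeval_eq_zero_of_mem_toricIdeal h
    rw [map_sub, aeval_monomial_eq_single_degA, aeval_monomial_eq_single_degA, sub_eq_zero] at this
    exact AddMonoidAlgebra.single_left_injective one_ne_zero this
  · intro h
    have hgen : monomial (u - v) (1 : K) - monomial (v - u) 1 ∈ toricIdeal K A :=
      Ideal.subset_span ⟨_, toIntVec_sub_mem_kerZ.2 h, by
        rw [neg_sub, posPart_toIntVec_sub, posPart_toIntVec_sub]⟩
    have hu : u ⊓ v + (u - v) = u := by ext i; simp; omega
    have hv : u ⊓ v + (v - u) = v := by ext i; simp; omega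
    have := Ideal.mul_mem_left _ (monomial (u ⊓ v) (1 : K)) hgen
    rwa [mul_sub, monomial_mul, monomial_mul, one_mul, hu, hv] at this

theorem exists_mem_support_le_of_mem_span {R : Type*} [CommSemiring R] {S : Set (MvPolynomial σ R)}
    {f : MvPolynomial σ R} (hf : f ∈ Ideal.span S) (hu : u ∈ f.support) :
    ∃ B ∈ S, ∃ v ∈ B.support, v ≤ u := by
  have hle : Ideal.span S ≤ Ideal.span ((fun s => monomial s (1 : R)) ''
      {v | ∃ B ∈ S, v ∈ B.support}) :=
    Ideal.span_le.2 fun B hB =>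
      mem_ideal_span_monomial_image.2 fun v hv => ⟨v, ⟨B, hB, hv⟩, le_rfl⟩
  obtain ⟨v, ⟨B, hB, hv⟩, hvu⟩ := mem_ideal_span_monomial_image.1 (hle hf) u hu
  exact ⟨B, hB, v, hv, hvu⟩

theorem IsCritical.isIndispensableMonomial (hu : IsCritical A u) :
    IsIndispensableMonomial (toricIdeal K A) u := by
  rintro S ⟨hbin, hspan⟩
  obtain ⟨v, hv, hvu⟩ := not_isRigid_iff.1 hu.not_isRigid
  have hmem : monomial u (1 : K) - monomial v 1 ∈ Ideal.span S :=
    hspan ▸ monomial_sub_mem_toricIdeal.2 hv.symm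
  obtain ⟨B, hB, w, hw, hwu⟩ := exists_mem_support_le_of_mem_span hmem
    (mem_support_monomial_sub.2 ⟨hvu.symm, Or.inl rfl⟩)
  obtain ⟨a, b, rfl⟩ := hbin B hB
  have hab : degA A a = degA A b := monomial_sub_mem_toricIdeal.1 (hspan ▸ Ideal.subset_span hB)
  have hw_not : ¬ IsRigid A w := by
    obtain ⟨hne, rfl | rfl⟩ := mem_support_monomial_sub.1 hw
    exacts [not_isRigid_of_degA_eq hab hne, not_isRigid_of_degA_eq hab.symm hne.symm]
  exact ⟨_, hB, hu.eq_of_le hw_not hwu ▸ hw⟩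

/-- The homogeneous binomials in which `x^u` does not occur. -/
def binomialsAvoiding (K : Type*) [Field K] (A : σ → ι → ℤ) (u : σ →₀ ℕ) :
    Set (MvPolynomial σ K) :=
  {f | ∃ a b, a ≠ u ∧ b ≠ u ∧ degA A a = degA A b ∧ f = monomial a (1 : K) - monomial b 1}

theorem monomial_sub_mem_span_binomialsAvoiding (hA : ∀ u, degA A u = 0 → u = 0) (hvu : v < u)
    (hv : ¬ IsRigid A v) {b : σ →₀ ℕ} (hb : degA A u = degA A b) :
    monomial u (1 : K) - monomial b 1 ∈ Ideal.span (binomialsAvoiding K A u) := by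
  by_cases hbu : b = u
  · simp [hbu]
  obtain ⟨w, hwv, hne⟩ := not_isRigid_iff.1 hv
  have hwu : w ≠ u := by
    rintro rfl
    exact hvu.ne (eq_of_le_of_degA_eq hA hvu.le hwv.symm)
  have hu : u - v + v = u := tsub_add_cancel_of_le hvu.le
  have hdeg : degA A (u - v + w) = degA A b := by rw [degA_add, hwv, ← degA_add, hu, hb]
  have hmid : u - v + w ≠ u := fun h => hne (add_left_cancel (h.trans hu.symm))
  have hvia : monomial u (1 : K) - monomial b 1
      = monomial (u - v) 1 * (monomial v 1 - monomial w 1)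
        + (monomial (u - v + w) 1 - monomial b 1) := by
    rw [mul_sub, monomial_mul, monomial_mul, one_mul, hu, sub_add_sub_cancel]
  rw [hvia]
  exact add_mem
    (Ideal.mul_mem_left _ _ (Ideal.subset_span ⟨v, w, hvu.ne, hwu, hwv.symm, rfl⟩))
    (Ideal.subset_span ⟨_, b, hmid, hbu, hdeg, rfl⟩)

theorem span_binomialsAvoiding (hA : ∀ u, degA A u = 0 → u = 0) (hvu : v < u)
    (hv : ¬ IsRigid A v) : Ideal.span (binomialsAvoiding K A u) = toricIdeal K A := by
  refine le_antisymm (Ideal.span_le.2 ?_) (Ideal.span_le.2 ?_)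
  · rintro _ ⟨a, b, -, -, hab, rfl⟩
    exact monomial_sub_mem_toricIdeal.2 hab
  · rintro _ ⟨z, hz, rfl⟩
    have hdeg := degA_posPart_eq hz
    by_cases hpos : posPart z = u
    · rw [hpos]
      exact monomial_sub_mem_span_binomialsAvoiding hA hvu hv (hpos ▸ hdeg)
    by_cases hneg : posPart (-z) = u
    · rw [← neg_sub, hneg]
      exact neg_mem (monomial_sub_mem_span_binomialsAvoiding hA hvu hv (hneg ▸ hdeg.symm))
    exact Ideal.subset_span ⟨_, _, hpos, hneg, hdeg, rfl⟩

theorem isIndispensableMonomial_iff (hA : ∀ u, degA A u = 0 → u = 0) :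
    IsIndispensableMonomial (toricIdeal K A) u ↔ IsCritical A u := by
  refine ⟨fun h => ⟨fun hrigid => ?_, fun v hv hvu => ?_⟩, IsCritical.isIndispensableMonomial⟩
  · obtain ⟨_, ⟨z, hz, rfl⟩, hB⟩ := h _ ⟨by rintro f ⟨z, -, rfl⟩; exact ⟨_, _, rfl⟩, rfl⟩
    have hdeg := degA_posPart_eq hz
    obtain ⟨hne, rfl | rfl⟩ := mem_support_monomial_sub.1 hB
    exacts [hne (hrigid _ hdeg.symm).symm, hne (hrigid _ hdeg)]
  · by_contra hle
    obtain ⟨_, ⟨a, b, ha, hb, -, rfl⟩, hB⟩ := h (binomialsAvoiding K A u)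
      ⟨by rintro _ ⟨a, b, -, -, -, rfl⟩; exact ⟨a, b, rfl⟩,
        span_binomialsAvoiding hA (lt_of_le_not_ge hvu hle) hv⟩
    obtain ⟨-, rfl | rfl⟩ := mem_support_monomial_sub.1 hB
    exacts [ha rfl, hb rfl]

theorem IsCritical.eq_zero_or_eq_zero (hu : IsCritical A u) (hv : degA A v = degA A u)
    (hne : v ≠ u) (e : σ) : u e = 0 ∨ v e = 0 := by
  by_contra! h
  have hue : Finsupp.single e 1 ≤ u := Finsupp.single_le_iff.2 (Nat.one_le_iff_ne_zero.2 h.1)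
  have hve : Finsupp.single e 1 ≤ v := Finsupp.single_le_iff.2 (Nat.one_le_iff_ne_zero.2 h.2)
  have hlt : u - Finsupp.single e 1 < u := by
    refine lt_of_le_of_ne tsub_le_self fun heq => h.1 ?_
    have := DFunLike.congr_fun heq e
    simp only [Finsupp.tsub_apply, Finsupp.single_eq_same] at this
    omega
  have heq : v - Finsupp.single e 1 = u - Finsupp.single e 1 :=
    hu.isRigid_of_lt hlt _ (by rw [degA_sub hue, degA_sub hve, hv])
  exact hne (by rw [← tsub_add_cancel_of_le hve, heq, tsub_add_cancel_of_le hue])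

theorem eq_zero_of_le_of_le (h : ∀ e, u e = 0 ∨ v e = 0) (hu : w ≤ u) (hv : w ≤ v) : w = 0 := by
  ext e
  have hue := hu e
  have hve := hv e
  rw [Finsupp.coe_zero, Pi.zero_apply]
  rcases h e with h | h <;> omega

/-- The binomial `x^a - x^b` of the toric ideal is primitive: its monomials are coprime and it has
no proper divisor `x^a' - x^b'` (meaning `x^a' ∣ x^a` and `x^b' ∣ x^b`) in that ideal. -/
structure IsPrimitivePair (A : σ → ι → ℤ) (a b : σ →₀ ℕ) : Prop where
  degA_eq : degA A a = degA A b
  eq_zero_or_eq_zero : ∀ e, a e = 0 ∨ b e = 0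
  eq_zero_or_eq : ∀ a' ≤ a, ∀ b' ≤ b, degA A a' = degA A b' →
    (a' = 0 ∧ b' = 0) ∨ (a' = a ∧ b' = b)

variable {a b : σ →₀ ℕ}

theorem IsPrimitivePair.symm (h : IsPrimitivePair A a b) : IsPrimitivePair A b a where
  degA_eq := h.degA_eq.symm
  eq_zero_or_eq_zero e := (h.eq_zero_or_eq_zero e).symm
  eq_zero_or_eq b' hb a' ha hd :=
    (h.eq_zero_or_eq a' ha b' hb hd.symm).imp And.symm And.symm

theorem IsPrimitivePair.not_isRigid_of_degA_add_eq (h : IsPrimitivePair A a b) (hu : u ≤ a)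
    (hv : v ≤ b) (hv0 : v ≠ 0) (hd : degA A (v + w) = degA A u) : ¬ IsRigid A u := by
  intro hr
  have hvu : v ≤ u := hr _ hd ▸ le_self_add
  exact hv0 (eq_zero_of_le_of_le h.eq_zero_or_eq_zero (hvu.trans hu) hv)

theorem IsCritical.isPrimitivePair (hA : ∀ u, degA A u = 0 → u = 0) (hu : IsCritical A u)
    (hv : degA A v = degA A u) (hne : v ≠ u) : IsPrimitivePair A u v := by
  have hcoprime := hu.eq_zero_or_eq_zero hv hne
  refine ⟨hv.symm, hcoprime, fun a ha b hb hab => ?_⟩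
  rcases ha.lt_or_eq with hlt | rfl
  · obtain rfl : b = a := hu.isRigid_of_lt hlt b hab.symm
    have h0 := eq_zero_of_le_of_le hcoprime ha hb
    exact Or.inl ⟨h0, h0⟩
  · exact Or.inr ⟨rfl, eq_of_le_of_degA_eq hA hb (hab.symm.trans hv.symm)⟩

theorem exists_isPrimitivePair_le (h : degA A u = degA A v) (hne : u ≠ v) :
    ∃ a ≤ u, ∃ b ≤ v, a ≠ b ∧ IsPrimitivePair A a b := by
  obtain ⟨⟨a, b⟩, ⟨hau, hbv⟩, ⟨hdeg, hab⟩, hmin⟩ :=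
    exists_minimal_le_of_wellFoundedLT
      (fun p : (σ →₀ ℕ) × (σ →₀ ℕ) => degA A p.1 = degA A p.2 ∧ p.1 ≠ p.2) (u, v) ⟨h, hne⟩
  dsimp only at hau hbv hdeg hab
  have hcoprime : ∀ e, a e = 0 ∨ b e = 0 := by
    intro e
    by_contra! he
    have hae : Finsupp.single e 1 ≤ a := Finsupp.single_le_iff.2 (Nat.one_le_iff_ne_zero.2 he.1)
    have hbe : Finsupp.single e 1 ≤ b := Finsupp.single_le_iff.2 (Nat.one_le_iff_ne_zero.2 he.2)
    have hle := @hmin (a - Finsupp.single e 1, b - Finsupp.single e 1)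
      ⟨by rw [degA_sub hae, degA_sub hbe, hdeg], fun heq => hab (by
        dsimp only at heq
        rw [← tsub_add_cancel_of_le hae, heq, tsub_add_cancel_of_le hbe])⟩
      ⟨tsub_le_self, tsub_le_self⟩
    have := hle.1 e
    simp only [Finsupp.tsub_apply, Finsupp.single_eq_same] at this
    omega
  refine ⟨a, hau, b, hbv, hab, hdeg, hcoprime, fun a' ha b' hb hd => ?_⟩
  by_cases heq : a' = b'
  · subst heq
    have h0 := eq_zero_of_le_of_le hcoprime ha hb
    exact Or.inl ⟨h0, h0⟩
  · have hle := @hmin (a', b') ⟨hd, heq⟩ ⟨ha, hb⟩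
    exact Or.inr ⟨ha.antisymm hle.1, hb.antisymm hle.2⟩

end Fibres

theorem eq_of_le_of_degree_le {σ : Type*} {u v : σ →₀ ℕ} (h : u ≤ v) (hdeg : v.degree ≤ u.degree) :
    u = v := by
  have hadd : (v - u).degree + u.degree = v.degree := by
    rw [← map_add, tsub_add_cancel_of_le h]
  have hzero : v - u = 0 := by
    rw [← Finsupp.degree_eq_zero_iff]
    omega
  exact h.antisymm (tsub_eq_zero_iff_le.1 hzero)

section EdgeMonomials

variable {V : Type*} {G : SimpleGraph V}

/-- The unit vector at the vertex `x`. -/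
def vertexVec (x : V) : V → ℤ :=
  Set.indicator {x} 1

theorem vertexVec_self (x : V) : vertexVec x x = 1 := by
  simp [vertexVec]

theorem vertexVec_of_ne {x y : V} (h : y ≠ x) : vertexVec x y = 0 := by
  simp [vertexVec, h]

theorem sum_vertexVec {T : Finset V} {x : V} (hx : x ∈ T) : ∑ y ∈ T, vertexVec x y = 1 := by
  rw [Finset.sum_eq_single_of_mem x hx fun y _ h => vertexVec_of_ne h, vertexVec_self]

theorem edgeVec_mk {x y : V} (h : G.Adj x y) :
    edgeVec G ⟨s(x, y), h⟩ = vertexVec x + vertexVec y := by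
  funext z
  by_cases hx : z = x
  · subst hx
    simp [edgeVec, vertexVec, h.ne]
  · by_cases hy : z = y
    · subst hy
      simp [edgeVec, vertexVec, h.ne.symm]
    · simp [edgeVec, vertexVec, hx, hy]

theorem edgeVec_of_mem {e : G.edgeSet} {x : V} (h : x ∈ (e : Sym2 V)) : edgeVec G e x = 1 := by
  simp [edgeVec, h]

theorem edgeVec_of_notMem {e : G.edgeSet} {x : V} (h : x ∉ (e : Sym2 V)) :
    edgeVec G e x = 0 := by
  simp [edgeVec, h]

theorem sum_edgeVec {T : Finset V} {e : G.edgeSet} (he : ∀ x ∈ (e : Sym2 V), x ∈ T) :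
    ∑ x ∈ T, edgeVec G e x = 2 := by
  obtain ⟨e, hadj⟩ := e
  induction e with
  | h x y =>
    rw [edgeVec_mk hadj]
    simp only [Pi.add_apply, Finset.sum_add_distrib, sum_vertexVec (he x (Sym2.mem_mk_left x y)),
      sum_vertexVec (he y (Sym2.mem_mk_right x y)), one_add_one_eq_two]

open Classical in
/-- The part of the monomial `x^u` made of the edges at the vertex `x`; its total degree is the
entry of the `A`-degree at `x`. -/
def edgesAt (u : G.edgeSet →₀ ℕ) (x : V) : G.edgeSet →₀ ℕ :=
  u.filter fun e => x ∈ (e : Sym2 V)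

theorem edgesAt_apply (u : G.edgeSet →₀ ℕ) {x : V} {e : G.edgeSet} (he : x ∈ (e : Sym2 V)) :
    edgesAt u x e = u e := by
  classical
  exact Finsupp.filter_apply_pos _ u he

theorem edgesAt_le_edgesAt {u v : G.edgeSet →₀ ℕ} {x : V}
    (h : ∀ e : G.edgeSet, x ∈ (e : Sym2 V) → u e ≤ v e) : edgesAt u x ≤ edgesAt v x := by
  classical
  intro e
  by_cases he : x ∈ (e : Sym2 V)
  · rw [edgesAt_apply u he, edgesAt_apply v he]
    exact h e he
  · exact ((Finsupp.filter_apply_neg _ u he).trans_le (Nat.zero_le _))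

open Classical in
theorem degA_edgeVec_apply (u : G.edgeSet →₀ ℕ) (x : V) :
    degA (edgeVec G) u x = (edgesAt u x).degree := by
  induction u using Finsupp.induction_linear with
  | zero => rw [degA_zero, edgesAt, Finsupp.filter_zero, map_zero, Nat.cast_zero, Pi.zero_apply]
  | add f g hf hg =>
    rw [degA_add, Pi.add_apply, hf, hg, edgesAt, edgesAt, edgesAt, Finsupp.filter_add, map_add,
      Nat.cast_add]
  | single e n =>
    rw [degA_single, Pi.smul_apply]
    by_cases he : x ∈ (e : Sym2 V)
    · rw [edgeVec_of_mem he, edgesAt,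
        Finsupp.filter_single_of_pos (fun f : G.edgeSet => x ∈ (f : Sym2 V)) he]
      simp
    · rw [edgeVec_of_notMem he, edgesAt,
        Finsupp.filter_single_of_neg (fun f : G.edgeSet => x ∈ (f : Sym2 V)) he]
      simp

theorem degA_apply_le {u v : G.edgeSet →₀ ℕ} {x : V}
    (h : ∀ e : G.edgeSet, x ∈ (e : Sym2 V) → u e ≤ v e) :
    degA (edgeVec G) u x ≤ degA (edgeVec G) v x := by
  rw [degA_edgeVec_apply, degA_edgeVec_apply]
  exact_mod_cast Finsupp.degree_mono (edgesAt_le_edgesAt h)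

theorem degA_mono : Monotone (degA (edgeVec G)) :=
  fun _ _ h _ => degA_apply_le fun e _ => h e

theorem eq_of_degA_apply_eq {u v : G.edgeSet →₀ ℕ} {x : V}
    (h : ∀ e : G.edgeSet, x ∈ (e : Sym2 V) → u e ≤ v e)
    (heq : degA (edgeVec G) u x = degA (edgeVec G) v x) {e : G.edgeSet}
    (he : x ∈ (e : Sym2 V)) : u e = v e := by
  rw [degA_edgeVec_apply, degA_edgeVec_apply, Nat.cast_inj] at heq
  rw [← edgesAt_apply u he, ← edgesAt_apply v he,
    eq_of_le_of_degree_le (edgesAt_le_edgesAt h) heq.ge]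

theorem exists_lt_of_degA_apply_lt {u v : G.edgeSet →₀ ℕ} {x : V}
    (h : degA (edgeVec G) u x < degA (edgeVec G) v x) :
    ∃ e : G.edgeSet, x ∈ (e : Sym2 V) ∧ u e < v e := by
  by_contra! hle
  exact h.not_ge (degA_apply_le hle)

theorem exists_pos_of_degA_apply_pos {u : G.edgeSet →₀ ℕ} {x : V}
    (h : 0 < degA (edgeVec G) u x) : ∃ e : G.edgeSet, x ∈ (e : Sym2 V) ∧ 0 < u e :=
  exists_lt_of_degA_apply_lt (u := 0) (by rwa [degA_zero])

theorem le_degA_apply (u : G.edgeSet →₀ ℕ) {e : G.edgeSet} {x : V} (he : x ∈ (e : Sym2 V)) :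
    (u e : ℤ) ≤ degA (edgeVec G) u x := by
  rw [degA_edgeVec_apply, ← edgesAt_apply u he]
  exact_mod_cast Finsupp.le_degree e _

theorem sum_degA {T : Finset V} {u : G.edgeSet →₀ ℕ}
    (hT : ∀ e ∈ u.support, ∀ x ∈ (e : Sym2 V), x ∈ T) :
    ∑ x ∈ T, degA (edgeVec G) u x = 2 * (u.degree : ℤ) := by
  simp only [degA, Finsupp.linearCombination_apply, Finsupp.sum, Finset.sum_apply, Pi.smul_apply]
  rw [Finset.sum_comm, Finsupp.degree_apply, Nat.cast_sum, Finset.mul_sum]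
  refine Finset.sum_congr rfl fun e he => ?_
  rw [← Finset.smul_sum, sum_edgeVec (hT e he), nsmul_eq_mul, mul_comm]

theorem degree_eq_of_degA_eq {u v : G.edgeSet →₀ ℕ}
    (h : degA (edgeVec G) u = degA (edgeVec G) v) : u.degree = v.degree := by
  classical
  let T : Finset V := (u.support ∪ v.support).biUnion fun e => (e : Sym2 V).toFinset
  have hT : ∀ e ∈ u.support ∪ v.support, ∀ x ∈ (e : Sym2 V), x ∈ T := fun e he x hx =>
    Finset.mem_biUnion.2 ⟨e, he, Sym2.mem_toFinset.2 hx⟩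
  have hu := sum_degA fun e he => hT e (Finset.mem_union_left _ he)
  have hv := sum_degA fun e he => hT e (Finset.mem_union_right _ he)
  rw [h] at hu
  have := hu.symm.trans hv
  omega

theorem eq_zero_of_degA_edgeVec_eq_zero (u : G.edgeSet →₀ ℕ) (h : degA (edgeVec G) u = 0) :
    u = 0 := by
  rw [← Finsupp.degree_eq_zero_iff, ← map_zero Finsupp.degree]
  exact degree_eq_of_degA_eq (h.trans degA_zero.symm)

end EdgeMonomials

/-! ### Alternating walks -/

section WalkMonomials

variable {V : Type*} {G : SimpleGraph V} {X Y : G.edgeSet →₀ ℕ} {x y : V}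

/-- The edge of `w` at position `i`; this is `walkEdge` for walks that need not be closed. -/
def edgeAt (w : G.Walk x y) (i : Fin w.length) : G.edgeSet :=
  ⟨s(w.getVert i, w.getVert (i + 1)), w.adj_getVert_succ i.2⟩

/-- The product of the edges at the positions `0, 2, 4, …`, which are the odd edges of `w` in the
one-based numbering. -/
def evenPart (w : G.Walk x y) : G.edgeSet →₀ ℕ :=
  ∑ i : Fin w.length with Even i.val, Finsupp.single (edgeAt w i) 1

/-- The product of the edges at the positions `1, 3, 5, …`. -/
def oddPart (w : G.Walk x y) : G.edgeSet →₀ ℕ :=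
  ∑ i : Fin w.length with Odd i.val, Finsupp.single (edgeAt w i) 1

theorem walkBinomial_eq (K : Type*) [Field K] (w : G.Walk x x) :
    walkBinomial K w = MvPolynomial.monomial (evenPart w) 1
      - MvPolynomial.monomial (oddPart w) 1 := by
  rw [walkBinomial, evenPart, oddPart, MvPolynomial.monomial_sum_one,
    MvPolynomial.monomial_sum_one]
  rfl

open SimpleGraph.Walk (cons nil)

theorem evenPart_nil : evenPart (nil : G.Walk x x) = 0 :=
  rfl

theorem oddPart_nil : oddPart (nil : G.Walk x x) = 0 :=
  rfl

theorem evenPart_cons {z : V} (h : G.Adj z x) (w : G.Walk x y) :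
    evenPart (cons h w) = Finsupp.single ⟨s(z, x), h⟩ 1 + oddPart w := by
  rw [evenPart, oddPart, Finset.sum_filter, Finset.sum_filter]
  refine (Fin.sum_univ_succ (n := w.length) _).trans ?_
  congr 1
  · simp [edgeAt]
  · refine Finset.sum_congr rfl fun i _ => ?_
    simp [Nat.even_add_one, edgeAt]

theorem oddPart_cons {z : V} (h : G.Adj z x) (w : G.Walk x y) :
    oddPart (cons h w) = evenPart w := by
  rw [evenPart, oddPart, Finset.sum_filter, Finset.sum_filter]
  refine (Fin.sum_univ_succ (n := w.length) _).trans ?_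
  rw [if_neg (by simp), zero_add]
  refine Finset.sum_congr rfl fun i _ => ?_
  simp [Nat.odd_add_one, edgeAt]

theorem degA_evenPart_sub_degA_oddPart (w : G.Walk x y) :
    degA (edgeVec G) (evenPart w) - degA (edgeVec G) (oddPart w)
      = vertexVec x - (-1) ^ w.length * vertexVec y := by
  induction w with
  | nil => simp [evenPart_nil, oddPart_nil]
  | cons h w ih =>
    rw [evenPart_cons, oddPart_cons, degA_add, degA_single, one_smul, edgeVec_mk,
      SimpleGraph.Walk.length_cons, pow_succ]
    linear_combination -ih

theorem degA_evenPart_eq_degA_oddPart {w : G.Walk x x} (hw : Even w.length) :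
    degA (edgeVec G) (evenPart w) = degA (edgeVec G) (oddPart w) := by
  rw [← sub_eq_zero, degA_evenPart_sub_degA_oddPart, hw.neg_one_pow, one_mul, sub_self]

theorem degree_evenPart_add_degree_oddPart (w : G.Walk x y) :
    (evenPart w).degree + (oddPart w).degree = w.length := by
  induction w with
  | nil => simp [evenPart_nil, oddPart_nil]
  | cons h w ih =>
    rw [evenPart_cons, oddPart_cons, map_add, Finsupp.degree_single, SimpleGraph.Walk.length_cons]
    omega

/-- The edges of `w` are taken alternately from the monomials `X` and `Y`, with multiplicity. -/
def IsAlternating (X Y : G.edgeSet →₀ ℕ) (w : G.Walk x y) : Prop :=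
  (evenPart w ≤ X ∧ oddPart w ≤ Y) ∨ (evenPart w ≤ Y ∧ oddPart w ≤ X)

theorem IsAlternating.length_le {w : G.Walk x y} (h : IsAlternating X Y w) :
    w.length ≤ X.degree + Y.degree := by
  rw [← degree_evenPart_add_degree_oddPart]
  rcases h with ⟨h₁, h₂⟩ | ⟨h₁, h₂⟩
  · exact add_le_add (Finsupp.degree_mono h₁) (Finsupp.degree_mono h₂)
  · exact (add_le_add (Finsupp.degree_mono h₁) (Finsupp.degree_mono h₂)).trans_eq (add_comm _ _)

/-- The first edge of `w` makes `deg X` exceed the part of `deg Y` used up by `w` at `x`, so that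
`Y` has an unused edge at `x`. -/
theorem exists_cons_le (hXY : degA (edgeVec G) X = degA (edgeVec G) Y) {w : G.Walk x y}
    (hX : evenPart w ≤ X) (hY : oddPart w ≤ Y) (hodd : x = y → Odd w.length) :
    ∃ (z : V) (h : G.Adj z x), evenPart (cons h w) ≤ Y ∧ oddPart (cons h w) ≤ X := by
  classical
  have hlt : degA (edgeVec G) (oddPart w) x < degA (edgeVec G) Y x := by
    refine lt_of_lt_of_le ?_ (hXY ▸ degA_mono hX x)
    have hdiff := congrFun (degA_evenPart_sub_degA_oddPart w) x
    simp only [Pi.sub_apply, Pi.mul_apply, Pi.pow_apply, Pi.neg_apply, Pi.one_apply,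
      vertexVec_self] at hdiff
    by_cases hxy : x = y
    · rw [(hodd hxy).neg_one_pow, show vertexVec y x = 1 by rw [hxy, vertexVec_self]] at hdiff
      omega
    · rw [vertexVec_of_ne hxy] at hdiff
      omega
  obtain ⟨⟨e, he⟩, hxe, hlt⟩ := exists_lt_of_degA_apply_lt hlt
  obtain ⟨z, rfl⟩ := Sym2.mem_iff_exists.1 hxe
  have hadj : G.Adj z x := G.adj_symm he
  have heq : (⟨s(z, x), hadj⟩ : G.edgeSet) = ⟨s(x, z), he⟩ := Subtype.ext Sym2.eq_swap
  refine ⟨z, hadj, ?_, (oddPart_cons hadj w).trans_le hX⟩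
  rw [evenPart_cons, heq]
  intro f
  rw [Finsupp.add_apply, Finsupp.single_apply]
  split_ifs with hf
  · subst hf
    omega
  · simpa using hY f

theorem exists_isAlternating_cons (hXY : degA (edgeVec G) X = degA (edgeVec G) Y)
    {w : G.Walk x y} (hw : IsAlternating X Y w) (hodd : x = y → Odd w.length) :
    ∃ (z : V) (h : G.Adj z x), IsAlternating X Y (cons h w) := by
  rcases hw with ⟨h₁, h₂⟩ | ⟨h₁, h₂⟩
  · obtain ⟨z, h, hz⟩ := exists_cons_le hXY h₁ h₂ hodd
    exact ⟨z, h, Or.inr hz⟩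
  · obtain ⟨z, h, hz⟩ := exists_cons_le hXY.symm h₁ h₂ hodd
    exact ⟨z, h, Or.inl hz⟩

theorem exists_isAlternating_of_ne_zero (hX : X ≠ 0) :
    ∃ (x y : V) (w : G.Walk x y), 0 < w.length ∧ IsAlternating X Y w := by
  obtain ⟨⟨e, hadj⟩, he⟩ := Finsupp.ne_iff.1 hX
  induction e with
  | h x y =>
    refine ⟨x, y, cons (G.mem_edgeSet.1 hadj) nil, by simp, Or.inl ⟨?_, ?_⟩⟩
    · rw [evenPart_cons, oddPart_nil, add_zero, Finsupp.single_le_iff]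
      exact Nat.one_le_iff_ne_zero.2 he
    · rw [oddPart_cons, evenPart_nil]
      exact zero_le

/-- A longest alternating walk must be closed and of even length. -/
theorem exists_even_closed_isAlternating (hXY : degA (edgeVec G) X = degA (edgeVec G) Y)
    (hX : X ≠ 0) :
    ∃ (x : V) (w : G.Walk x x), Even w.length ∧ 0 < w.length ∧ IsAlternating X Y w := by
  by_contra! hno
  have hlong : ∀ n, ∃ (x y : V) (w : G.Walk x y), n < w.length ∧ IsAlternating X Y w := by
    intro n
    induction n with
    | zero => exact exists_isAlternating_of_ne_zero hX
    | succ n ih =>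
      obtain ⟨x, y, w, hlen, hw⟩ := ih
      have hodd : x = y → Odd w.length := by
        rintro rfl
        by_contra heven
        exact hno x w (Nat.not_odd_iff_even.1 heven) (by omega) hw
      obtain ⟨z, h, hz⟩ := exists_isAlternating_cons hXY hw hodd
      exact ⟨z, y, _, by rw [SimpleGraph.Walk.length_cons]; omega, hz⟩
  obtain ⟨x, y, w, hlen, hw⟩ := hlong (X.degree + Y.degree)
  exact hlen.not_ge hw.length_le

end WalkMonomials

/-! ### Induced lollipops -/

section Lollipop

open SimpleGraph

variable {V W : Type*} {G : SimpleGraph V} {H : SimpleGraph W} {u v w : V}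

theorem start_notMem_support_tail {p : G.Walk u v} (hp : p.IsPath) : u ∉ p.support.tail :=
  (List.nodup_cons.1 (p.cons_tail_support.symm ▸ hp.support_nodup)).1

theorem isPath_append {p : G.Walk u v} {q : G.Walk v w} (hp : p.IsPath) (hq : q.IsPath)
    (h : ∀ a ∈ p.support, a ∈ q.support → a = v) : (p.append q).IsPath := by
  rw [Walk.isPath_def, Walk.support_append, List.nodup_append]
  refine ⟨hp.support_nodup, hq.support_nodup.tail, ?_⟩
  rintro a ha _ hb rfl
  exact start_notMem_support_tail hq (h a ha (List.mem_of_mem_tail hb) ▸ hb)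

theorem dist_getVert_of_length_eq_dist {q : G.Walk v w} (hq : q.length = G.dist v w) {r : ℕ}
    (hr : r ≤ q.length) : G.dist v (q.getVert r) = r := by
  have htake := dist_le (q.take r)
  have hdrop := dist_le (q.drop r)
  have htri := Reachable.dist_triangle_left (q.take r).reachable w
  rw [Walk.take_length] at htake
  rw [Walk.drop_length] at hdrop
  omega

theorem eq_of_dist_eq_of_mem_support {q : G.Walk v w} (hq : q.length = G.dist v w) {a b : V}
    (ha : a ∈ q.support) (hb : b ∈ q.support) (h : G.dist v a = G.dist v b) : a = b := by
  obtain ⟨i, rfl, hi⟩ := Walk.mem_support_iff_exists_getVert.1 ha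
  obtain ⟨j, rfl, hj⟩ := Walk.mem_support_iff_exists_getVert.1 hb
  rw [dist_getVert_of_length_eq_dist hq hi, dist_getVert_of_length_eq_dist hq hj] at h
  rw [h]

theorem isInduced_of_length_eq_dist {q : G.Walk v w} (hq : q.length = G.dist v w) :
    q.toSubgraph.IsInduced := by
  intro a ha b hb hab
  obtain ⟨i, rfl, hi⟩ := Walk.mem_support_iff_exists_getVert.1 (q.mem_verts_toSubgraph.1 ha)
  obtain ⟨j, rfl, hj⟩ := Walk.mem_support_iff_exists_getVert.1 (q.mem_verts_toSubgraph.1 hb)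
  have hne : i ≠ j := fun h => hab.ne (congrArg q.getVert h)
  have h := hab.diff_dist_adj (u := v)
  rw [dist_getVert_of_length_eq_dist hq hi, dist_getVert_of_length_eq_dist hq hj] at h
  obtain rfl | rfl : j = i + 1 ∨ i = j + 1 := by omega
  · exact q.toSubgraph_adj_getVert hj
  · exact (q.toSubgraph_adj_getVert hi).symm

/-- If adjacent vertices always had distances of different parity from `v`, then every walk would
change the parity of the distance as often as it has edges. -/
theorem exists_adj_dist_eq (c : G.Walk v v) (hc : Odd c.length) :
    ∃ x y, G.Adj x y ∧ G.Reachable v x ∧ G.dist v x = G.dist v y := by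
  by_contra! hno
  have heven : ∀ {x y : V} (p : G.Walk x y), G.Reachable v x →
      Even (p.length + G.dist v x + G.dist v y) := by
    intro x y p
    induction p with
    | nil => intro _; simp
    | cons h p ih =>
      intro hr
      have := ih (hr.trans h.reachable)
      have := hno _ _ h hr
      have := h.diff_dist_adj (u := v)
      rw [Walk.length_cons]
      grind
  have := heven c (Reachable.refl v)
  rw [dist_self, add_zero, add_zero] at this
  exact (Nat.not_even_iff_odd.2 hc) this

theorem isInduced_sup {A B : G.Subgraph} (hA : A.IsInduced) (hB : B.IsInduced)
    (h : ∀ a ∈ A.verts, ∀ b ∈ B.verts, G.Adj a b → a ∈ B.verts ∨ b ∈ A.verts) :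
    (A ⊔ B).IsInduced := by
  have hcross : ∀ a ∈ A.verts, ∀ b ∈ B.verts, G.Adj a b → (A ⊔ B).Adj a b :=
    fun a ha b hb hab => (h a ha b hb hab).elim
      (fun ha' => Or.inr (hB ha' hb hab)) fun hb' => Or.inl (hA ha hb' hab)
  rintro a (ha | ha) b (hb | hb) hab
  · exact Or.inl (hA ha hb hab)
  · exact hcross a ha b hb hab
  · exact (hcross b hb a ha hab.symm).symm
  · exact Or.inr (hB ha hb hab)

theorem isInduced_map (f : G ↪g H) {A : G.Subgraph} (hA : A.IsInduced) :
    (A.map f.toHom).IsInduced := by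
  rintro _ ⟨a, ha, rfl⟩ _ ⟨b, hb, rfl⟩ hab
  exact ⟨a, b, hA ha hb (f.map_adj_iff.1 hab), rfl, rfl⟩

/-- Two geodesics from `v` to adjacent vertices at the same distance from `v`, with a common
initial segment `stem`. -/
structure GeodesicFork (G : SimpleGraph V) (v : V) where
  {x y z : V}
  stem : G.Walk v z
  left : G.Walk z x
  right : G.Walk z y
  adj : G.Adj x y
  left_geodesic : (stem.append left).length = G.dist v x
  right_geodesic : (stem.append right).length = G.dist v y
  dist_eq : G.dist v x = G.dist v y

namespace GeodesicFork

variable (F : GeodesicFork G v)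

/-- The number of edges of the two geodesics, the stem counted once. -/
def size : ℕ :=
  F.stem.length + F.left.length + F.right.length

/-- The fork with the two prongs exchanged. -/
def swap : GeodesicFork G v where
  stem := F.stem
  left := F.right
  right := F.left
  adj := F.adj.symm
  left_geodesic := F.right_geodesic
  right_geodesic := F.left_geodesic
  dist_eq := F.dist_eq.symm

theorem size_swap : F.swap.size = F.size :=
  add_right_comm _ _ _

theorem length_left_eq : F.left.length = F.right.length := by
  have hl := F.left_geodesic
  have hr := F.right_geodesic
  have := F.dist_eq
  rw [Walk.length_append] at hl hr
  omega

theorem length_left_pos : 0 < F.left.length := by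
  by_contra! h
  have hlen := F.length_left_eq
  exact F.adj.ne ((Walk.eq_of_length_eq_zero (p := F.left) (by omega)).symm.trans
    (Walk.eq_of_length_eq_zero (p := F.right) (by omega)))

theorem dist_left {r : ℕ} (hr : r ≤ F.left.length) :
    G.dist v (F.left.getVert r) = F.stem.length + r := by
  have := dist_getVert_of_length_eq_dist F.left_geodesic (r := F.stem.length + r)
    (by rw [Walk.length_append]; omega)
  rwa [Walk.getVert_append, if_neg (by omega), Nat.add_sub_cancel_left] at this

theorem dist_right {r : ℕ} (hr : r ≤ F.left.length) :
    G.dist v (F.right.getVert r) = F.stem.length + r :=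
  F.swap.dist_left (hr.trans_eq F.length_left_eq)

/-- No fork from `v` has smaller size. -/
def IsMinimal : Prop :=
  ∀ F' : GeodesicFork G v, F.size ≤ F'.size

variable {F}

theorem IsMinimal.swap (hF : F.IsMinimal) : F.swap.IsMinimal :=
  fun F' => F.size_swap.trans_le (hF F')

theorem exists_isMinimal (c : G.Walk v v) (hc : Odd c.length) :
    ∃ F : GeodesicFork G v, F.IsMinimal := by
  obtain ⟨x, y, hadj, hreach, hdist⟩ := exists_adj_dist_eq c hc
  obtain ⟨p, hp⟩ := hreach.exists_walk_length_eq_dist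
  obtain ⟨q, hq⟩ := (hreach.trans hadj.reachable).exists_walk_length_eq_dist
  let F : GeodesicFork G v := ⟨Walk.nil, p, q, hadj, by simpa using hp, by simpa using hq, hdist⟩
  obtain ⟨F', -, hmin⟩ := exists_minimalFor_of_wellFoundedLT (fun _ => True) size ⟨F, trivial⟩
  exact ⟨F', fun F'' => (le_total _ _).elim id (hmin trivial)⟩

/-- A geodesic to `y` through a later vertex of the left prong would give a fork with a longer
stem. -/
theorem IsMinimal.length_ne (hF : F.IsMinimal) {r : ℕ} (hr : 0 < r) (hr' : r ≤ F.left.length)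
    (q : G.Walk (F.left.getVert r) F.y) : r + q.length ≠ F.left.length := by
  intro hq
  have hl := F.left_geodesic
  have hr₂ := F.right_geodesic
  have hlen := F.length_left_eq
  rw [Walk.length_append] at hl hr₂
  have hmin := hF
    { stem := F.stem.append (F.left.take r)
      left := F.left.drop r
      right := q
      adj := F.adj
      left_geodesic := by
        simp only [Walk.length_append, Walk.take_length, Walk.drop_length]
        omega
      right_geodesic := by
        simp only [Walk.length_append, Walk.take_length]
        omega
      dist_eq := F.dist_eq }
  simp only [size, Walk.length_append, Walk.take_length, Walk.drop_length] at hmin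
  omega

theorem IsMinimal.getVert_ne (hF : F.IsMinimal) {r : ℕ} (hr : 0 < r) (hr' : r ≤ F.left.length) :
    F.left.getVert r ≠ F.right.getVert r := by
  intro heq
  refine hF.length_ne hr hr' ((F.right.drop r).copy heq.symm rfl) ?_
  rw [Walk.length_copy, Walk.drop_length, ← F.length_left_eq]
  omega

theorem IsMinimal.not_adj_getVert_succ (hF : F.IsMinimal) {r : ℕ} (hr : 0 < r)
    (hr' : r < F.left.length) : ¬ G.Adj (F.left.getVert r) (F.right.getVert (r + 1)) := by
  intro hadj
  refine hF.length_ne hr hr'.le (Walk.cons hadj (F.right.drop (r + 1))) ?_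
  rw [Walk.length_cons, Walk.drop_length, ← F.length_left_eq]
  omega

theorem IsMinimal.not_adj_getVert (hF : F.IsMinimal) {r : ℕ} (hr : r < F.left.length) :
    ¬ G.Adj (F.left.getVert r) (F.right.getVert r) := by
  intro hadj
  have hlen := F.length_left_eq
  have hmin := hF
    { stem := F.stem
      left := F.left.take r
      right := F.right.take r
      adj := hadj
      left_geodesic := by
        rw [F.dist_left hr.le, Walk.length_append, Walk.take_length]
        omega
      right_geodesic := by
        rw [F.dist_right hr.le, Walk.length_append, Walk.take_length]
        omega
      dist_eq := (F.dist_left hr.le).trans (F.dist_right hr.le).symm }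
  simp only [size, Walk.take_length] at hmin
  omega

variable (F)

/-- The two geodesics together with the edge joining their ends. -/
def toSubgraph : G.Subgraph :=
  (F.stem.append F.left).toSubgraph ⊔ (F.stem.append F.right).toSubgraph ⊔ G.subgraphOfAdj F.adj

theorem toSubgraph_swap : F.swap.toSubgraph = F.toSubgraph := by
  rw [toSubgraph, toSubgraph, ← subgraphOfAdj_symm F.adj,
    sup_comm (F.stem.append F.left).toSubgraph]
  rfl

theorem mem_verts_toSubgraph {a : V} : a ∈ F.toSubgraph.verts ↔
    a ∈ (F.stem.append F.left).support ∨ a ∈ (F.stem.append F.right).support := by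
  simp only [toSubgraph, Subgraph.verts_sup, Set.mem_union, Walk.mem_verts_toSubgraph,
    subgraphOfAdj_verts, Set.mem_insert_iff, Set.mem_singleton_iff]
  constructor
  · rintro (h | rfl | rfl)
    · exact h
    · exact Or.inl (Walk.end_mem_support _)
    · exact Or.inr (Walk.end_mem_support _)
  · exact Or.inl

variable {F}

theorem IsMinimal.adj_of_dist_eq (hF : F.IsMinimal) {a b : V}
    (ha : a ∈ (F.stem.append F.left).support) (hb : b ∈ (F.stem.append F.right).support)
    (hab : G.Adj a b) (h : G.dist v a = G.dist v b) : F.toSubgraph.Adj a b := by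
  have hlen := F.length_left_eq
  obtain ⟨i, rfl, hi⟩ := Walk.mem_support_iff_exists_getVert.1 ha
  obtain ⟨j, rfl, hj⟩ := Walk.mem_support_iff_exists_getVert.1 hb
  rw [dist_getVert_of_length_eq_dist F.left_geodesic hi,
    dist_getVert_of_length_eq_dist F.right_geodesic hj] at h
  subst h
  rw [Walk.length_append] at hi
  rw [Walk.getVert_append, Walk.getVert_append] at hab ⊢
  split_ifs at hab ⊢ with hlt
  · exact absurd rfl hab.ne
  · have hr : i - F.stem.length = F.left.length := by
      by_contra hne
      exact hF.not_adj_getVert (by omega) hab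
    rw [hr, F.left.getVert_length, hlen, F.right.getVert_length]
    exact Or.inr rfl

theorem IsMinimal.adj_of_dist_eq_succ (hF : F.IsMinimal) {a b : V}
    (ha : a ∈ (F.stem.append F.left).support) (hb : b ∈ (F.stem.append F.right).support)
    (hab : G.Adj a b) (h : G.dist v b = G.dist v a + 1) : F.toSubgraph.Adj a b := by
  have hlen := F.length_left_eq
  obtain ⟨i, rfl, hi⟩ := Walk.mem_support_iff_exists_getVert.1 ha
  obtain ⟨j, rfl, hj⟩ := Walk.mem_support_iff_exists_getVert.1 hb
  rw [dist_getVert_of_length_eq_dist F.left_geodesic hi,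
    dist_getVert_of_length_eq_dist F.right_geodesic hj] at h
  subst h
  by_cases hlt : F.stem.length < i
  · rw [Walk.length_append] at hi hj
    rw [Walk.getVert_append, Walk.getVert_append, if_neg (by omega), if_neg (by omega),
      Nat.sub_add_comm hlt.le] at hab
    exact absurd hab (hF.not_adj_getVert_succ (by omega) (by omega))
  · have hi' : (F.stem.append F.left).getVert i = (F.stem.append F.right).getVert i := by
      simp only [Walk.getVert_append', if_pos (not_lt.1 hlt)]
    rw [hi']
    exact Or.inl (Or.inr (Walk.toSubgraph_adj_getVert _ hj))

theorem IsMinimal.adj_of_mem_left_of_mem_right (hF : F.IsMinimal) {a b : V}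
    (ha : a ∈ (F.stem.append F.left).support) (hb : b ∈ (F.stem.append F.right).support)
    (hab : G.Adj a b) : F.toSubgraph.Adj a b := by
  rcases hab.diff_dist_adj (u := v) with h | h | h
  · exact hF.adj_of_dist_eq ha hb hab h.symm
  · exact hF.adj_of_dist_eq_succ ha hb hab h
  · have hpos : G.dist v a ≠ 0 ∨ G.dist v a = G.dist v b := by omega
    rcases hpos with hpos | heq
    · rw [← F.toSubgraph_swap]
      exact (hF.swap.adj_of_dist_eq_succ hb ha hab.symm (by omega)).symm
    · exact hF.adj_of_dist_eq ha hb hab heq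

theorem IsMinimal.isInduced (hF : F.IsMinimal) : F.toSubgraph.IsInduced := by
  intro a ha b hb hab
  rw [mem_verts_toSubgraph] at ha hb
  rcases ha with ha | ha <;> rcases hb with hb | hb
  · exact Or.inl (Or.inl (isInduced_of_length_eq_dist F.left_geodesic
      ((Walk.mem_verts_toSubgraph _).2 ha) ((Walk.mem_verts_toSubgraph _).2 hb) hab))
  · exact hF.adj_of_mem_left_of_mem_right ha hb hab
  · exact (hF.adj_of_mem_left_of_mem_right hb ha hab.symm).symm
  · exact Or.inl (Or.inr (isInduced_of_length_eq_dist F.right_geodesic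
      ((Walk.mem_verts_toSubgraph _).2 ha) ((Walk.mem_verts_toSubgraph _).2 hb) hab))

variable (F)

/-- The closed walk formed by the prongs of a fork and the edge joining their ends. -/
def cycle : G.Walk F.z F.z :=
  F.right.append (Walk.cons F.adj.symm F.left.reverse)

theorem odd_length_cycle : Odd F.cycle.length := by
  rw [cycle, Walk.length_append, Walk.length_cons, Walk.length_reverse, F.length_left_eq]
  exact ⟨F.right.length, by ring⟩

theorem mem_support_cycle {a : V} :
    a ∈ F.cycle.support ↔ a ∈ F.left.support ∨ a ∈ F.right.support := by
  have hy : F.y ∈ F.right.support := Walk.end_mem_support _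
  simp only [cycle, Walk.mem_support_append_iff, Walk.support_cons, Walk.support_reverse,
    List.mem_cons, List.mem_reverse]
  grind

theorem toSubgraph_cycle : F.stem.toSubgraph ⊔ F.cycle.toSubgraph = F.toSubgraph := by
  rw [toSubgraph, cycle, Walk.toSubgraph_append, Walk.toSubgraph_append, Walk.toSubgraph_append,
    Walk.toSubgraph, Walk.toSubgraph_reverse, subgraphOfAdj_symm, sup_sup_sup_comm, sup_idem]
  · ac_rfl
  · exact F.adj

theorem isPath_stem : F.stem.IsPath :=
  (Walk.isPath_of_length_eq_dist _ F.left_geodesic).of_append_left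

theorem eq_of_mem_stem_of_mem_left {a : V} (ha : a ∈ F.stem.support) (ha' : a ∈ F.left.support) :
    a = F.z := by
  obtain ⟨i, rfl, hi⟩ := Walk.mem_support_iff_exists_getVert.1 ha
  obtain ⟨j, hj, hj'⟩ := Walk.mem_support_iff_exists_getVert.1 ha'
  have hdist := dist_getVert_of_length_eq_dist F.left_geodesic (r := i)
    (by rw [Walk.length_append]; omega)
  rw [Walk.getVert_append', if_pos hi, ← hj, F.dist_left hj'] at hdist
  obtain rfl : i = F.stem.length := by omega
  exact F.stem.getVert_length

variable {F}

theorem IsMinimal.eq_of_mem_left_of_mem_right (hF : F.IsMinimal) {a : V}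
    (ha : a ∈ F.left.support) (ha' : a ∈ F.right.support) : a = F.z := by
  obtain ⟨i, rfl, hi⟩ := Walk.mem_support_iff_exists_getVert.1 ha
  obtain ⟨j, hij, hj⟩ := Walk.mem_support_iff_exists_getVert.1 ha'
  have hdist := F.dist_left hi
  rw [← hij, F.dist_right (hj.trans_eq F.length_left_eq.symm)] at hdist
  obtain rfl : j = i := by omega
  rcases Nat.eq_zero_or_pos j with rfl | hpos
  · exact F.left.getVert_zero
  · exact absurd hij.symm (hF.getVert_ne hpos hi)

theorem IsMinimal.isCycle (hF : F.IsMinimal) : F.cycle.IsCycle := by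
  have hleft := (Walk.isPath_of_length_eq_dist _ F.left_geodesic).of_append_right
  have hright := (Walk.isPath_of_length_eq_dist _ F.right_geodesic).of_append_right
  have hy : F.y ∉ F.left.support := fun h => by
    have hyl := Walk.support_subset_support_append_right F.stem _ h
    exact F.adj.ne' (eq_of_dist_eq_of_mem_support F.left_geodesic hyl (Walk.end_mem_support _)
      F.dist_eq.symm)
  refine hright.isCycle_append (hleft.reverse.cons (by simpa using hy)) ?_
    (Or.inr (by simpa using F.length_left_pos))
  intro a ha hb
  rw [Walk.support_cons, List.tail_cons, Walk.support_reverse, List.mem_reverse] at hb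
  obtain rfl := hF.eq_of_mem_left_of_mem_right hb (List.mem_of_mem_tail ha)
  exact start_notMem_support_tail hright ha

end GeodesicFork

/-- An odd cycle together with a path `stem` from `v` to it, forming an induced subgraph. -/
structure InducedLollipop (G : SimpleGraph V) (v : V) where
  {joint : V}
  stem : G.Walk v joint
  cycle : G.Walk joint joint
  isPath : stem.IsPath
  isCycle : cycle.IsCycle
  odd_length : Odd cycle.length
  eq_joint : ∀ a ∈ stem.support, a ∈ cycle.support → a = joint
  isInduced : (stem.toSubgraph ⊔ cycle.toSubgraph).IsInduced

namespace InducedLollipop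

theorem nonempty_of_odd_closed_walk (c : G.Walk v v) (hc : Odd c.length) :
    Nonempty (InducedLollipop G v) := by
  obtain ⟨F, hF⟩ := GeodesicFork.exists_isMinimal c hc
  exact ⟨{
    stem := F.stem
    cycle := F.cycle
    isPath := F.isPath_stem
    isCycle := hF.isCycle
    odd_length := F.odd_length_cycle
    eq_joint := fun a ha hb => (F.mem_support_cycle.1 hb).elim (F.eq_of_mem_stem_of_mem_left ha)
      (F.swap.eq_of_mem_stem_of_mem_left ha)
    isInduced := F.toSubgraph_cycle ▸ hF.isInduced }⟩

/-- The union of stem and cycle. -/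
def toSubgraph (L : InducedLollipop G v) : G.Subgraph :=
  L.stem.toSubgraph ⊔ L.cycle.toSubgraph

/-- The image of a lollipop under a graph embedding. -/
def map (f : G ↪g H) (L : InducedLollipop G v) : InducedLollipop H (f v) where
  stem := L.stem.map f.toHom
  cycle := L.cycle.map f.toHom
  isPath := L.isPath.map f.injective
  isCycle := L.isCycle.map f.injective
  odd_length := by simpa using L.odd_length
  eq_joint := by
    simp only [Walk.support_map, List.mem_map]
    rintro _ ⟨a, ha, rfl⟩ ⟨b, hb, hab⟩
    obtain rfl := f.injective hab
    exact congrArg f (L.eq_joint b ha hb)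
  isInduced := by
    rw [Walk.toSubgraph_map, Walk.toSubgraph_map, ← Subgraph.map_sup]
    exact isInduced_map f L.isInduced

end InducedLollipop

end Lollipop

section Sharp

open SimpleGraph

variable {V : Type*} {G : SimpleGraph V} {u v v₁ v₂ : V} {S S₁ S₂ U : Set V}

theorem InducedLollipop.exists_verts_subset (c : G.Walk v v) (hc : Odd c.length)
    (hS : ∀ a ∈ c.support, a ∈ S) : ∃ L : InducedLollipop G v, L.toSubgraph.verts ⊆ S := by
  obtain ⟨L⟩ := nonempty_of_odd_closed_walk (c.induce S hS)
    (by rwa [← Walk.length_map, Walk.map_induce])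
  refine ⟨L.map (Embedding.induce S), ?_⟩
  rintro a (ha | ha) <;> obtain ⟨b, -, rfl⟩ := List.mem_map.1
    (Walk.support_map _ _ ▸ (Walk.mem_verts_toSubgraph _).1 ha)
  exacts [b.2, b.2]

theorem InducedLollipop.mem_verts_toSubgraph (L : InducedLollipop G v) {a : V} :
    a ∈ L.toSubgraph.verts ↔ a ∈ L.stem.support ∨ a ∈ L.cycle.support := by
  simp only [toSubgraph, Subgraph.verts_sup, Set.mem_union, Walk.mem_verts_toSubgraph]

theorem exists_isPath_isInduced (q : G.Walk u v) (hU : ∀ a ∈ q.support, a ∈ U) :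
    ∃ r : G.Walk u v, r.IsPath ∧ r.toSubgraph.IsInduced ∧ r.toSubgraph.verts ⊆ U := by
  obtain ⟨r, hr⟩ := (q.induce U hU).reachable.exists_walk_length_eq_dist
  let f : G.induce U ↪g G := Embedding.induce U
  have hind : (r.map f.toHom).toSubgraph.IsInduced := by
    rw [Walk.toSubgraph_map]
    exact isInduced_map f (isInduced_of_length_eq_dist hr)
  have hverts : (r.map f.toHom).toSubgraph.verts ⊆ U := by
    rw [Walk.toSubgraph_map]
    rintro _ ⟨a, -, rfl⟩
    exact a.2
  exact ⟨r.map f.toHom, (r.isPath_of_length_eq_dist hr).map f.injective, hind, hverts⟩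

/-- The edges of `G` from `S` to the rest of `U` all start at `v`. -/
def IsCutOffAt (G : SimpleGraph V) (U S : Set V) (v : V) : Prop :=
  ∀ a ∈ S, ∀ b ∈ U, b ∉ S → G.Adj a b → a = v

theorem IsCutOffAt.eq_of_mem (hcut : IsCutOffAt G U S u) {r : G.Walk u v} (hr : r.IsPath)
    (hU : r.toSubgraph.verts ⊆ U) (hv : v ∉ S) {a : V} (ha : a ∈ r.support) (haS : a ∈ S) :
    a = u := by
  classical
  by_contra hne
  obtain ⟨d, hd, hfst, hsnd⟩ := (r.dropUntil a ha).exists_boundary_dart S haS hv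
  have hdU : d.snd ∈ U := hU <| r.mem_verts_toSubgraph.2 <|
    r.support_dropUntil_subset_support ha <| Walk.dart_snd_mem_support_of_mem_darts _ hd
  have hu := Walk.dart_fst_mem_support_of_mem_darts _ hd
  rw [hcut _ hfst _ hdU hsnd d.adj] at hu
  rw [← r.take_spec ha] at hr
  exact hr.ne_of_mem_support_of_append (Ne.symm hne) (Walk.start_mem_support _) hu rfl

theorem IsCutOffAt.isInduced_sup (hcut : IsCutOffAt G U S v) {A B : G.Subgraph}
    (hA : A.IsInduced) (hB : B.IsInduced) (hAS : A.verts ⊆ S) (hBU : B.verts ⊆ U)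
    (hvA : v ∈ A.verts) (hvB : v ∈ B.verts) (hBS : ∀ b ∈ B.verts, b ∈ S → b = v) :
    (A ⊔ B).IsInduced := by
  refine GraphToric.isInduced_sup hA hB fun a ha b hb hab => ?_
  by_cases hbS : b ∈ S
  · exact Or.inr (hBS b hb hbS ▸ hvA)
  · exact Or.inl (hcut a (hAS ha) b (hBU hb) hbS hab ▸ hvB)

theorem CondSharp.not_isInduced_lollipops (hG : CondSharp G) (L₁ : InducedLollipop G v₁)
    (L₂ : InducedLollipop G v₂) (hdisj : Disjoint L₁.toSubgraph.verts L₂.toSubgraph.verts)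
    {r : G.Walk v₁ v₂} (hr : r.IsPath) (h₁ : ∀ a ∈ r.support, a ∈ L₁.toSubgraph.verts → a = v₁)
    (h₂ : ∀ a ∈ r.support, a ∈ L₂.toSubgraph.verts → a = v₂) :
    ¬ (L₁.toSubgraph ⊔ r.toSubgraph ⊔ L₂.toSubgraph).IsInduced := by
  have hv₁ : v₁ ∈ L₁.stem.support := L₁.stem.start_mem_support
  have hv₂ : v₂ ∈ L₂.stem.support := L₂.stem.start_mem_support
  have hj₁ := L₁.eq_joint
  have hj₂ := L₂.eq_joint
  simp only [Set.disjoint_left, InducedLollipop.mem_verts_toSubgraph] at hdisj h₁ h₂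
  let p := L₁.stem.reverse.append (r.append L₂.stem)
  have hmem : ∀ a, a ∈ p.support ↔ a ∈ L₁.stem.support ∨ a ∈ r.support ∨ a ∈ L₂.stem.support := by
    simp [p, Walk.mem_support_append_iff]
  have hp : p.IsPath := by
    refine isPath_append L₁.isPath.reverse (isPath_append hr L₂.isPath (by grind)) ?_
    simp only [Walk.support_reverse, List.mem_reverse, Walk.mem_support_append_iff]
    grind
  have hlen : 1 ≤ p.length := by
    by_contra! h
    have hjoint := Walk.eq_of_length_eq_zero (Nat.lt_one_iff.1 h)
    have hjoint₁ := L₁.cycle.start_mem_support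
    have hjoint₂ := L₂.cycle.start_mem_support
    grind
  have hsub : L₁.cycle.toSubgraph ⊔ p.toSubgraph ⊔ L₂.cycle.toSubgraph =
      L₁.toSubgraph ⊔ r.toSubgraph ⊔ L₂.toSubgraph := by
    simp only [p, InducedLollipop.toSubgraph, Walk.toSubgraph_append, Walk.toSubgraph_reverse]
    ac_rfl
  rw [← hsub]
  refine hG _ _ L₁.cycle L₂.cycle p L₁.isCycle L₁.odd_length L₂.isCycle L₂.odd_length
    (fun a ha hb => hdisj (Or.inr ha) (Or.inr hb)) hp hlen ?_ ?_
  · intro a ha hc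
    rcases (hmem a).1 ha with ha | ha | ha
    · exact hj₁ a ha hc
    · exact hj₁ a (h₁ a ha (Or.inr hc) ▸ hv₁) hc
    · exact absurd (Or.inl ha) (hdisj (Or.inr hc))
  · intro a ha hc
    rcases (hmem a).1 ha with ha | ha | ha
    · exact absurd (Or.inr hc) (hdisj (Or.inl ha))
    · exact hj₂ a (h₂ a ha (Or.inr hc) ▸ hv₂) hc
    · exact hj₂ a ha hc

theorem CondSharp.false_of_odd_walks (hG : CondSharp G) (hcut₁ : IsCutOffAt G U S₁ v₁)
    (hcut₂ : IsCutOffAt G U S₂ v₂) (hdisj : Disjoint S₁ S₂) (hSU : S₁ ⊆ U)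
    (c₁ : G.Walk v₁ v₁) (hc₁ : Odd c₁.length) (hS₁ : ∀ a ∈ c₁.support, a ∈ S₁)
    (c₂ : G.Walk v₂ v₂) (hc₂ : Odd c₂.length) (hS₂ : ∀ a ∈ c₂.support, a ∈ S₂)
    (q : G.Walk v₁ v₂) (hq : ∀ a ∈ q.support, a ∈ U) : False := by
  have hv₁ : v₁ ∉ S₂ := Set.disjoint_left.1 hdisj (hS₁ _ c₁.start_mem_support)
  have hv₂ : v₂ ∉ S₁ := Set.disjoint_right.1 hdisj (hS₂ _ c₂.start_mem_support)
  obtain ⟨L₁, hL₁⟩ := InducedLollipop.exists_verts_subset c₁ hc₁ hS₁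
  obtain ⟨L₂, hL₂⟩ := InducedLollipop.exists_verts_subset c₂ hc₂ hS₂
  obtain ⟨r, hr, hind, hrU⟩ := exists_isPath_isInduced q hq
  have hr₁ : ∀ a ∈ r.support, a ∈ S₁ → a = v₁ := fun a => hcut₁.eq_of_mem hr hrU hv₂
  have hr₂ : ∀ a ∈ r.support, a ∈ S₂ → a = v₂ := fun a ha =>
    hcut₂.eq_of_mem hr.reverse (by rwa [Walk.toSubgraph_reverse]) hv₁ (by simpa using ha)
  have hdisj' := hdisj.mono hL₁ hL₂
  refine hG.not_isInduced_lollipops L₁ L₂ hdisj' hr (fun a ha h => hr₁ a ha (hL₁ h))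
    (fun a ha h => hr₂ a ha (hL₂ h)) ?_
  have hind₁ : (L₁.toSubgraph ⊔ r.toSubgraph).IsInduced :=
    hcut₁.isInduced_sup L₁.isInduced hind hL₁ hrU
      (L₁.mem_verts_toSubgraph.2 (Or.inl L₁.stem.start_mem_support)) (by simp)
      fun a ha => hr₁ a (r.mem_verts_toSubgraph.1 ha)
  rw [sup_comm]
  refine hcut₂.isInduced_sup L₂.isInduced hind₁ hL₂ (Set.union_subset (hL₁.trans hSU) hrU)
    (L₂.mem_verts_toSubgraph.2 (Or.inl L₂.stem.start_mem_support)) (Or.inr (by simp)) ?_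
  rintro a (ha | ha) haS
  · exact absurd haS (Set.disjoint_left.1 hdisj (hL₁ ha))
  · exact hr₂ a (r.mem_verts_toSubgraph.1 ha) haS

end Sharp

section Pairs

variable {V : Type*} {G : SimpleGraph V} {a b : G.edgeSet →₀ ℕ}

/-- Both `x^a` and `x^b` have proper non-rigid divisors, whose degrees add up to `deg x^a + 1`:
what a chord of a closed walk produces by breaking the walk into two even closed walks. It prevents
`x^a` and `x^b` from being critical. -/
def HasSplit (a b : G.edgeSet →₀ ℕ) : Prop :=
  ∃ a' < a, ∃ b' < b, ¬ IsRigid (edgeVec G) a' ∧ ¬ IsRigid (edgeVec G) b' ∧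
    a'.degree + b'.degree = a.degree + 1

theorem HasSplit.symm (hd : degA (edgeVec G) a = degA (edgeVec G) b) (h : HasSplit a b) :
    HasSplit b a := by
  obtain ⟨a', ha, b', hb, ha', hb', hdeg⟩ := h
  exact ⟨b', hb, a', ha, hb', ha', by rw [add_comm, hdeg, degree_eq_of_degA_eq hd]⟩

end Pairs

/-! ### Closed walks of primitive binomials -/

/-- A closed walk of positive even length, as a periodic sequence of vertices. -/
structure ClosedSeq {V : Type*} (G : SimpleGraph V) where
  /-- the successive vertices -/
  vert : ℕ → V
  /-- half of the period -/
  half : ℕ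
  half_pos : 0 < half
  adj : ∀ n, G.Adj (vert n) (vert (n + 1))
  periodic : ∀ n, vert (n + 2 * half) = vert n

theorem sum_filter_even_range_two_mul {M : Type*} [AddCommMonoid M] (f : ℕ → M) (s : ℕ) :
    ∑ n ∈ Finset.range (2 * s) with Even n, f n = ∑ k ∈ Finset.range s, f (2 * k) := by
  induction s with
  | zero => rfl
  | succ s ih =>
    rw [Finset.sum_range_succ, ← ih, Finset.sum_filter, Finset.sum_filter, mul_add_one,
      Finset.sum_range_succ, Finset.sum_range_succ, if_pos (by simp), if_neg (by simp), add_zero]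

theorem sum_filter_odd_range_two_mul {M : Type*} [AddCommMonoid M] (f : ℕ → M) (s : ℕ) :
    ∑ n ∈ Finset.range (2 * s) with Odd n, f n = ∑ k ∈ Finset.range s, f (2 * k + 1) := by
  induction s with
  | zero => rfl
  | succ s ih =>
    rw [Finset.sum_range_succ, ← ih, Finset.sum_filter, Finset.sum_filter, mul_add_one,
      Finset.sum_range_succ, Finset.sum_range_succ, if_neg (by simp), if_pos (by simp), add_zero]

theorem disjoint_Ico_Ico_of_le {p r q t : ℕ} (h : r ≤ q) :
    Disjoint (Finset.Ico p r) (Finset.Ico q t) := by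
  rw [Finset.disjoint_left]
  intro n hn hn'
  rw [Finset.mem_Ico] at hn hn'
  omega

theorem card_Ico_union_Ico {p r q t : ℕ} (h : r ≤ q) :
    (Finset.Ico p r ∪ Finset.Ico q t).card = (r - p) + (t - q) := by
  rw [Finset.card_union_of_disjoint (disjoint_Ico_Ico_of_le h), Nat.card_Ico, Nat.card_Ico]

theorem neg_one_pow_eq_neg_of_odd_add {R : Type*} [Ring R] {m n : ℕ} (h : Odd (m + n)) :
    (-1 : R) ^ n = -(-1) ^ m := by
  rw [neg_one_pow_congr (n := m + 1) (by grind), pow_succ, mul_neg_one]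

namespace ClosedSeq

variable {V : Type*} {G : SimpleGraph V} (c : ClosedSeq G)

/-- The edge at position `n`. -/
def edge (n : ℕ) : G.edgeSet :=
  ⟨s(c.vert n, c.vert (n + 1)), c.adj n⟩

/-- The exponent vector of the product of the edges at the even positions in `S`. -/
def evenOn (S : Finset ℕ) : G.edgeSet →₀ ℕ :=
  ∑ n ∈ S with Even n, Finsupp.single (c.edge n) 1

/-- The exponent vector of the product of the edges at the odd positions in `S`. -/
def oddOn (S : Finset ℕ) : G.edgeSet →₀ ℕ :=
  ∑ n ∈ S with Odd n, Finsupp.single (c.edge n) 1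

/-- The positions in one period. -/
def period : Finset ℕ :=
  Finset.range (2 * c.half)

/-- The monomial `B_w^{(+)}` of the closed walk: the edges at even positions in one period. -/
def plus : G.edgeSet →₀ ℕ :=
  c.evenOn c.period

/-- The monomial `B_w^{(-)}` of the closed walk: the edges at odd positions in one period. -/
def minus : G.edgeSet →₀ ℕ :=
  c.oddOn c.period

/-- The binomial of the closed walk is primitive. -/
def IsPrimitive : Prop :=
  IsPrimitivePair (edgeVec G) c.plus c.minus

/-- The same closed walk, started at position `n`. -/
def shift (n : ℕ) : ClosedSeq G where
  vert k := c.vert (k + n)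
  half := c.half
  half_pos := c.half_pos
  adj k := by
    have := c.adj (k + n)
    rwa [add_right_comm] at this
  periodic k := by rw [add_right_comm, c.periodic]

theorem shift_half (n : ℕ) : (c.shift n).half = c.half :=
  rfl

theorem shift_vert_zero (n : ℕ) : (c.shift n).vert 0 = c.vert n :=
  congrArg c.vert (zero_add n)

theorem shift_vert_sub {n m : ℕ} (h : n ≤ m) : (c.shift n).vert (m - n) = c.vert m :=
  congrArg c.vert (Nat.sub_add_cancel h)

theorem edge_periodic (n : ℕ) : c.edge (n + 2 * c.half) = c.edge n := by
  refine Subtype.ext ?_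
  simp only [edge]
  rw [c.periodic, add_right_comm, c.periodic]

theorem vert_mod (n : ℕ) : c.vert (n % (2 * c.half)) = c.vert n :=
  Function.Periodic.map_mod_nat c.periodic n

theorem exists_lt_vert_eq (n : ℕ) : ∃ m < 2 * c.half, c.vert m = c.vert n :=
  ⟨n % (2 * c.half), Nat.mod_lt _ (by have := c.half_pos; omega), c.vert_mod n⟩

theorem plus_eq_sum :
    c.plus = ∑ k ∈ Finset.range c.half, Finsupp.single (c.edge (2 * k)) 1 :=
  sum_filter_even_range_two_mul _ _

theorem minus_eq_sum :
    c.minus = ∑ k ∈ Finset.range c.half, Finsupp.single (c.edge (2 * k + 1)) 1 :=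
  sum_filter_odd_range_two_mul _ _

theorem shift_one_plus : (c.shift 1).plus = c.minus := by
  rw [plus_eq_sum, minus_eq_sum]
  rfl

theorem shift_one_minus : (c.shift 1).minus = c.plus := by
  rw [plus_eq_sum, minus_eq_sum]
  change ∑ k ∈ Finset.range c.half, Finsupp.single (c.edge (2 * (k + 1))) 1 = _
  have hlast := Finset.sum_range_succ (fun k => Finsupp.single (c.edge (2 * k)) 1) c.half
  have hfirst := Finset.sum_range_succ' (fun k => Finsupp.single (c.edge (2 * k)) 1) c.half
  have hperiod : c.edge (2 * c.half) = c.edge 0 := by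
    simpa only [zero_add] using c.edge_periodic 0
  rw [hlast, mul_zero, hperiod] at hfirst
  exact (add_right_cancel hfirst).symm

theorem shift_succ (n : ℕ) : c.shift (n + 1) = (c.shift n).shift 1 := by
  simp only [shift, ClosedSeq.mk.injEq, and_true]
  funext k
  rw [add_right_comm, add_assoc]

theorem shift_plus_minus (n : ℕ) :
    ((c.shift n).plus = c.plus ∧ (c.shift n).minus = c.minus) ∨
      ((c.shift n).plus = c.minus ∧ (c.shift n).minus = c.plus) := by
  induction n with
  | zero => exact Or.inl ⟨rfl, rfl⟩
  | succ n ih =>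
    rw [shift_succ, shift_one_plus, shift_one_minus]
    exact ih.symm.imp And.symm And.symm

theorem degree_evenOn_add_degree_oddOn (S : Finset ℕ) :
    (c.evenOn S).degree + (c.oddOn S).degree = S.card := by
  simp only [evenOn, oddOn, map_sum, Finsupp.degree_single, Finset.sum_const, smul_eq_mul, mul_one,
    ← Nat.not_even_iff_odd]
  exact Finset.card_filter_add_card_filter_not _

theorem evenOn_add_evenOn_sdiff {S T : Finset ℕ} (h : S ⊆ T) :
    c.evenOn S + c.evenOn (T \ S) = c.evenOn T := by
  simp only [evenOn, Finset.sum_filter]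
  rw [add_comm, Finset.sum_sdiff h]

theorem oddOn_add_oddOn_sdiff {S T : Finset ℕ} (h : S ⊆ T) :
    c.oddOn S + c.oddOn (T \ S) = c.oddOn T := by
  simp only [oddOn, Finset.sum_filter]
  rw [add_comm, Finset.sum_sdiff h]

theorem evenOn_le_plus {S : Finset ℕ} (h : S ⊆ c.period) : c.evenOn S ≤ c.plus := by
  rw [plus, ← c.evenOn_add_evenOn_sdiff h]
  exact le_self_add

theorem oddOn_le_minus {S : Finset ℕ} (h : S ⊆ c.period) : c.oddOn S ≤ c.minus := by
  rw [minus, ← c.oddOn_add_oddOn_sdiff h]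
  exact le_self_add

/-- The alternating degree of a set of positions, the `A`-degree of its even edges minus that of
its odd edges. -/
def altDeg (S : Finset ℕ) : V → ℤ :=
  ∑ n ∈ S, (-1) ^ n * (vertexVec (c.vert n) + vertexVec (c.vert (n + 1)))

theorem degA_evenOn_sub_degA_oddOn (S : Finset ℕ) :
    degA (edgeVec G) (c.evenOn S) - degA (edgeVec G) (c.oddOn S) = c.altDeg S := by
  simp only [evenOn, oddOn, altDeg, Finset.sum_filter]
  induction S using Finset.induction_on with
  | empty => simp only [Finset.sum_empty, sub_self]
  | insert n S hn ih =>
    rw [Finset.sum_insert hn, Finset.sum_insert hn, Finset.sum_insert hn, ← ih, degA_add, degA_add]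
    rcases Nat.even_or_odd n with h | h
    · rw [if_pos h, if_neg (Nat.not_odd_iff_even.2 h), degA_single, edge, edgeVec_mk, degA_zero,
        h.neg_one_pow]
      ring
    · rw [if_pos h, if_neg (Nat.not_even_iff_odd.2 h), degA_single, edge, edgeVec_mk, degA_zero,
        h.neg_one_pow]
      ring

theorem altDeg_Ico {a b : ℕ} (h : a ≤ b) :
    c.altDeg (Finset.Ico a b)
      = (-1) ^ a * vertexVec (c.vert a) - (-1) ^ b * vertexVec (c.vert b) := by
  rw [altDeg]
  induction b, h using Nat.le_induction with
  | base => simp only [Finset.Ico_self, Finset.sum_empty, sub_self]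
  | succ b hab ih =>
    rw [Finset.sum_Ico_succ_top hab, ih, pow_succ]
    ring

theorem altDeg_union {S T : Finset ℕ} (h : Disjoint S T) :
    c.altDeg (S ∪ T) = c.altDeg S + c.altDeg T :=
  Finset.sum_union h

theorem altDeg_Ico_union_Ico {p r q t : ℕ} (h1 : p ≤ r) (h2 : r ≤ q) (h3 : q ≤ t) :
    c.altDeg (Finset.Ico p r ∪ Finset.Ico q t)
      = (-1) ^ p * vertexVec (c.vert p) - (-1) ^ r * vertexVec (c.vert r)
        + ((-1) ^ q * vertexVec (c.vert q) - (-1) ^ t * vertexVec (c.vert t)) := by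
  rw [altDeg_union _ (disjoint_Ico_Ico_of_le h2), altDeg_Ico _ h1, altDeg_Ico _ h3]

theorem altDeg_period : c.altDeg c.period = 0 := by
  have h : c.vert (2 * c.half) = c.vert 0 := by simpa only [zero_add] using c.periodic 0
  rw [period, Finset.range_eq_Ico, altDeg_Ico _ (Nat.zero_le _), h, (even_two_mul _).neg_one_pow,
    pow_zero, sub_self]

theorem degA_plus_eq_degA_minus : degA (edgeVec G) c.plus = degA (edgeVec G) c.minus := by
  rw [← sub_eq_zero, plus, minus, degA_evenOn_sub_degA_oddOn, altDeg_period]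

theorem altDeg_sdiff {S : Finset ℕ} (h : S ⊆ c.period) :
    c.altDeg (c.period \ S) = -c.altDeg S := by
  rw [eq_neg_iff_add_eq_zero, ← c.altDeg_period]
  exact Finset.sum_sdiff h

theorem card_sdiff_add_card {S : Finset ℕ} (h : S ⊆ c.period) :
    (c.period \ S).card + S.card = 2 * c.half := by
  rw [Finset.card_sdiff_add_card_eq_card h, period, Finset.card_range]

theorem degree_plus_add_degree_minus : c.plus.degree + c.minus.degree = 2 * c.half := by
  rw [plus, minus, c.degree_evenOn_add_degree_oddOn, period, Finset.card_range]

theorem degree_plus : c.plus.degree = c.half := by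
  have h := c.degree_plus_add_degree_minus
  rw [← degree_eq_of_degA_eq c.degA_plus_eq_degA_minus] at h
  omega

theorem Ico_subset_period {a b : ℕ} (h : b ≤ 2 * c.half) : Finset.Ico a b ⊆ c.period :=
  fun _ hn => Finset.mem_range.2 ((Finset.mem_Ico.1 hn).2.trans_le h)

variable {c}

theorem IsPrimitive.shift (h : c.IsPrimitive) (n : ℕ) : (c.shift n).IsPrimitive := by
  rw [IsPrimitive] at h ⊢
  rcases c.shift_plus_minus n with ⟨hp, hm⟩ | ⟨hp, hm⟩ <;> rw [hp, hm]
  exacts [h, h.symm]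

theorem hasSplit_of_shift {n : ℕ} (h : HasSplit (c.shift n).plus (c.shift n).minus) :
    HasSplit c.plus c.minus := by
  rcases c.shift_plus_minus n with ⟨hp, hm⟩ | ⟨hp, hm⟩ <;> rw [hp, hm] at h
  exacts [h, h.symm c.degA_plus_eq_degA_minus.symm]

theorem card_eq_zero_or_eq_of_altDeg_eq_zero (hP : c.IsPrimitive) {S : Finset ℕ}
    (hS : S ⊆ c.period) (h : c.altDeg S = 0) : S.card = 0 ∨ S.card = 2 * c.half := by
  rw [← degA_evenOn_sub_degA_oddOn, sub_eq_zero] at h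
  rw [← c.degree_evenOn_add_degree_oddOn, ← c.degree_plus_add_degree_minus]
  rcases hP.eq_zero_or_eq _ (c.evenOn_le_plus hS) _ (c.oddOn_le_minus hS) h with ⟨he, ho⟩ | ⟨he, ho⟩
  · left
    rw [he, ho, map_zero, add_zero]
  · right
    rw [he, ho]

section Split

variable {S : Finset ℕ} {f : G.edgeSet}

theorem degA_oddOn_add_single (hf : c.altDeg S = edgeVec G f) :
    degA (edgeVec G) (c.oddOn S + Finsupp.single f 1) = degA (edgeVec G) (c.evenOn S) := by
  rw [degA_add, degA_single, one_smul, ← hf, ← degA_evenOn_sub_degA_oddOn, add_sub_cancel]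

theorem degA_evenOn_add_single (hf : c.altDeg S = -edgeVec G f) :
    degA (edgeVec G) (c.evenOn S + Finsupp.single f 1) = degA (edgeVec G) (c.oddOn S) := by
  rw [degA_add, degA_single, one_smul, ← neg_eq_iff_eq_neg.2 hf, ← degA_evenOn_sub_degA_oddOn,
    neg_sub, add_sub_cancel]

theorem degree_oddOn_add_one (hf : c.altDeg S = edgeVec G f) :
    (c.oddOn S).degree + 1 = (c.evenOn S).degree := by
  simpa only [map_add, Finsupp.degree_single] using
    degree_eq_of_degA_eq (degA_oddOn_add_single hf)

theorem degree_evenOn_add_one (hf : c.altDeg S = -edgeVec G f) :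
    (c.evenOn S).degree + 1 = (c.oddOn S).degree := by
  simpa only [map_add, Finsupp.degree_single] using
    degree_eq_of_degA_eq (degA_evenOn_add_single hf)

theorem not_isRigid_evenOn (hP : c.IsPrimitive) (hS : S ⊆ c.period)
    (h2 : 2 ≤ S.card) (hf : c.altDeg S = edgeVec G f) : ¬ IsRigid (edgeVec G) (c.evenOn S) := by
  refine hP.not_isRigid_of_degA_add_eq (c.evenOn_le_plus hS) (c.oddOn_le_minus hS) ?_
    (degA_oddOn_add_single hf)
  intro h0
  have hodd := degree_oddOn_add_one hf
  have hcard := c.degree_evenOn_add_degree_oddOn S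
  rw [h0, map_zero] at hodd hcard
  omega

theorem not_isRigid_oddOn (hP : c.IsPrimitive) (hS : S ⊆ c.period)
    (h2 : 2 ≤ S.card) (hf : c.altDeg S = -edgeVec G f) : ¬ IsRigid (edgeVec G) (c.oddOn S) := by
  refine hP.symm.not_isRigid_of_degA_add_eq (c.oddOn_le_minus hS) (c.evenOn_le_plus hS) ?_
    (degA_evenOn_add_single hf)
  intro h0
  have heven := degree_evenOn_add_one hf
  have hcard := c.degree_evenOn_add_degree_oddOn S
  rw [h0, map_zero] at heven hcard
  omega

-- The even edges of `S` and the odd edges outside `S` are the two divisors.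
theorem hasSplit_of_altDeg_eq (hP : c.IsPrimitive) (hS : S ⊆ c.period)
    (h2 : 2 ≤ S.card) (h2' : S.card + 2 ≤ 2 * c.half) (hf : c.altDeg S = edgeVec G f) :
    HasSplit c.plus c.minus := by
  have hT : c.period \ S ⊆ c.period := Finset.sdiff_subset
  have hf' : c.altDeg (c.period \ S) = -edgeVec G f := by rw [c.altDeg_sdiff hS, hf]
  have hcard := c.card_sdiff_add_card hS
  have hplus := c.degree_plus
  have hsum := c.degree_plus_add_degree_minus
  have hdegS := degree_oddOn_add_one hf
  have hdegT := degree_evenOn_add_one hf'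
  have hcardS := c.degree_evenOn_add_degree_oddOn S
  have hcardT := c.degree_evenOn_add_degree_oddOn (c.period \ S)
  refine ⟨_, (c.evenOn_le_plus hS).lt_of_ne fun h => ?_, _, (c.oddOn_le_minus hT).lt_of_ne
    fun h => ?_, not_isRigid_evenOn hP hS h2 hf, not_isRigid_oddOn hP hT (by omega) hf', by omega⟩
  · rw [h] at hdegS hcardS
    omega
  · rw [h] at hdegT hcardT
    omega

theorem hasSplit_of_altDeg_eq_or (hP : c.IsPrimitive) (hS : S ⊆ c.period)
    (h2 : 2 ≤ S.card) (h2' : S.card + 2 ≤ 2 * c.half)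
    (hf : c.altDeg S = edgeVec G f ∨ c.altDeg S = -edgeVec G f) : HasSplit c.plus c.minus := by
  rcases hf with hf | hf
  · exact hasSplit_of_altDeg_eq hP hS h2 h2' hf
  · have hcard := c.card_sdiff_add_card hS
    exact hasSplit_of_altDeg_eq (S := c.period \ S) hP Finset.sdiff_subset (by omega) (by omega)
      (by rw [c.altDeg_sdiff hS, hf, neg_neg])

end Split

section Repetitions

theorem odd_of_vert_zero_eq (hP : c.IsPrimitive) {b : ℕ} (h0 : 0 < b)
    (hb : b < 2 * c.half) (h : c.vert 0 = c.vert b) : Odd b := by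
  by_contra hodd
  rw [Nat.not_odd_iff_even] at hodd
  have := card_eq_zero_or_eq_of_altDeg_eq_zero hP (c.Ico_subset_period (a := 0) hb.le)
    (by rw [altDeg_Ico _ (Nat.zero_le _), h, hodd.neg_one_pow, pow_zero, sub_self])
  rw [Nat.card_Ico] at this
  omega

theorem odd_of_vert_eq (hP : c.IsPrimitive) {a b : ℕ} (hab : a < b)
    (hb : b < a + 2 * c.half) (h : c.vert a = c.vert b) : Odd (a + b) := by
  have : Odd (b - a) := odd_of_vert_zero_eq (hP.shift a) (by omega)
    (by rw [shift_half]; omega) (by rwa [shift_vert_zero, shift_vert_sub _ hab.le])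
  grind

theorem false_of_crossing_zero (hP : c.IsPrimitive) {r q t : ℕ} (hr : 0 < r)
    (hrq : r < q) (hqt : q < t) (ht : t < 2 * c.half) (h : c.vert 0 = c.vert q)
    (h' : c.vert r = c.vert t) : False := by
  have hq := odd_of_vert_eq hP (a := 0) (by omega) (by omega) h
  have hrt := odd_of_vert_eq hP (by omega) (by omega) h'
  have := card_eq_zero_or_eq_of_altDeg_eq_zero hP (S := Finset.Ico 0 r ∪ Finset.Ico q t)
    (Finset.union_subset (c.Ico_subset_period (by omega)) (c.Ico_subset_period ht.le))
    (by
      rw [c.altDeg_Ico_union_Ico hr.le hrq.le hqt.le, neg_one_pow_eq_neg_of_odd_add hq,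
        neg_one_pow_eq_neg_of_odd_add hrt, h, h']
      ring)
  rw [card_Ico_union_Ico hrq.le] at this
  omega

theorem false_of_crossing (hP : c.IsPrimitive) {p r q t : ℕ} (hpr : p < r)
    (hrq : r < q) (hqt : q < t) (ht : t < p + 2 * c.half) (h : c.vert p = c.vert q)
    (h' : c.vert r = c.vert t) : False :=
  false_of_crossing_zero (hP.shift p) (r := r - p) (q := q - p) (t := t - p)
    (by omega) (by omega) (by omega) (by rw [shift_half]; omega)
    (by rwa [shift_vert_zero, shift_vert_sub _ (by omega)])
    (by rwa [shift_vert_sub _ (by omega), shift_vert_sub _ (by omega)])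

theorem consecutive_of_adj (hP : c.IsPrimitive) (hS : ¬ HasSplit c.plus c.minus)
    {a b : ℕ} (hab : a < b) (hb : b < a + 2 * c.half) (hodd : Odd (a + b))
    (hadj : G.Adj (c.vert a) (c.vert b)) : b = a + 1 ∨ b + 1 = a + 2 * c.half := by
  by_contra! hno
  have hodd' : Odd (b - a) := by grind
  have hne : b - a ≠ 1 ∧ b - a + 1 ≠ 2 * c.half := by omega
  refine hS (hasSplit_of_shift (n := a) (hasSplit_of_altDeg_eq (hP.shift a)
    (S := Finset.Ico 0 (b - a)) (f := ⟨s(_, _), hadj⟩)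
    (Ico_subset_period _ (by rw [shift_half]; omega)) ?_ ?_ ?_))
  · rw [Nat.card_Ico]
    grind
  · rw [Nat.card_Ico, shift_half]
    grind
  · rw [altDeg_Ico _ (Nat.zero_le _), edgeVec_mk, shift_vert_zero, shift_vert_sub _ hab.le,
      hodd'.neg_one_pow, pow_zero, one_mul, neg_one_mul, sub_neg_eq_add]

theorem hasSplit_of_crossing_adj_zero (hP : c.IsPrimitive) {r q t : ℕ}
    (hr : 0 < r) (hrq : r < q) (hqt : q < t) (ht : t < 2 * c.half) (h : c.vert 0 = c.vert q)
    (hrt : Even (r + t)) (hadj : G.Adj (c.vert r) (c.vert t)) : HasSplit c.plus c.minus := by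
  have hq := odd_of_vert_eq hP (a := 0) (by omega) (by omega) h
  have halt : c.altDeg (Finset.Ico 0 r ∪ Finset.Ico q t)
      = -(-1) ^ r * edgeVec G ⟨s(_, _), hadj⟩ := by
    rw [altDeg_Ico_union_Ico _ hr.le hrq.le hqt.le, edgeVec_mk, neg_one_pow_eq_neg_of_odd_add hq,
      neg_one_pow_congr (m := t) (n := r) (by grind), h]
    ring
  rw [zero_add] at hq
  refine hasSplit_of_altDeg_eq_or hP (S := Finset.Ico 0 r ∪ Finset.Ico q t)
    (f := ⟨s(_, _), hadj⟩) (Finset.union_subset (c.Ico_subset_period (by omega))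
    (c.Ico_subset_period ht.le)) ?_ ?_ ?_
  · rw [card_Ico_union_Ico hrq.le]
    omega
  · rw [card_Ico_union_Ico hrq.le]
    grind
  · rw [halt]
    rcases Nat.even_or_odd r with hr | hr
    · right
      rw [hr.neg_one_pow, neg_one_mul]
    · left
      rw [hr.neg_one_pow, neg_neg, one_mul]

theorem not_adj_of_crossing (hP : c.IsPrimitive)
    (hS : ¬ HasSplit c.plus c.minus) {p r q t : ℕ} (hpr : p < r) (hrq : r < q) (hqt : q < t)
    (ht : t < p + 2 * c.half) (h : c.vert p = c.vert q) : ¬ G.Adj (c.vert r) (c.vert t) := by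
  intro hadj
  rcases Nat.even_or_odd (r + t) with hrt | hrt
  · refine hS (hasSplit_of_shift (n := p) (hasSplit_of_crossing_adj_zero
      (hP.shift p) (r := r - p) (q := q - p) (t := t - p) (by omega) (by omega)
      (by omega) (by rw [shift_half]; omega) ?_ (by grind) ?_))
    · rwa [shift_vert_zero, shift_vert_sub _ (by omega)]
    · rwa [shift_vert_sub _ (by omega), shift_vert_sub _ (by omega)]
  · have := consecutive_of_adj hP hS (by omega) (by omega) hrt hadj
    omega

end Repetitions

section TwoDoubles

theorem exists_vert_eq (c : ClosedSeq G) (i n : ℕ) :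
    ∃ m, i ≤ m ∧ m < i + 2 * c.half ∧ c.vert m = c.vert n := by
  obtain ⟨k, hk, hkn⟩ := (c.shift i).exists_lt_vert_eq (n + i * (2 * c.half) - i)
  have hi : i ≤ n + i * (2 * c.half) :=
    (Nat.le_mul_of_pos_right i (by have := c.half_pos; omega)).trans (Nat.le_add_left _ _)
  have hper : c.vert (n + i * (2 * c.half)) = c.vert n := Function.Periodic.nat_mul c.periodic i n
  rw [shift_vert_sub _ hi, hper] at hkn
  rw [shift_half] at hk
  exact ⟨k + i, by omega, by omega, hkn⟩

theorem exists_walk (c : ClosedSeq G) {i j : ℕ} (h : i ≤ j) :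
    ∃ w : G.Walk (c.vert i) (c.vert j),
      w.length = j - i ∧ ∀ a ∈ w.support, a ∈ c.vert '' Set.Icc i j := by
  induction j, h using Nat.le_induction with
  | base =>
    refine ⟨.nil, (Nat.sub_self i).symm, fun a ha => ?_⟩
    rw [SimpleGraph.Walk.support_nil, List.mem_singleton] at ha
    exact ⟨i, ⟨le_rfl, le_rfl⟩, ha.symm⟩
  | succ j hij ih =>
    obtain ⟨w, hlen, hw⟩ := ih
    refine ⟨w.concat (c.adj j), by rw [SimpleGraph.Walk.length_concat]; omega, fun a ha => ?_⟩
    rw [SimpleGraph.Walk.support_concat, List.mem_append, List.mem_singleton] at ha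
    rcases ha with ha | rfl
    · exact Set.image_mono (Set.Icc_subset_Icc_right j.le_succ) (hw a ha)
    · exact ⟨j + 1, ⟨by omega, le_rfl⟩, rfl⟩

theorem exists_odd_closed_walk (hP : c.IsPrimitive) {i j : ℕ} (hij : i < j)
    (hj : j < i + 2 * c.half) (h : c.vert i = c.vert j) :
    ∃ w : G.Walk (c.vert i) (c.vert i),
      Odd w.length ∧ ∀ a ∈ w.support, a ∈ c.vert '' Set.Icc i j := by
  obtain ⟨w, hlen, hw⟩ := c.exists_walk hij.le
  have hodd := odd_of_vert_eq hP hij hj h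
  refine ⟨w.copy rfl h.symm, ?_, fun a ha => hw a (SimpleGraph.Walk.support_copy w rfl _ ▸ ha)⟩
  rw [SimpleGraph.Walk.length_copy, hlen]
  grind

theorem isCutOffAt_image_Icc (hP : c.IsPrimitive)
    (hS : ¬ HasSplit c.plus c.minus) {i j : ℕ} (hj : j < i + 2 * c.half)
    (h : c.vert i = c.vert j) :
    IsCutOffAt G (Set.range c.vert) (c.vert '' Set.Icc i j) (c.vert i) := by
  rintro _ ⟨a, ⟨hia, haj⟩, rfl⟩ _ ⟨n, rfl⟩ hn hadj
  obtain ⟨m, him, hm, hmn⟩ := c.exists_vert_eq i n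
  have hjm : j < m := by
    by_contra! hmj
    exact hn ⟨m, ⟨him, hmj⟩, hmn⟩
  rcases hia.eq_or_lt with rfl | hia
  · rfl
  rcases haj.eq_or_lt with rfl | haj
  · exact h.symm
  · exact absurd (hmn ▸ hadj) (not_adj_of_crossing hP hS hia haj hjm hm h)

theorem disjoint_image_Icc (hP : c.IsPrimitive) {i j k l : ℕ} (hij : i < j)
    (hjk : j < k) (hl : l < i + 2 * c.half) (h : c.vert i = c.vert j) :
    Disjoint (c.vert '' Set.Icc i j) (c.vert '' Set.Icc k l) := by
  rw [Set.disjoint_left]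
  rintro _ ⟨a, ⟨hia, haj⟩, rfl⟩ ⟨b, ⟨hkb, hbl⟩, hba⟩
  have hend : c.vert i ≠ c.vert b := fun hib => by
    have hij_odd := odd_of_vert_eq hP hij (by omega) h
    have hib_odd := odd_of_vert_eq hP (by omega) (by omega) hib
    have hjb_odd := odd_of_vert_eq hP (by omega) (by omega) (h.symm.trans hib)
    grind
  rcases hia.eq_or_lt with rfl | hia
  · exact hend hba.symm
  rcases haj.eq_or_lt with rfl | haj
  · exact hend (h.trans hba.symm)
  · exact false_of_crossing hP hia haj (by omega) (by omega) h hba.symm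

theorem false_of_two_doubles (hG : CondSharp G) (hP : c.IsPrimitive)
    (hS : ¬ HasSplit c.plus c.minus) {i j k l : ℕ} (hij : i < j) (hjk : j < k) (hkl : k < l)
    (hl : l < i + 2 * c.half) (h : c.vert i = c.vert j) (h' : c.vert k = c.vert l) : False := by
  obtain ⟨c₁, hc₁, hS₁⟩ := exists_odd_closed_walk hP hij (by omega) h
  obtain ⟨c₂, hc₂, hS₂⟩ := exists_odd_closed_walk hP hkl (by omega) h'
  obtain ⟨q, -, hq⟩ := c.exists_walk (hij.trans hjk).le
  exact hG.false_of_odd_walks (isCutOffAt_image_Icc hP hS (by omega) h)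
    (isCutOffAt_image_Icc hP hS (by omega) h') (disjoint_image_Icc hP hij hjk hl h)
    (Set.image_subset_range _ _) c₁ hc₁ hS₁ c₂ hc₂ hS₂ q
    fun a ha => Set.image_subset_range _ _ (hq a ha)

end TwoDoubles

end ClosedSeq

theorem sum_single_one_apply {ι α : Type*} [DecidableEq α] (S : Finset ι) (f : ι → α) (e : α) :
    (∑ n ∈ S, Finsupp.single (f n) 1 : α →₀ ℕ) e = {n ∈ S | f n = e}.card := by
  rw [Finsupp.finsetSum_apply, Finset.card_filter]
  exact Finset.sum_congr rfl fun n _ => Finsupp.single_apply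

theorem card_add_card_le_two_mul_card_image {ι α : Type*} [DecidableEq α]
    {f : ι → α} {S T : Finset ι} (hTS : T ⊆ S) (hT : ∀ x ∈ T, ∀ y ∈ S, f x = f y → x = y)
    (hf : ∀ e, {x ∈ S | f x = e}.card ≤ 2) : S.card + T.card ≤ 2 * (S.image f).card := by
  classical
  have hdisj : Disjoint (T.image f) ((S \ T).image f) := by
    simp only [Finset.disjoint_left, Finset.mem_image, Finset.mem_sdiff]
    rintro _ ⟨x, hx, rfl⟩ ⟨y, ⟨hyS, hyT⟩, hxy⟩
    exact hyT (hT x hx y hyS hxy.symm ▸ hx)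
  have hcardT : (T.image f).card = T.card :=
    Finset.card_image_of_injOn fun x hx y hy => hT x hx y (hTS hy)
  have hcardST : (S \ T).card ≤ 2 * ((S \ T).image f).card :=
    Finset.card_le_mul_card_image _ _ fun e _ =>
      (Finset.card_le_card (Finset.filter_subset_filter _ Finset.sdiff_subset)).trans (hf e)
  have hunion : (T.image f).card + ((S \ T).image f).card = (S.image f).card := by
    rw [← Finset.card_union_of_disjoint hdisj, ← Finset.image_union,
      Finset.union_sdiff_of_subset hTS]
  have := Finset.card_sdiff_add_card_eq_card hTS
  omega

namespace ClosedSeq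

variable {V : Type*} {G : SimpleGraph V} {c : ClosedSeq G} {e : G.edgeSet}

theorem odd_of_vert_eq_of_ne (hP : c.IsPrimitive) {a b : ℕ} (hab : a ≠ b)
    (ha : a < b + 2 * c.half) (hb : b < a + 2 * c.half) (h : c.vert a = c.vert b) :
    Odd (a + b) := by
  rcases hab.lt_or_gt with hlt | hlt
  · exact odd_of_vert_eq hP hlt hb h
  · rw [add_comm]
    exact odd_of_vert_eq hP hlt ha h.symm

theorem plus_pos_iff : 0 < c.plus e ↔ ∃ n < 2 * c.half, Even n ∧ c.edge n = e := by
  classical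
  rw [plus, evenOn, sum_single_one_apply, Finset.card_pos, Finset.filter_filter]
  simp only [Finset.Nonempty, Finset.mem_filter, period, Finset.mem_range]

theorem minus_pos_iff : 0 < c.minus e ↔ ∃ n < 2 * c.half, Odd n ∧ c.edge n = e := by
  classical
  rw [minus, oddOn, sum_single_one_apply, Finset.card_pos, Finset.filter_filter]
  simp only [Finset.Nonempty, Finset.mem_filter, period, Finset.mem_range]

theorem even_add_of_edge_eq (hP : c.IsPrimitive) {a b : ℕ} (ha : a < 2 * c.half)
    (hb : b < 2 * c.half) (h : c.edge a = c.edge b) : Even (a + b) := by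
  wlog hparity : Even a ∧ Odd b generalizing a b
  · by_contra hodd
    exact hodd (add_comm a b ▸ this hb ha h.symm (by grind))
  have hplus := plus_pos_iff.2 ⟨a, ha, hparity.1, rfl⟩
  have hminus := minus_pos_iff.2 ⟨b, hb, hparity.2, h.symm⟩
  have := hP.eq_zero_or_eq_zero (c.edge a)
  omega

theorem vert_eq_of_edge_eq (hP : c.IsPrimitive) {a b : ℕ} (hab : a ≠ b)
    (ha : a < 2 * c.half) (hb : b < 2 * c.half) (h : c.edge a = c.edge b) :
    c.vert a = c.vert (b + 1) ∧ c.vert (a + 1) = c.vert b := by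
  refine (Sym2.eq_iff.1 (congrArg Subtype.val h)).resolve_left fun h' => ?_
  have := odd_of_vert_eq_of_ne hP hab (by omega) (by omega) h'.1
  exact Nat.not_even_iff_odd.2 this (even_add_of_edge_eq hP ha hb h)

theorem eq_of_edge_eq (hG : CondSharp G) (hP : c.IsPrimitive) (hS : ¬ HasSplit c.plus c.minus)
    {a b : ℕ} (ha : a < 2 * c.half) (hb : b < 2 * c.half) (h : c.edge a = c.edge b) : a = b := by
  wlog hab : a < b generalizing a b
  · by_contra hne
    exact hne (this hb ha h.symm (by omega)).symm
  have heven := even_add_of_edge_eq hP ha hb h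
  obtain ⟨h1, h2⟩ := vert_eq_of_edge_eq hP hab.ne ha hb h
  exact (false_of_two_doubles hG hP hS (i := a + 1) (j := b) (k := b + 1) (l := a + 2 * c.half)
    (by grind) (by omega) (by grind) (by omega) h2 (by rw [c.periodic, h1])).elim

theorem plus_le_one (hG : CondSharp G) (hP : c.IsPrimitive) (hS : ¬ HasSplit c.plus c.minus)
    (e : G.edgeSet) : c.plus e ≤ 1 := by
  classical
  rw [plus, evenOn, sum_single_one_apply, Finset.card_le_one]
  simp only [Finset.mem_filter, period, Finset.mem_range]
  exact fun m hm n hn => eq_of_edge_eq hG hP hS hm.1.1 hn.1.1 (hm.2.trans hn.2.symm)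

theorem minus_le_one (hG : CondSharp G) (hP : c.IsPrimitive) (hS : ¬ HasSplit c.plus c.minus)
    (e : G.edgeSet) : c.minus e ≤ 1 := by
  rw [← shift_one_plus]
  exact plus_le_one hG (hP.shift 1) (fun h => hS (hasSplit_of_shift h)) e

theorem exists_vert_eq_of_one_lt_plus (hP : c.IsPrimitive) (he : 1 < c.plus e) :
    ∃ i j, i < j ∧ j < i + 2 * c.half ∧ c.vert i = c.vert j := by
  classical
  rw [plus, evenOn, sum_single_one_apply, Finset.one_lt_card] at he
  simp only [Finset.mem_filter, period, Finset.mem_range] at he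
  obtain ⟨m, ⟨⟨hm, hm'⟩, hme⟩, n, ⟨⟨hn, hn'⟩, hne⟩, hmn⟩ := he
  wlog hlt : m < n generalizing m n
  · exact this n hne hn hn' m hmn.symm hme hm hm' (by omega)
  · exact ⟨m, n + 1, by omega, by grind,
      (vert_eq_of_edge_eq hP hmn hm hn (hme.trans hne.symm)).1⟩

section ShortestLoop

/-- The walk is first back at its starting vertex after `d` steps, and no return to any of its
vertices is quicker. -/
structure IsShortestLoop (c : ClosedSeq G) (d : ℕ) : Prop where
  pos : 0 < d
  lt : d < 2 * c.half
  vert_zero_eq : c.vert 0 = c.vert d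
  vert_ne : ∀ k d', 0 < d' → d' < d → c.vert k ≠ c.vert (k + d')

theorem exists_isShortestLoop {i j : ℕ} (hij : i < j) (hj : j < i + 2 * c.half)
    (h : c.vert i = c.vert j) : ∃ n d, (c.shift n).IsShortestLoop d := by
  classical
  have hex : ∃ d, 0 < d ∧ d < 2 * c.half ∧ ∃ i, c.vert i = c.vert (i + d) :=
    ⟨j - i, by omega, by omega, i, by rw [Nat.add_sub_cancel' hij.le, h]⟩
  obtain ⟨hd0, hd, n, hn⟩ := Nat.find_spec hex
  refine ⟨n, Nat.find hex, hd0, hd, ?_, fun k d' h0 hlt heq => ?_⟩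
  · rw [shift_vert_zero, hn, add_comm]
    rfl
  · exact Nat.find_min hex hlt ⟨h0, hlt.trans hd, k + n, heq.trans (by rw [add_right_comm]; rfl)⟩

variable {d : ℕ}

theorem IsShortestLoop.eq_of_vert_eq (hd : c.IsShortestLoop d) (hP : c.IsPrimitive) {x m : ℕ}
    (hx : 0 < x) (hxd : x < d) (hm : m ≤ 2 * c.half) (hxm : c.vert x = c.vert m) : m = x := by
  by_contra hne
  rcases hm.eq_or_lt with rfl | hm
  · refine hd.vert_ne 0 x hx hxd ?_
    rw [zero_add, hxm, ← c.periodic 0, zero_add]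
  rcases le_or_gt m d with hmd | hmd
  · rcases Nat.lt_or_gt_of_ne hne with hlt | hlt
    · exact hd.vert_ne m (x - m) (by omega) (by omega) (by rw [Nat.add_sub_cancel' hlt.le, hxm])
    · exact hd.vert_ne x (m - x) (by omega) (by omega) (by rw [Nat.add_sub_cancel' hlt.le, hxm])
  · exact false_of_crossing hP hx hxd hmd (by omega) hd.vert_zero_eq hxm

theorem IsShortestLoop.three_le (hd : c.IsShortestLoop d) (hP : c.IsPrimitive) : 3 ≤ d := by
  have hodd := odd_of_vert_zero_eq hP hd.pos hd.lt hd.vert_zero_eq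
  have hne : d ≠ 1 := by
    rintro rfl
    exact (c.adj 0).ne hd.vert_zero_eq
  grind

theorem IsShortestLoop.eq_of_edge_eq (hd : c.IsShortestLoop d) (hP : c.IsPrimitive) {n n' : ℕ}
    (hn : n < d) (hn' : n' < 2 * c.half) (h : c.edge n = c.edge n') : n = n' := by
  by_contra hne
  have heven := even_add_of_edge_eq hP (hn.trans hd.lt) hn' h
  have hd3 := hd.three_le hP
  obtain ⟨h1, h2⟩ := vert_eq_of_edge_eq hP hne (hn.trans hd.lt) hn' h
  rcases Nat.eq_zero_or_pos n with rfl | hn0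
  · have := hd.eq_of_vert_eq hP zero_lt_one (by omega) hn'.le h2
    grind
  · have := hd.eq_of_vert_eq hP hn0 hn hn' h1
    grind

theorem card_filter_edge_eq_le_two [DecidableEq G.edgeSet] (hP : c.IsPrimitive) (e : G.edgeSet) :
    {n ∈ c.period | c.edge n = e}.card ≤ 2 := by
  by_contra! hlt
  obtain ⟨x, hx, y, hy, z, hz, hxy, hxz, hyz⟩ := Finset.two_lt_card.1 hlt
  simp only [period, Finset.mem_filter, Finset.mem_range] at hx hy hz
  have hvert_y := (vert_eq_of_edge_eq hP hxy hx.1 hy.1 (hx.2.trans hy.2.symm)).1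
  have hvert_z := (vert_eq_of_edge_eq hP hxz hx.1 hz.1 (hx.2.trans hz.2.symm)).1
  have hodd := odd_of_vert_eq_of_ne hP (a := y + 1) (b := z + 1) (by omega) (by omega) (by omega)
    (hvert_y.symm.trans hvert_z)
  have heven := even_add_of_edge_eq hP hy.1 hz.1 (hy.2.trans hz.2.symm)
  grind

theorem image_edge_period_subset [DecidableEq G.edgeSet] :
    c.period.image c.edge ⊆ c.plus.support ∪ c.minus.support := by
  intro e he
  obtain ⟨n, hn, hne⟩ := Finset.mem_image.1 he
  rw [period, Finset.mem_range] at hn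
  rw [Finset.mem_union, Finsupp.mem_support_iff, Finsupp.mem_support_iff,
    ← Nat.pos_iff_ne_zero, ← Nat.pos_iff_ne_zero, plus_pos_iff, minus_pos_iff]
  exact (Nat.even_or_odd n).imp (fun h => ⟨n, hn, h, hne⟩) fun h => ⟨n, hn, h, hne⟩

-- Every edge occurs at most twice, and the edges of a shortest loop, at least three, only once.
theorem half_add_two_le_card_support (hP : c.IsPrimitive) {i j : ℕ} (hij : i < j)
    (hj : j < i + 2 * c.half) (h : c.vert i = c.vert j) :
    c.half + 2 ≤ c.plus.support.card + c.minus.support.card := by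
  classical
  obtain ⟨n, d, hd⟩ := exists_isShortestLoop hij hj h
  have hP' := hP.shift n
  have hcard : (c.shift n).plus.support.card + (c.shift n).minus.support.card
      = c.plus.support.card + c.minus.support.card := by
    rcases c.shift_plus_minus n with ⟨hp, hm⟩ | ⟨hp, hm⟩ <;> rw [hp, hm]
    rw [add_comm]
  have hT : Finset.range d ⊆ (c.shift n).period := Finset.range_subset_range.2 hd.lt.le
  have himage := card_add_card_le_two_mul_card_image (f := (c.shift n).edge) hT
    (fun x hx y hy => hd.eq_of_edge_eq hP' (Finset.mem_range.1 hx) (Finset.mem_range.1 hy))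
    (card_filter_edge_eq_le_two hP')
  have hd3 := hd.three_le hP'
  rw [Finset.card_range, period, Finset.card_range] at himage
  rw [← hcard, ← c.shift_half n]
  calc (c.shift n).half + 2 ≤ ((c.shift n).period.image (c.shift n).edge).card := by
        rw [period]
        omega
    _ ≤ ((c.shift n).plus.support ∪ (c.shift n).minus.support).card :=
        Finset.card_le_card image_edge_period_subset
    _ ≤ _ := Finset.card_union_le _ _

end ShortestLoop

section OfWalk

/-- A closed walk of positive even length, as a closed sequence. -/
def ofWalk {u : V} (w : G.Walk u u) (heven : Even w.length) (hpos : 0 < w.length) :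
    ClosedSeq G where
  vert n := w.getVert (n % w.length)
  half := w.length / 2
  half_pos := by grind
  adj n := by
    have hlt := Nat.mod_lt n hpos
    have h := w.adj_getVert_succ hlt
    rcases Nat.lt_or_eq_of_le (show n % w.length + 1 ≤ w.length from hlt) with hsucc | hsucc
    · rwa [Nat.add_mod, Nat.mod_eq_of_lt (a := 1) (by omega), Nat.mod_eq_of_lt hsucc]
    · have hone : 1 < w.length := by grind
      rw [hsucc, SimpleGraph.Walk.getVert_length] at h
      rwa [Nat.add_mod, Nat.mod_eq_of_lt hone, hsucc, Nat.mod_self, SimpleGraph.Walk.getVert_zero]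
  periodic n := by rw [Nat.two_mul_div_two_of_even heven, Nat.add_mod_right]

variable {u : V} {w : G.Walk u u} {heven : Even w.length} {hpos : 0 < w.length}

theorem ofWalk_two_mul_half : 2 * (ofWalk w heven hpos).half = w.length :=
  Nat.two_mul_div_two_of_even heven

theorem ofWalk_vert {n : ℕ} (hn : n ≤ w.length) : (ofWalk w heven hpos).vert n = w.getVert n := by
  change w.getVert (n % w.length) = _
  rcases hn.lt_or_eq with hn | rfl
  · rw [Nat.mod_eq_of_lt hn]
  · rw [Nat.mod_self, SimpleGraph.Walk.getVert_zero, SimpleGraph.Walk.getVert_length]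

theorem ofWalk_edge (i : Fin w.length) : (ofWalk w heven hpos).edge i = edgeAt w i := by
  refine Subtype.ext ?_
  simp only [edge, edgeAt]
  rw [ofWalk_vert i.2.le, ofWalk_vert i.2]

theorem ofWalk_plus : (ofWalk w heven hpos).plus = evenPart w := by
  rw [plus, evenOn, period, ofWalk_two_mul_half, evenPart, Finset.sum_filter, Finset.sum_filter,
    ← Fin.sum_univ_eq_sum_range (fun n => if Even n then
      Finsupp.single ((ofWalk w heven hpos).edge n) 1 else 0)]
  simp only [ofWalk_edge]

theorem ofWalk_minus : (ofWalk w heven hpos).minus = oddPart w := by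
  rw [minus, oddOn, period, ofWalk_two_mul_half, oddPart, Finset.sum_filter, Finset.sum_filter,
    ← Fin.sum_univ_eq_sum_range (fun n => if Odd n then
      Finsupp.single ((ofWalk w heven hpos).edge n) 1 else 0)]
  simp only [ofWalk_edge]

end OfWalk

end ClosedSeq

section Squarefree

variable {σ : Type*} {u v : σ →₀ ℕ}

theorem le_of_support_subset (hu : ∀ e, u e ≤ 1) (h : u.support ⊆ v.support) : u ≤ v := by
  intro e
  by_cases he : u e = 0
  · rw [he]
    exact Nat.zero_le _
  · have := Finsupp.mem_support_iff.1 (h (Finsupp.mem_support_iff.2 he))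
    have := hu e
    omega

theorem card_support_eq_degree (hu : ∀ e, u e ≤ 1) : u.support.card = u.degree := by
  rw [Finsupp.degree_apply, Finset.card_eq_sum_ones]
  refine Finset.sum_congr rfl fun e he => ?_
  have := Finsupp.mem_support_iff.1 he
  have := hu e
  omega

end Squarefree

section Critical

variable {V : Type*} {G : SimpleGraph V} {a b M M' N u u' : G.edgeSet →₀ ℕ}

theorem IsCritical.not_hasSplit (hM : IsCritical (edgeVec G) M) : ¬ HasSplit M N :=
  fun ⟨_, ha, _, _, hr, _⟩ => hr (hM.isRigid_of_lt ha)

theorem IsPrimitivePair.exists_walk (h : IsPrimitivePair (edgeVec G) a b) (ha : a ≠ 0) :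
    ∃ (x : V) (w : G.Walk x x), Even w.length ∧ 0 < w.length ∧
      ((evenPart w = a ∧ oddPart w = b) ∨ (evenPart w = b ∧ oddPart w = a)) := by
  obtain ⟨x, w, heven, hpos, hw⟩ := exists_even_closed_isAlternating h.degA_eq ha
  refine ⟨x, w, heven, hpos, ?_⟩
  have hd := degA_evenPart_eq_degA_oddPart heven
  have hne : ¬ (evenPart w = 0 ∧ oddPart w = 0) := by
    rintro ⟨h0, h0'⟩
    have := degree_evenPart_add_degree_oddPart w
    rw [h0, h0', map_zero] at this
    omega
  rcases hw with ⟨ha', hb'⟩ | ⟨hb', ha'⟩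
  · exact Or.inl ((h.eq_zero_or_eq _ ha' _ hb' hd).resolve_left hne)
  · exact Or.inr ((h.symm.eq_zero_or_eq _ hb' _ ha' hd).resolve_left hne)

theorem IsPrimitivePair.exists_closedSeq (h : IsPrimitivePair (edgeVec G) a b) (ha : a ≠ 0) :
    ∃ c : ClosedSeq G, c.plus = a ∧ c.minus = b := by
  obtain ⟨x, w, heven, hpos, ⟨rfl, rfl⟩ | ⟨rfl, rfl⟩⟩ := h.exists_walk ha
  · exact ⟨.ofWalk w heven hpos, ClosedSeq.ofWalk_plus, ClosedSeq.ofWalk_minus⟩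
  · exact ⟨(ClosedSeq.ofWalk w heven hpos).shift 1,
      (ClosedSeq.shift_one_plus _).trans ClosedSeq.ofWalk_minus,
      (ClosedSeq.shift_one_minus _).trans ClosedSeq.ofWalk_plus⟩

theorem IsCritical.ne_zero (hM : IsCritical (edgeVec G) M) : M ≠ 0 := by
  rintro rfl
  exact hM.not_isRigid fun v hv => eq_zero_of_degA_edgeVec_eq_zero v (hv.trans degA_zero)

theorem IsCritical.isPrimitivePair_edgeVec (hM : IsCritical (edgeVec G) M)
    (hN : degA (edgeVec G) N = degA (edgeVec G) M) (hne : N ≠ M) :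
    IsPrimitivePair (edgeVec G) M N :=
  hM.isPrimitivePair eq_zero_of_degA_edgeVec_eq_zero hN hne

theorem IsCritical.exists_closedSeq (hM : IsCritical (edgeVec G) M)
    (hN : degA (edgeVec G) N = degA (edgeVec G) M) (hne : N ≠ M) :
    ∃ c : ClosedSeq G, c.plus = M ∧ c.minus = N ∧ c.IsPrimitive ∧ ¬ HasSplit c.plus c.minus := by
  have hP := hM.isPrimitivePair_edgeVec hN hne
  obtain ⟨c, rfl, rfl⟩ := hP.exists_closedSeq hM.ne_zero
  exact ⟨c, rfl, rfl, hP, hM.not_hasSplit⟩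

theorem IsCritical.le_one_of_degA_eq (hG : CondSharp G) (hM : IsCritical (edgeVec G) M)
    (hN : degA (edgeVec G) N = degA (edgeVec G) M) (hne : N ≠ M) (e : G.edgeSet) : N e ≤ 1 := by
  obtain ⟨c, rfl, rfl, hP, hS⟩ := hM.exists_closedSeq hN hne
  exact c.minus_le_one hG hP hS e

theorem IsCritical.le_one (hG : CondSharp G) (hM : IsCritical (edgeVec G) M) (e : G.edgeSet) :
    M e ≤ 1 := by
  obtain ⟨N, hN, hne⟩ := not_isRigid_iff.1 hM.not_isRigid
  obtain ⟨c, rfl, rfl, hP, hS⟩ := hM.exists_closedSeq hN hne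
  exact c.plus_le_one hG hP hS e

theorem IsCritical.le_of_support_subset (hG : CondSharp G) (hM : IsCritical (edgeVec G) M)
    (hu : ¬ IsRigid (edgeVec G) u) (h : u.support ⊆ M.support) : M ≤ u := by
  obtain ⟨u', hle, hu'⟩ := exists_isCritical_le hu
  have hle' : u' ≤ M :=
    GraphToric.le_of_support_subset (hu'.le_one hG) ((Finsupp.support_mono hle).trans h)
  exact hM.eq_of_le hu'.not_isRigid hle' ▸ hle

-- A split would force an edge to occur twice in `c`, hence `c` to have more edges than
-- `deg M + deg M'`.
theorem not_hasSplit_of_support_subset (hG : CondSharp G) (hM : IsCritical (edgeVec G) M)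
    (hM' : IsCritical (edgeVec G) M') {c : ClosedSeq G} (hP : c.IsPrimitive)
    (hplus : c.plus.support ⊆ M.support) (hminus : c.minus.support ⊆ M'.support) :
    ¬ HasSplit c.plus c.minus := by
  rintro ⟨a, ha, b, hb, hra, hrb, hdeg⟩
  have hMa := hM.le_of_support_subset hG hra ((Finsupp.support_mono ha.le).trans hplus)
  have hMb := hM'.le_of_support_subset hG hrb ((Finsupp.support_mono hb.le).trans hminus)
  obtain ⟨e, he⟩ : ∃ e, 1 < c.plus e := by
    by_contra! hle
    exact (hMa.trans_lt ha).not_ge (GraphToric.le_of_support_subset hle hplus)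
  obtain ⟨i, j, hij, hj, hv⟩ := ClosedSeq.exists_vert_eq_of_one_lt_plus hP he
  have hcard := ClosedSeq.half_add_two_le_card_support hP hij hj hv
  have hcardM := (Finset.card_le_card hplus).trans_eq (card_support_eq_degree (hM.le_one hG))
  have hcardM' := (Finset.card_le_card hminus).trans_eq (card_support_eq_degree (hM'.le_one hG))
  have := Finsupp.degree_mono hMa
  have := Finsupp.degree_mono hMb
  have := c.degree_plus
  omega

theorem IsCritical.degA_eq_of_support (hG : CondSharp G) (hM : IsCritical (edgeVec G) M)
    (hM' : IsCritical (edgeVec G) M') (hu : u.support = M.support) (hu' : u'.support = M'.support)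
    (h : degA (edgeVec G) u = degA (edgeVec G) u') :
    degA (edgeVec G) M = degA (edgeVec G) M' := by
  rcases eq_or_ne u u' with rfl | hne
  · rw [(GraphToric.le_of_support_subset (hM.le_one hG) (hu ▸ hu').le).antisymm
      (GraphToric.le_of_support_subset (hM'.le_one hG) (hu ▸ hu').ge)]
  obtain ⟨a, hau, b, hbu', hab, hP⟩ := exists_isPrimitivePair_le h hne
  have haM : a.support ⊆ M.support := (Finsupp.support_mono hau).trans hu.le
  have hbM' : b.support ⊆ M'.support := (Finsupp.support_mono hbu').trans hu'.le
  have hMa := hM.le_of_support_subset hG (not_isRigid_of_degA_eq hP.degA_eq hab) haM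
  have hMb := hM'.le_of_support_subset hG (not_isRigid_of_degA_eq hP.symm.degA_eq hab.symm) hbM'
  have ha0 : a ≠ 0 := by
    rintro rfl
    exact hM.ne_zero (le_zero_iff.1 hMa)
  obtain ⟨c, rfl, rfl⟩ := hP.exists_closedSeq ha0
  have hS := not_hasSplit_of_support_subset hG hM hM' hP haM hbM'
  rw [hMa.antisymm (GraphToric.le_of_support_subset (c.plus_le_one hG hP hS) haM),
    hMb.antisymm (GraphToric.le_of_support_subset (c.minus_le_one hG hP hS) hbM'), hP.degA_eq]

end Critical

/-! ### Blocks and bridges -/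

section Blocks

open SimpleGraph

variable {V : Type*} {G : SimpleGraph V}

theorem deleteVerts_singleton_sup (H K : G.Subgraph) (x : V) :
    (H ⊔ K).deleteVerts {x} = H.deleteVerts {x} ⊔ K.deleteVerts {x} := by
  ext a b
  · simp only [Subgraph.deleteVerts_verts, Subgraph.verts_sup, Set.mem_sdiff, Set.mem_union]
    tauto
  · simp only [Subgraph.deleteVerts_adj, Subgraph.verts_sup, Subgraph.sup_adj, Set.mem_union]
    constructor
    · rintro ⟨-, ha, -, hb, h | h⟩
      · exact Or.inl ⟨h.fst_mem, ha, h.snd_mem, hb, h⟩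
      · exact Or.inr ⟨h.fst_mem, ha, h.snd_mem, hb, h⟩
    · tauto

theorem IsBiconnected.preconnected_deleteVerts {H : G.Subgraph} (h : IsBiconnected H) (x : V) :
    (H.deleteVerts {x}).Preconnected := by
  by_cases hx : x ∈ H.verts
  · exact h.2 x hx
  · rw [← Subgraph.deleteVerts_inter_verts_left_eq, Set.inter_singleton_eq_empty.2 hx,
      Subgraph.deleteVerts_empty]
    exact h.1.preconnected

theorem IsBiconnected.sup {H K : G.Subgraph} (hH : IsBiconnected H) (hK : IsBiconnected K)
    {x y : V} (hxy : x ≠ y) (hxH : x ∈ H.verts) (hxK : x ∈ K.verts) (hyH : y ∈ H.verts)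
    (hyK : y ∈ K.verts) : IsBiconnected (H ⊔ K) := by
  refine ⟨Subgraph.connected_sup hH.1.preconnected hK.1.preconnected ⟨x, hxH, hxK⟩, fun z _ => ?_⟩
  rw [deleteVerts_singleton_sup]
  refine (Subgraph.connected_sup (hH.preconnected_deleteVerts z)
    (hK.preconnected_deleteVerts z) ?_).preconnected
  by_cases hzx : x = z
  · have hyz : y ≠ z := fun h => hxy (hzx.trans h.symm)
    exact ⟨y, ⟨hyH, hyz⟩, ⟨hyK, hyz⟩⟩
  · exact ⟨x, ⟨hxH, hzx⟩, ⟨hxK, hzx⟩⟩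

variable {u : V} {w : G.Walk u u}

theorem le_of_isBlock {B C : G.Subgraph} (hB : IsBlock w B) (hCw : C ≤ w.toSubgraph)
    (hC : IsBiconnected C) {x : V} (hxB : x ∈ B.verts) (hxC : x ∈ C.verts)
    (hnbr : ∀ y, w.toSubgraph.Adj x y → y ∈ C.verts) : C ≤ B := by
  by_cases hnt : Nontrivial B.verts
  · obtain ⟨y, hy⟩ := hB.1.2.1.preconnected.exists_adj_of_nontrivial ⟨x, hxB⟩
    have hCB := hC.sup hB.1.2 hy.ne hxC hxB (hnbr y (hB.1.1.2 hy)) hy.snd_mem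
    exact le_sup_left.trans (hB.2 ⟨sup_le hCw hB.1.1, hCB⟩ le_sup_right)
  · rw [not_nontrivial_iff_subsingleton, Set.subsingleton_coe] at hnt
    refine hB.2 ⟨hCw, hC⟩ ⟨fun y hy => hnt hy hxB ▸ hxC, fun a b hab => ?_⟩
    exact absurd (hnt hab.fst_mem hab.snd_mem) hab.ne

theorem eq_of_isBlock {B₁ B₂ C : G.Subgraph} (hB₁ : IsBlock w B₁) (hB₂ : IsBlock w B₂)
    (h₁ : C ≤ B₁) (h₂ : C ≤ B₂) {x y : V} (hxy : x ≠ y) (hx : x ∈ C.verts) (hy : y ∈ C.verts) :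
    B₁ = B₂ := by
  have h := hB₁.1.2.sup hB₂.1.2 hxy (h₁.1 hx) (h₂.1 hx) (h₁.1 hy) (h₂.1 hy)
  have hle := sup_le hB₁.1.1 hB₂.1.1
  exact le_antisymm (le_sup_left.trans (hB₂.2 ⟨hle, h⟩ le_sup_right))
    (le_sup_right.trans (hB₁.2 ⟨hle, h⟩ le_sup_left))

end Blocks

namespace ClosedSeq

open SimpleGraph

variable {V : Type*} {G : SimpleGraph V} {c : ClosedSeq G}

theorem vert_congr {m n : ℕ} (h : m ≡ n [MOD 2 * c.half]) : c.vert m = c.vert n := by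
  rw [← c.vert_mod m, h, c.vert_mod]

theorem edge_congr {m n : ℕ} (h : m ≡ n [MOD 2 * c.half]) : c.edge m = c.edge n :=
  Subtype.ext (congrArg₂ (fun x y => s(x, y)) (vert_congr h) (vert_congr (h.add_right 1)))

/-- The walk passes only once per period through the vertex at position `p`; positions are taken
modulo the period. -/
def IsSimpleAt (c : ClosedSeq G) (p : ℕ) : Prop :=
  ∀ m, c.vert m = c.vert p → m ≡ p [MOD 2 * c.half]

theorem IsSimpleAt.eq {p m : ℕ} (h : c.IsSimpleAt p) (hp : p < 2 * c.half) (hm : m < 2 * c.half)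
    (hv : c.vert m = c.vert p) : m = p :=
  (h m hv).eq_of_lt_of_lt hm hp

theorem isSimpleAt_of_forall_lt {p : ℕ} (h : ∀ m < 2 * c.half, c.vert m = c.vert p → m = p) :
    c.IsSimpleAt p := by
  intro m hm
  have hmod := h _ (Nat.mod_lt m (Nat.mul_pos two_pos c.half_pos)) ((c.vert_mod m).trans hm)
  exact ((Nat.mod_modEq m _).symm.trans (congrArg (· % _) hmod))

theorem IsSimpleAt.congr {p p' : ℕ} (h : c.IsSimpleAt p) (hp : p' ≡ p [MOD 2 * c.half]) :
    c.IsSimpleAt p' :=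
  fun m hm => (h m (hm.trans (vert_congr hp))).trans hp.symm

/-- The part of the walk between the positions `a` and `b`, as a subgraph. -/
def arc (c : ClosedSeq G) (a b : ℕ) : G.Subgraph where
  verts := c.vert '' Set.Icc a b
  Adj x y := ∃ n, a ≤ n ∧ n < b ∧ s(c.vert n, c.vert (n + 1)) = s(x, y)
  adj_sub := by
    rintro x y ⟨n, -, -, hn⟩
    have := c.adj n
    rwa [← SimpleGraph.mem_edgeSet, hn] at this
  edge_vert := by
    rintro x y ⟨n, ha, hb, hn⟩
    rcases Sym2.eq_iff.1 hn with ⟨rfl, -⟩ | ⟨-, rfl⟩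
    · exact ⟨n, ⟨ha, hb.le⟩, rfl⟩
    · exact ⟨n + 1, ⟨by omega, hb⟩, rfl⟩
  symm := ⟨fun _ _ ⟨n, ha, hb, hn⟩ => ⟨n, ha, hb, hn.trans Sym2.eq_swap⟩⟩

theorem vert_mem_arc {a b n : ℕ} (ha : a ≤ n) (hb : n ≤ b) : c.vert n ∈ (c.arc a b).verts :=
  ⟨n, ⟨ha, hb⟩, rfl⟩

theorem arc_self_connected (a : ℕ) : (c.arc a a).Connected := by
  have hle : G.singletonSubgraph (c.vert a) ≤ c.arc a a :=
    ⟨Set.singleton_subset_iff.2 (vert_mem_arc le_rfl le_rfl), fun _ _ h => h.elim⟩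
  exact Subgraph.singletonSubgraph_connected.mono hle (by simp [arc])

theorem arc_connected {a b : ℕ} (h : a ≤ b) : (c.arc a b).Connected := by
  induction b, h using Nat.le_induction with
  | base => exact arc_self_connected a
  | succ n han ih =>
    have hedge := Subgraph.subgraphOfAdj_connected (c.adj n)
    have hle : c.arc a n ≤ c.arc a (n + 1) :=
      ⟨Set.image_mono (Set.Icc_subset_Icc_right n.le_succ),
        fun x y ⟨m, ha, hb, hm⟩ => ⟨m, ha, by omega, hm⟩⟩
    have hadj : (c.arc a (n + 1)).Adj (c.vert n) (c.vert (n + 1)) := ⟨n, han, n.lt_succ_self, rfl⟩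
    have hle' : G.subgraphOfAdj (c.adj n) ≤ c.arc a (n + 1) := subgraphOfAdj_le_of_adj _ hadj
    have hsup : (c.arc a n ⊔ G.subgraphOfAdj (c.adj n)).Connected :=
      Subgraph.connected_sup ih.preconnected hedge.preconnected
        ⟨c.vert n, vert_mem_arc han le_rfl, Or.inl rfl⟩
    refine hsup.mono (sup_le hle hle') ?_
    rw [Subgraph.verts_sup, subgraphOfAdj_verts]
    change c.vert '' _ ∪ _ = c.vert '' _
    rw [← Set.image_pair, ← Set.image_union]
    congr 1
    ext m
    simp only [Set.mem_union, Set.mem_Icc, Set.mem_insert_iff, Set.mem_singleton_iff]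
    omega

theorem arc_le_deleteVerts {a b i j : ℕ} {x : V} (hi : a ≤ i) (hj : j ≤ b)
    (hx : ∀ n, i ≤ n → n ≤ j → c.vert n ≠ x) : c.arc i j ≤ (c.arc a b).deleteVerts {x} := by
  have hverts : ∀ n, i ≤ n → n ≤ j → c.vert n ∈ (c.arc a b).verts \ {x} := fun n h h' =>
    ⟨vert_mem_arc (hi.trans h) (h'.trans hj), hx n h h'⟩
  refine ⟨?_, ?_⟩
  · rintro _ ⟨n, ⟨h, h'⟩, rfl⟩
    exact hverts n h h'
  · rintro y z ⟨n, h, h', hn⟩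
    have hyz : (c.arc a b).Adj y z := ⟨n, by omega, by omega, hn⟩
    rw [Subgraph.deleteVerts_adj]
    rcases Sym2.eq_iff.1 hn with ⟨rfl, rfl⟩ | ⟨rfl, rfl⟩
    · exact ⟨hyz.fst_mem, hx n h h'.le, hyz.snd_mem, hx (n + 1) (by omega) h', hyz⟩
    · exact ⟨hyz.fst_mem, hx (n + 1) (by omega) h', hyz.snd_mem, hx n h h'.le, hyz⟩

section ClosedArc

variable {a b m : ℕ}

theorem preconnected_arc_deleteVerts_left (hab : a < b) (h : c.vert b = c.vert a)
    (hinj : Set.InjOn c.vert (Set.Ico a b)) :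
    ((c.arc a b).deleteVerts {c.vert a}).Preconnected := by
  have hb : a + 1 ≤ b - 1 := by
    by_contra hlt
    obtain rfl : b = a + 1 := by omega
    exact (c.adj a).ne h.symm
  have hne : ∀ n, a + 1 ≤ n → n ≤ b - 1 → c.vert n ≠ c.vert a := fun n h1 h2 heq => by
    have := hinj ⟨by omega, by omega⟩ ⟨le_rfl, hab⟩ heq
    omega
  refine ((arc_connected hb).mono (arc_le_deleteVerts (by omega) (by omega) hne)
    (subset_antisymm (arc_le_deleteVerts (by omega) (by omega) hne).1 ?_)).preconnected
  rintro _ ⟨⟨n, ⟨h1, h2⟩, rfl⟩, hna⟩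
  have hn : n ≠ a ∧ n ≠ b := ⟨fun h' => hna (h' ▸ rfl), fun h' => hna (h' ▸ h)⟩
  exact vert_mem_arc (by omega) (by omega)

theorem preconnected_arc_deleteVerts (hma : a < m) (hmb : m < b) (h : c.vert b = c.vert a)
    (hinj : Set.InjOn c.vert (Set.Ico a b)) :
    ((c.arc a b).deleteVerts {c.vert m}).Preconnected := by
  have hne : ∀ n, a ≤ n → n < b → n ≠ m → c.vert n ≠ c.vert m := fun n h1 h2 h3 heq =>
    h3 (hinj ⟨h1, h2⟩ ⟨hma.le, hmb⟩ heq)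
  have hle : c.arc a (m - 1) ⊔ c.arc (m + 1) b ≤ (c.arc a b).deleteVerts {c.vert m} := by
    refine sup_le (arc_le_deleteVerts le_rfl (by omega) fun n h1 h2 => ?_)
      (arc_le_deleteVerts (by omega) le_rfl fun n h1 h2 => ?_)
    · exact hne n h1 (by omega) (by omega)
    · rcases h2.lt_or_eq with h3 | rfl
      · exact hne n (by omega) h3 (by omega)
      · exact h ▸ hne a le_rfl (by omega) (by omega)
  refine ((Subgraph.connected_sup (arc_connected (by omega)).preconnected
    (arc_connected (by omega)).preconnected ⟨c.vert a, vert_mem_arc le_rfl (by omega), ?_⟩).mono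
      hle (subset_antisymm hle.1 ?_)).preconnected
  · exact h ▸ vert_mem_arc (by omega) le_rfl
  · rintro _ ⟨⟨n, ⟨h1, h2⟩, rfl⟩, hnm⟩
    rcases lt_trichotomy n m with h3 | rfl | h3
    · exact Or.inl (vert_mem_arc h1 (by omega))
    · exact absurd rfl hnm
    · exact Or.inr (vert_mem_arc h3 h2)

theorem arc_isBiconnected (hab : a < b) (h : c.vert b = c.vert a)
    (hinj : Set.InjOn c.vert (Set.Ico a b)) : IsBiconnected (c.arc a b) := by
  refine ⟨arc_connected hab.le, ?_⟩
  rintro _ ⟨m, ⟨h1, h2⟩, rfl⟩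
  rcases h1.lt_or_eq with h1 | rfl
  · rcases h2.lt_or_eq with h2 | rfl
    · exact preconnected_arc_deleteVerts h1 h2 h hinj
    · exact h ▸ preconnected_arc_deleteVerts_left hab h hinj
  · exact preconnected_arc_deleteVerts_left hab h hinj

end ClosedArc

section Bridges

variable {u : V} {w : G.Walk u u} {heven : Even w.length} {hpos : 0 < w.length}

theorem toSubgraph_adj_iff_exists {x y : V} : w.toSubgraph.Adj x y ↔
    ∃ n, s((ofWalk w heven hpos).vert n, (ofWalk w heven hpos).vert (n + 1)) = s(x, y) := by
  rw [Walk.toSubgraph_adj_iff]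
  constructor
  · rintro ⟨i, hi, hlt⟩
    exact ⟨i, by rw [ofWalk_vert hlt.le, ofWalk_vert hlt, hi]⟩
  · rintro ⟨n, hn⟩
    have hlt := Nat.mod_lt n hpos
    refine ⟨n % w.length, ?_, hlt⟩
    rw [← hn, ← ofWalk_vert (heven := heven) (hpos := hpos) hlt.le,
      ← ofWalk_vert (heven := heven) (hpos := hpos) hlt]
    have hmod := Nat.mod_modEq n (2 * (ofWalk w heven hpos).half)
    rw [ofWalk_two_mul_half] at hmod
    exact congrArg Subtype.val
      (edge_congr (c := ofWalk w heven hpos) (by rwa [ofWalk_two_mul_half]))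

theorem arc_le_toSubgraph {a b : ℕ} : (ofWalk w heven hpos).arc a b ≤ w.toSubgraph := by
  constructor
  · rintro _ ⟨n, -, rfl⟩
    rw [Walk.mem_verts_toSubgraph]
    exact w.getVert_mem_support _
  · rintro x y ⟨n, -, -, hn⟩
    exact toSubgraph_adj_iff_exists.2 ⟨n, hn⟩

theorem mem_arc_of_adj {a b p : ℕ} (hp : (ofWalk w heven hpos).IsSimpleAt p) (ha : a < p)
    (hb : p < b) {y : V} (hy : w.toSubgraph.Adj ((ofWalk w heven hpos).vert p) y) :
    y ∈ ((ofWalk w heven hpos).arc a b).verts := by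
  obtain ⟨n, hn⟩ := (toSubgraph_adj_iff_exists (heven := heven) (hpos := hpos)).1 hy
  rcases Sym2.eq_iff.1 hn with ⟨hnp, rfl⟩ | ⟨rfl, hnp⟩
  · rw [vert_congr ((hp n hnp).add_right 1)]
    exact vert_mem_arc (by omega) hb
  · have hprev : n ≡ p - 1 [MOD 2 * (ofWalk w heven hpos).half] :=
      Nat.ModEq.add_right_cancel' 1 (by
        rw [Nat.sub_add_cancel (by omega)]
        exact hp _ hnp)
    rw [vert_congr hprev]
    exact vert_mem_arc (by omega) (by omega)

theorem eq_of_isBlock_of_mem_Ioo {a b p q : ℕ}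
    (h : (ofWalk w heven hpos).vert b = (ofWalk w heven hpos).vert a)
    (hinj : Set.InjOn (ofWalk w heven hpos).vert (Set.Ico a b))
    (hp : (ofWalk w heven hpos).IsSimpleAt p) (hq : (ofWalk w heven hpos).IsSimpleAt q)
    (hpab : p ∈ Set.Ioo a b) (hqab : q ∈ Set.Ioo a b) {B₁ B₂ : G.Subgraph} (hB₁ : IsBlock w B₁)
    (hB₂ : IsBlock w B₂) (hpB : (ofWalk w heven hpos).vert p ∈ B₁.verts)
    (hqB : (ofWalk w heven hpos).vert q ∈ B₂.verts) : B₁ = B₂ := by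
  obtain ⟨hap, hpb⟩ := hpab
  obtain ⟨haq, hqb⟩ := hqab
  have hbi := arc_isBiconnected (hap.trans hpb) h hinj
  have h₁ := le_of_isBlock hB₁ arc_le_toSubgraph hbi hpB (vert_mem_arc hap.le hpb.le)
    fun _ hy => mem_arc_of_adj hp hap hpb hy
  have h₂ := le_of_isBlock hB₂ arc_le_toSubgraph hbi hqB (vert_mem_arc haq.le hqb.le)
    fun _ hy => mem_arc_of_adj hq haq hqb hy
  exact eq_of_isBlock hB₁ hB₂ h₁ h₂ ((ofWalk w heven hpos).adj a).ne
    (vert_mem_arc le_rfl (by omega)) (vert_mem_arc (by omega) (by omega))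

theorem injOn_vert_Ico (hG : CondSharp G) (hP : c.IsPrimitive)
    (hS : ¬ HasSplit c.plus c.minus) {a b : ℕ} (hb : b < a + 2 * c.half)
    (h : c.vert b = c.vert a) : Set.InjOn c.vert (Set.Ico a b) := by
  have hlt : ∀ k l, a ≤ k → k < l → l < b → c.vert k ≠ c.vert l := by
    intro k l hk hkl hl hv
    rcases hk.lt_or_eq with hk | rfl
    · exact false_of_two_doubles hG hP hS hkl hl (l := a + 2 * c.half) (by omega) (by omega) hv
        (h.trans (c.periodic a).symm)
    · have h1 := odd_of_vert_eq hP hkl (by omega) hv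
      have h2 := odd_of_vert_eq hP hl (by omega) (hv.symm.trans h.symm)
      have h3 := odd_of_vert_eq hP (hkl.trans hl) hb h.symm
      rw [Nat.odd_iff] at h1 h2 h3
      omega
  rintro k ⟨hk, hkb⟩ l ⟨hl, hlb⟩ hv
  rcases lt_trichotomy k l with hkl | hkl | hkl
  · exact absurd hv (hlt k l hk hkl hlb)
  · exact hkl
  · exact absurd hv.symm (hlt l k hl hkl hkb)

theorem injOn_vert_Ico_period (h : ∀ n < 2 * c.half, c.IsSimpleAt n) (a : ℕ) :
    Set.InjOn c.vert (Set.Ico a (a + 2 * c.half)) := by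
  intro k hk l hl hv
  have hmod := h _ (Nat.mod_lt l (Nat.mul_pos two_pos c.half_pos)) k (hv.trans (c.vert_mod l).symm)
  refine (hmod.trans (Nat.mod_modEq l _)).eq_of_abs_lt ?_
  rw [abs_lt]
  have := Set.mem_Ico.1 hk
  have := Set.mem_Ico.1 hl
  omega

theorem IsSimpleAt.mem_Ioo_or_exists {i j p : ℕ} (hp : c.IsSimpleAt p) (hij : i < j)
    (hj : j < 2 * c.half) (h : c.vert i = c.vert j) (hlt : p < 2 * c.half) :
    p ∈ Set.Ioo i j ∨ ∃ p' ∈ Set.Ioo j (i + 2 * c.half), p' ≡ p [MOD 2 * c.half] := by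
  have hne : ∀ k l, k < l → l < 2 * c.half → c.vert k = c.vert l → p ≠ k ∧ p ≠ l := by
    refine fun k l hkl hl hv => ⟨?_, ?_⟩ <;> rintro rfl
    · exact hkl.ne' (hp.eq hlt hl hv.symm)
    · exact hkl.ne (hp.eq hlt (hkl.trans hl) hv)
  obtain ⟨hpi, hpj⟩ := hne i j hij hj h
  rw [Set.mem_Ioo]
  by_cases h1 : p < i
  · exact Or.inr ⟨p + 2 * c.half, ⟨by omega, by omega⟩, Nat.add_modEq_right⟩
  · by_cases h2 : p < j
    · exact Or.inl (by omega)
    · exact Or.inr ⟨p, ⟨by omega, by omega⟩, rfl⟩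

/-- Where the walk meets itself it breaks into two closed arcs, and two adjacent simple vertices
lie on the same one; a walk that does not meet itself is cut open at a neighbour of `p`. -/
theorem exists_closed_arc (hG : CondSharp G) (hP : c.IsPrimitive)
    (hS : ¬ HasSplit c.plus c.minus) {p q : ℕ} (hpq : p + 1 < q) (hq : q < 2 * c.half)
    (hsp : c.IsSimpleAt p) (hsq : c.IsSimpleAt q) (hadj : G.Adj (c.vert p) (c.vert q)) :
    ∃ a b, c.vert b = c.vert a ∧ Set.InjOn c.vert (Set.Ico a b) ∧
      (∃ p' ∈ Set.Ioo a b, p' ≡ p [MOD 2 * c.half]) ∧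
      ∃ q' ∈ Set.Ioo a b, q' ≡ q [MOD 2 * c.half] := by
  by_cases hdouble : ∃ i j, i < j ∧ j < 2 * c.half ∧ c.vert i = c.vert j
  · obtain ⟨i, j, hij, hj, hv⟩ := hdouble
    rcases hsp.mem_Ioo_or_exists hij hj hv (by omega) with hpij | ⟨p', hp', hpp⟩ <;>
      rcases hsq.mem_Ioo_or_exists hij hj hv hq with hqij | ⟨q', hq', hqq⟩
    · exact ⟨i, j, hv.symm, injOn_vert_Ico hG hP hS (by omega) hv.symm, ⟨p, hpij, rfl⟩,
        ⟨q, hqij, rfl⟩⟩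
    · refine absurd ?_ (not_adj_of_crossing hP hS hpij.1 hpij.2 hq'.1 hq'.2 hv)
      rwa [vert_congr hqq]
    · refine absurd ?_ (not_adj_of_crossing hP hS hqij.1 hqij.2 hp'.1 hp'.2 hv)
      rw [vert_congr hpp]
      exact hadj.symm
    · have hv' : c.vert (i + 2 * c.half) = c.vert j := (c.periodic i).trans hv
      exact ⟨j, i + 2 * c.half, hv', injOn_vert_Ico hG hP hS (by omega) hv', ⟨p', hp', hpp⟩,
        ⟨q', hq', hqq⟩⟩
  · have hsimple : ∀ n < 2 * c.half, c.IsSimpleAt n := fun n hn =>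
      isSimpleAt_of_forall_lt fun m hm hv => by
        rcases lt_trichotomy m n with hlt | heq | hlt
        · exact absurd ⟨m, n, hlt, hn, hv⟩ hdouble
        · exact heq
        · exact absurd ⟨n, m, hlt, hm, hv.symm⟩ hdouble
    exact ⟨p + 1, p + 1 + 2 * c.half, c.periodic _, injOn_vert_Ico_period hsimple _,
      ⟨p + 2 * c.half, ⟨by omega, by omega⟩, Nat.add_modEq_right⟩, ⟨q, ⟨hpq, by omega⟩, rfl⟩⟩

theorem not_isBridgeAt (hG : CondSharp G) (hP : (ofWalk w heven hpos).IsPrimitive)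
    (hS : ¬ HasSplit (ofWalk w heven hpos).plus (ofWalk w heven hpos).minus) {p q : ℕ}
    (hpq : p + 1 < q) (hqw : q < w.length) (hp : (ofWalk w heven hpos).IsSimpleAt p)
    (hq : (ofWalk w heven hpos).IsSimpleAt q) (hadj : G.Adj (w.getVert p) (w.getVert q)) :
    ¬ IsBridgeAt w p q := by
  rintro ⟨B₁, B₂, hB₁, hB₂, hne, hpB, hqB⟩
  have hvp : (ofWalk w heven hpos).vert p = w.getVert p := ofWalk_vert (by omega)
  have hvq : (ofWalk w heven hpos).vert q = w.getVert q := ofWalk_vert hqw.le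
  obtain ⟨a, b, hab, hinj, ⟨p', hp', hpp⟩, q', hq', hqq⟩ := exists_closed_arc hG hP hS hpq
    (by rwa [ofWalk_two_mul_half]) hp hq (by rwa [hvp, hvq])
  refine hne (eq_of_isBlock_of_mem_Ioo hab hinj (hp.congr hpp) (hq.congr hqq) hp' hq'
    hB₁ hB₂ ?_ ?_)
  · rwa [vert_congr hpp, hvp]
  · rwa [vert_congr hqq, hvq]

end Bridges

end ClosedSeq

/-! ### Chords in other monomials of the same degree -/

section Monomials

variable {V : Type*} {G : SimpleGraph V} {Q : G.edgeSet →₀ ℕ} {e e' : G.edgeSet}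

theorem single_add_single_le {σ : Type*} {u : σ →₀ ℕ} {e e' : σ} (hne : e ≠ e') (he : 0 < u e)
    (he' : 0 < u e') : Finsupp.single e 1 + Finsupp.single e' 1 ≤ u := by
  classical
  intro f
  rw [Finsupp.add_apply, Finsupp.single_apply, Finsupp.single_apply]
  grind

theorem eq_of_degA_apply_eq_one {x : V} (h : degA (edgeVec G) Q x = 1) (he : x ∈ (e : Sym2 V))
    (he' : x ∈ (e' : Sym2 V)) (hQ : 0 < Q e) (hQ' : 0 < Q e') : e = e' := by
  by_contra hne
  have hle := degA_mono (single_add_single_le hne hQ hQ') x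
  rw [degA_add, degA_single, degA_single, one_smul, one_smul, Pi.add_apply, edgeVec_of_mem he,
    edgeVec_of_mem he', h] at hle
  exact absurd hle (by norm_num)

end Monomials

namespace ClosedSeq

variable {V : Type*} {G : SimpleGraph V} {c : ClosedSeq G}

section SimplePositions

variable {p q : ℕ}

theorem degA_plus (c : ClosedSeq G) :
    degA (edgeVec G) c.plus = ∑ n ∈ c.period, vertexVec (c.vert n) := by
  rw [plus_eq_sum, period]
  generalize c.half = s
  induction s with
  | zero => simp [degA_zero]
  | succ s ih =>
    rw [Finset.sum_range_succ, degA_add, ih, degA_single, one_smul, edge, edgeVec_mk, mul_add_one,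
      Finset.sum_range_succ, Finset.sum_range_succ, add_assoc]

theorem degA_plus_apply_of_isSimpleAt (hp : p < 2 * c.half) (h : c.IsSimpleAt p) :
    degA (edgeVec G) c.plus (c.vert p) = 1 := by
  have hmem : p ∈ c.period := Finset.mem_range.2 hp
  rw [degA_plus, Finset.sum_apply, Finset.sum_eq_single_of_mem p hmem, vertexVec_self]
  intro n hn hne
  exact vertexVec_of_ne fun heq => hne (h.eq hp (Finset.mem_range.1 hn) heq.symm)

theorem edge_ne_of_isSimpleAt (hp : c.IsSimpleAt p) (hq : c.IsSimpleAt q) (heven : Even (p + q))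
    (h : G.Adj (c.vert p) (c.vert q)) (n : ℕ) : c.edge n ≠ ⟨s(c.vert p, c.vert q), h⟩ := by
  intro heq
  have hodd : ∀ {x y : ℕ}, c.IsSimpleAt x → c.IsSimpleAt y → c.vert n = c.vert x →
      c.vert (n + 1) = c.vert y → Odd (x + y) := by
    intro x y hx hy hnx hny
    have hmod : x + 1 ≡ y [MOD 2] :=
      (((hx n hnx).symm.add_right 1).trans (hy _ hny)).of_mul_right c.half
    rw [Nat.ModEq] at hmod
    grind
  rw [← Nat.not_odd_iff_even] at heven
  rcases Sym2.eq_iff.1 (congrArg Subtype.val heq) with ⟨hnp, hnq⟩ | ⟨hnq, hnp⟩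
  · exact heven (hodd hp hq hnp hnq)
  · exact heven (add_comm q p ▸ hodd hq hp hnq hnp)

theorem exists_edge_eq_of_adj_of_odd (hP : c.IsPrimitive) (hS : ¬ HasSplit c.plus c.minus)
    (hp : p < 2 * c.half) (hq : q < 2 * c.half) (hodd : Odd (p + q))
    (h : G.Adj (c.vert p) (c.vert q)) :
    ∃ n < 2 * c.half, (c.edge n : Sym2 V) = s(c.vert p, c.vert q) := by
  wlog hpq : p < q generalizing p q
  · have hne : p ≠ q := fun heq => h.ne (congrArg c.vert heq)
    rw [Sym2.eq_swap]
    exact this hq hp (by rwa [add_comm]) h.symm (by omega)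
  rcases consecutive_of_adj hP hS hpq (by omega) hodd h with rfl | hlast
  · exact ⟨p, hp, rfl⟩
  · obtain rfl : p = 0 := by omega
    refine ⟨q, hq, ?_⟩
    change s(c.vert q, c.vert (q + 1)) = s(c.vert 0, c.vert q)
    rw [hlast, c.periodic, Sym2.eq_swap]

theorem isSimpleAt_of_adj (hP : c.IsPrimitive) (hS : ¬ HasSplit c.plus c.minus)
    (hp : p < 2 * c.half) (hq : q < 2 * c.half) (heven : Even (p + q))
    (h : G.Adj (c.vert p) (c.vert q))
    (hedge : ∀ n < 2 * c.half, (c.edge n : Sym2 V) ≠ s(c.vert p, c.vert q)) :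
    c.IsSimpleAt p := by
  refine isSimpleAt_of_forall_lt fun m hm hmp => ?_
  by_contra hne
  have hodd := odd_of_vert_eq_of_ne hP hne (by omega) (by omega) hmp
  obtain ⟨n, hn, hn'⟩ := exists_edge_eq_of_adj_of_odd hP hS hm hq (by grind) (hmp ▸ h)
  exact hedge n hn (hmp ▸ hn')

theorem exists_edge_eq_or_isSimpleAt (hP : c.IsPrimitive) (hS : ¬ HasSplit c.plus c.minus)
    (hp : p < 2 * c.half) (hq : q < 2 * c.half) (h : G.Adj (c.vert p) (c.vert q)) :
    (∃ n < 2 * c.half, (c.edge n : Sym2 V) = s(c.vert p, c.vert q)) ∨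
      (Even (p + q) ∧ c.IsSimpleAt p ∧ c.IsSimpleAt q) := by
  by_cases hedge : ∃ n < 2 * c.half, (c.edge n : Sym2 V) = s(c.vert p, c.vert q)
  · exact Or.inl hedge
  have heven : Even (p + q) := Nat.not_odd_iff_even.1 fun hodd =>
    hedge (exists_edge_eq_of_adj_of_odd hP hS hp hq hodd h)
  push Not at hedge
  refine Or.inr ⟨heven, isSimpleAt_of_adj hP hS hp hq heven h hedge, ?_⟩
  refine isSimpleAt_of_adj hP hS hq hp (by rwa [add_comm]) h.symm fun n hn => ?_
  rw [Sym2.eq_swap]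
  exact hedge n hn

end SimplePositions

/-- The two monomials of the binomial of the closed walk are `M` and `N`, in one order or the
other. -/
def Realizes (c : ClosedSeq G) (M N : G.edgeSet →₀ ℕ) : Prop :=
  (c.plus = M ∧ c.minus = N) ∨ (c.plus = N ∧ c.minus = M)

/-- The monomial `Q` contains the chord `{v_p, v_q}` of the closed walk, which joins two simple
vertices at positions of the same parity. -/
structure IsChordIn (c : ClosedSeq G) (Q : G.edgeSet →₀ ℕ) (p q : ℕ) : Prop where
  lt : p < q
  lt_period : q < 2 * c.half
  simple_left : c.IsSimpleAt p
  simple_right : c.IsSimpleAt q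
  even : Even (p + q)
  adj : G.Adj (c.vert p) (c.vert q)
  pos : 0 < Q ⟨s(c.vert p, c.vert q), adj⟩

theorem IsChordIn.edge_ne {Q : G.edgeSet →₀ ℕ} {p q : ℕ} (h : c.IsChordIn Q p q) (n : ℕ) :
    c.edge n ≠ ⟨s(c.vert p, c.vert q), h.adj⟩ :=
  edge_ne_of_isSimpleAt h.simple_left h.simple_right h.even h.adj n

section Chords

variable {M N : G.edgeSet →₀ ℕ} {m n : ℕ}

theorem Realizes.degA_plus (h : c.Realizes M N) :
    degA (edgeVec G) c.plus = degA (edgeVec G) M := by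
  rcases h with ⟨rfl, -⟩ | ⟨-, rfl⟩
  · rfl
  · exact c.degA_plus_eq_degA_minus

theorem Realizes.degA_eq (h : c.Realizes M N) : degA (edgeVec G) N = degA (edgeVec G) M := by
  have hd := c.degA_plus_eq_degA_minus
  rcases h with ⟨rfl, rfl⟩ | ⟨rfl, rfl⟩
  exacts [hd.symm, hd]

theorem Realizes.isPrimitive (h : c.Realizes M N) (hM : IsCritical (edgeVec G) M) (hne : N ≠ M) :
    c.IsPrimitive := by
  have hP := hM.isPrimitivePair_edgeVec h.degA_eq hne
  rcases h with ⟨rfl, rfl⟩ | ⟨rfl, rfl⟩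
  exacts [hP, hP.symm]

theorem Realizes.not_hasSplit (h : c.Realizes M N) (hM : IsCritical (edgeVec G) M) :
    ¬ HasSplit c.plus c.minus := by
  rcases h with ⟨rfl, rfl⟩ | ⟨rfl, rfl⟩
  exacts [hM.not_hasSplit, fun hS => hM.not_hasSplit (hS.symm c.degA_plus_eq_degA_minus)]

theorem Realizes.pos_or_pos_of_lt (h : c.Realizes M N) (hn : n < 2 * c.half) :
    0 < M (c.edge n) ∨ 0 < N (c.edge n) := by
  have hpos : 0 < c.plus (c.edge n) ∨ 0 < c.minus (c.edge n) :=
    (Nat.even_or_odd n).imp (fun h => plus_pos_iff.2 ⟨n, hn, h, rfl⟩)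
      fun h => minus_pos_iff.2 ⟨n, hn, h, rfl⟩
  rcases h with ⟨rfl, rfl⟩ | ⟨rfl, rfl⟩
  exacts [hpos, hpos.symm]

theorem Realizes.pos_or_pos_of_odd (h : c.Realizes M N) (hm : m < 2 * c.half) (hn : n < 2 * c.half)
    (hodd : Odd (m + n)) : 0 < N (c.edge m) ∨ 0 < N (c.edge n) := by
  rcases h with ⟨-, rfl⟩ | ⟨rfl, -⟩
  · rw [minus_pos_iff, minus_pos_iff]
    rcases Nat.even_or_odd m with hm' | hm'
    exacts [Or.inr ⟨n, hn, by grind, rfl⟩, Or.inl ⟨m, hm, hm', rfl⟩]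
  · rw [plus_pos_iff, plus_pos_iff]
    rcases Nat.even_or_odd m with hm' | hm'
    exacts [Or.inl ⟨m, hm, hm', rfl⟩, Or.inr ⟨n, hn, by grind, rfl⟩]

theorem Realizes.even_add_of_pos (h : c.Realizes M N) (hP : c.IsPrimitive) (hm : m < 2 * c.half)
    (hn : n < 2 * c.half) (hNm : 0 < N (c.edge m)) (hNn : 0 < N (c.edge n)) : Even (m + n) := by
  rcases h with ⟨-, rfl⟩ | ⟨rfl, -⟩
  · obtain ⟨k, hk, hk', hkm⟩ := minus_pos_iff.1 hNm
    obtain ⟨l, hl, hl', hln⟩ := minus_pos_iff.1 hNn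
    have := even_add_of_edge_eq hP hk hm hkm
    have := even_add_of_edge_eq hP hl hn hln
    grind
  · obtain ⟨k, hk, hk', hkm⟩ := plus_pos_iff.1 hNm
    obtain ⟨l, hl, hl', hln⟩ := plus_pos_iff.1 hNn
    have := even_add_of_edge_eq hP hk hm hkm
    have := even_add_of_edge_eq hP hl hn hln
    grind

end Chords

section CrossingChords

variable {S : Finset ℕ} {f f' : G.edgeSet}

theorem evenOn_apply_eq_zero (hf : ∀ n, c.edge n ≠ f) : c.evenOn S f = 0 := by
  classical
  rw [evenOn, sum_single_one_apply, Finset.card_eq_zero, Finset.filter_eq_empty_iff]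
  exact fun n _ => hf n

theorem oddOn_apply_eq_zero (hf : ∀ n, c.edge n ≠ f) : c.oddOn S f = 0 := by
  classical
  rw [oddOn, sum_single_one_apply, Finset.card_eq_zero, Finset.filter_eq_empty_iff]
  exact fun n _ => hf n

theorem not_isRigid_evenOn_of_chords (hf : ∀ n, c.edge n ≠ f)
    (h : c.altDeg S = edgeVec G f + edgeVec G f') : ¬ IsRigid (edgeVec G) (c.evenOn S) := by
  refine not_isRigid_iff.2 ⟨c.oddOn S + Finsupp.single f 1 + Finsupp.single f' 1, ?_, fun heq => ?_⟩
  · rw [degA_add, degA_add, degA_single, degA_single, one_smul, one_smul, add_assoc, ← h,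
      ← degA_evenOn_sub_degA_oddOn, add_sub_cancel]
  · have := DFunLike.congr_fun heq f
    simp only [evenOn_apply_eq_zero hf, Finsupp.add_apply, Finsupp.single_eq_same] at this
    omega

theorem not_isRigid_oddOn_of_chords (hf : ∀ n, c.edge n ≠ f)
    (h : c.altDeg S = -(edgeVec G f + edgeVec G f')) : ¬ IsRigid (edgeVec G) (c.oddOn S) := by
  refine not_isRigid_iff.2
    ⟨c.evenOn S + Finsupp.single f 1 + Finsupp.single f' 1, ?_, fun heq => ?_⟩
  · rw [degA_add, degA_add, degA_single, degA_single, one_smul, one_smul, add_assoc,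
      ← neg_eq_iff_eq_neg.2 h, ← degA_evenOn_sub_degA_oddOn, neg_sub, add_sub_cancel]
  · have := DFunLike.congr_fun heq f
    simp only [oddOn_apply_eq_zero hf, Finsupp.add_apply, Finsupp.single_eq_same] at this
    omega

theorem odd_of_mem_sdiff (hM : IsCritical (edgeVec G) c.plus) (hS : S ⊆ c.period)
    (hr : ¬ IsRigid (edgeVec G) (c.evenOn S)) : ∀ n ∈ c.period \ S, Odd n := by
  intro n hn
  by_contra heven
  have hsum := c.evenOn_add_evenOn_sdiff hS
  rw [← plus, hM.eq_of_le hr (c.evenOn_le_plus hS), add_eq_left, evenOn, Finset.sum_eq_zero_iff]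
    at hsum
  have := hsum n (Finset.mem_filter.2 ⟨hn, Nat.not_odd_iff_even.1 heven⟩)
  exact one_ne_zero (Finsupp.single_eq_zero.1 this)

theorem even_of_mem_sdiff (hM : IsCritical (edgeVec G) c.minus) (hS : S ⊆ c.period)
    (hr : ¬ IsRigid (edgeVec G) (c.oddOn S)) : ∀ n ∈ c.period \ S, Even n := by
  intro n hn
  by_contra hodd
  have hsum := c.oddOn_add_oddOn_sdiff hS
  rw [← minus, hM.eq_of_le hr (c.oddOn_le_minus hS), add_eq_left, oddOn, Finset.sum_eq_zero_iff]
    at hsum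
  have := hsum n (Finset.mem_filter.2 ⟨hn, Nat.not_even_iff_odd.1 hodd⟩)
  exact one_ne_zero (Finsupp.single_eq_zero.1 this)

variable {M N : G.edgeSet →₀ ℕ}

theorem Realizes.pos_of_mem_sdiff_or_pos_of_mem (h : c.Realizes M N) (hM : IsCritical (edgeVec G) M)
    (hS : S ⊆ c.period) (hf : ∀ n, c.edge n ≠ f)
    (halt : c.altDeg S = edgeVec G f + edgeVec G f') :
    (∀ n ∈ c.period \ S, 0 < N (c.edge n)) ∨ ∀ n ∈ S, 0 < N (c.edge n) := by
  rcases h with ⟨rfl, rfl⟩ | ⟨rfl, rfl⟩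
  · refine Or.inl fun n hn => minus_pos_iff.2 ⟨n, ?_, ?_, rfl⟩
    · exact Finset.mem_range.1 (Finset.mem_sdiff.1 hn).1
    · exact odd_of_mem_sdiff hM hS (not_isRigid_evenOn_of_chords hf halt) n hn
  · refine Or.inr fun n hn => plus_pos_iff.2 ⟨n, Finset.mem_range.1 (hS hn), ?_, rfl⟩
    have halt' : c.altDeg (c.period \ S) = -(edgeVec G f + edgeVec G f') := by
      rw [c.altDeg_sdiff hS, halt]
    refine even_of_mem_sdiff hM Finset.sdiff_subset (not_isRigid_oddOn_of_chords hf halt') n ?_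
    rwa [Finset.sdiff_sdiff_eq_self hS]

end CrossingChords

section ThirdMonomial

variable {M N Q : G.edgeSet →₀ ℕ}

theorem Realizes.exists_vert_eq_of_mem (h : c.Realizes M N)
    (hQ : degA (edgeVec G) Q = degA (edgeVec G) M) {e : G.edgeSet} (he : 0 < Q e) {x : V}
    (hx : x ∈ (e : Sym2 V)) : ∃ p < 2 * c.half, c.vert p = x := by
  have hpos : 0 < degA (edgeVec G) c.plus x := by
    rw [h.degA_plus, ← hQ]
    exact (Nat.cast_pos.2 he).trans_le (le_degA_apply Q hx)
  obtain ⟨e', hxe, hpos'⟩ := exists_pos_of_degA_apply_pos hpos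
  obtain ⟨n, hn, -, rfl⟩ := plus_pos_iff.1 hpos'
  rcases Sym2.mem_iff.1 hxe with rfl | rfl
  · exact ⟨n, hn, rfl⟩
  · exact c.exists_lt_vert_eq (n + 1)

theorem Realizes.pos_of_pos (h : c.Realizes M N) (hM : IsCritical (edgeVec G) M)
    (hQ : degA (edgeVec G) Q = degA (edgeVec G) M) (hQM : Q ≠ M) {n : ℕ} (hn : n < 2 * c.half)
    (hpos : 0 < Q (c.edge n)) : 0 < N (c.edge n) := by
  refine (h.pos_or_pos_of_lt hn).resolve_left fun hMn => ?_
  rcases hM.eq_zero_or_eq_zero hQ hQM (c.edge n) with h0 | h0 <;> omega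

theorem Realizes.exists_isChordIn_of_pos (h : c.Realizes M N) (hM : IsCritical (edgeVec G) M)
    (hNM : N ≠ M) (hQ : degA (edgeVec G) Q = degA (edgeVec G) M) (hQM : Q ≠ M) {e : G.edgeSet}
    (he : 0 < Q e) (hNe : N e = 0) :
    ∃ p q, c.IsChordIn Q p q ∧ (e : Sym2 V) = s(c.vert p, c.vert q) := by
  obtain ⟨⟨x, y⟩, hadj⟩ := e
  obtain ⟨p, hp, rfl⟩ := h.exists_vert_eq_of_mem hQ he (Sym2.mem_mk_left x y)
  obtain ⟨q, hq, rfl⟩ := h.exists_vert_eq_of_mem hQ he (Sym2.mem_mk_right _ y)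
  have hadj' : G.Adj (c.vert p) (c.vert q) := hadj
  rcases exists_edge_eq_or_isSimpleAt (h.isPrimitive hM hNM) (h.not_hasSplit hM) hp hq hadj' with
    ⟨n, hn, hne⟩ | ⟨heven, hsp, hsq⟩
  · have hne' : c.edge n = ⟨s(c.vert p, c.vert q), hadj⟩ := Subtype.ext hne
    have hpos := h.pos_of_pos hM hQ hQM hn (hne' ▸ he)
    exact absurd hNe (hne' ▸ hpos).ne'
  · rcases lt_trichotomy p q with hlt | rfl | hlt
    · exact ⟨p, q, ⟨hlt, hq, hsp, hsq, heven, hadj', he⟩, rfl⟩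
    · exact absurd rfl hadj'.ne
    · refine ⟨q, p, ⟨hlt, hp, hsq, hsp, by rwa [add_comm], hadj'.symm, ?_⟩, Sym2.eq_swap⟩
      convert he using 3
      exact Subtype.ext Sym2.eq_swap

theorem Realizes.exists_isChordIn_at (h : c.Realizes M N) (hG : CondSharp G)
    (hM : IsCritical (edgeVec G) M) (hNM : N ≠ M) (hQ : degA (edgeVec G) Q = degA (edgeVec G) M)
    (hQM : Q ≠ M) {e : G.edgeSet} (hNe : 0 < N e) (hQe : Q e = 0) {x : V}
    (hx : x ∈ (e : Sym2 V)) :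
    ∃ p q, c.IsChordIn Q p q ∧ (x = c.vert p ∨ x = c.vert q) := by
  obtain ⟨f, hxf, hf, hNf⟩ : ∃ f : G.edgeSet, x ∈ (f : Sym2 V) ∧ 0 < Q f ∧ N f = 0 := by
    by_contra! hno
    have hle : ∀ f : G.edgeSet, x ∈ (f : Sym2 V) → Q f ≤ N f := by
      intro f hf
      have hQf := hM.le_one_of_degA_eq hG hQ hQM f
      have := hno f hf
      omega
    have := eq_of_degA_apply_eq hle (by rw [hQ, h.degA_eq]) hx
    omega
  obtain ⟨p, q, hpq, heq⟩ := h.exists_isChordIn_of_pos hM hNM hQ hQM hf hNf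
  rw [heq] at hxf
  exact ⟨p, q, hpq, Sym2.mem_iff.1 hxf⟩

theorem Realizes.exists_isChordIn (h : c.Realizes M N) (hG : CondSharp G)
    (hM : IsCritical (edgeVec G) M) (hNM : N ≠ M) (hQ : degA (edgeVec G) Q = degA (edgeVec G) M)
    (hQM : Q ≠ M) (hQN : Q ≠ N) : ∃ p q, c.IsChordIn Q p q := by
  obtain ⟨e, he⟩ : ∃ e, Q e < N e := by
    by_contra! hle
    exact hQN (eq_of_le_of_degA_eq eq_zero_of_degA_edgeVec_eq_zero hle
      (by rw [h.degA_eq, hQ])).symm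
  have hNe := hM.le_one_of_degA_eq hG h.degA_eq hNM e
  obtain ⟨p, q, hpq, -⟩ :=
    h.exists_isChordIn_at hG hM hNM hQ hQM (by omega) (by omega) e.1.out_fst_mem
  exact ⟨p, q, hpq⟩

end ThirdMonomial

section CrossingPairs

variable {M N Q : G.edgeSet →₀ ℕ} {p q r t : ℕ}

/-- The monomial `Q` contains the chords `{v_p, v_q}` and `{v_r, v_t}` of the closed walk, which
cross effectively. -/
structure IsCrossingIn (c : ClosedSeq G) (Q : G.edgeSet →₀ ℕ) (p r q t : ℕ) : Prop where
  left_lt : p < r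
  lt : r < q
  lt_right : q < t
  odd : Odd (p + r)
  isChordIn : c.IsChordIn Q p q
  isChordIn' : c.IsChordIn Q r t

theorem IsChordIn.exists_isShortest (h : c.IsChordIn Q p q) :
    ∃ i j, c.IsChordIn Q i j ∧ ∀ p q, c.IsChordIn Q p q → j - i ≤ q - p := by
  obtain ⟨⟨i, j⟩, hij, hmin⟩ := exists_minimalFor_of_wellFoundedLT
    (fun x : ℕ × ℕ => c.IsChordIn Q x.1 x.2) (fun x => x.2 - x.1) ⟨(p, q), h⟩
  exact ⟨i, j, hij, fun p q hpq => (le_total _ _).elim id (hmin (j := (p, q)) hpq)⟩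

theorem IsChordIn.eq_zero_of_mem_edge (h : c.IsChordIn Q p q)
    (hQ : degA (edgeVec G) Q = degA (edgeVec G) c.plus) {n : ℕ}
    (hn : c.vert p ∈ (c.edge n : Sym2 V) ∨ c.vert q ∈ (c.edge n : Sym2 V)) :
    Q (c.edge n) = 0 := by
  by_contra h0
  have hpos := Nat.pos_of_ne_zero h0
  refine h.edge_ne n ?_
  rcases hn with hn | hn
  · have hdeg := degA_plus_apply_of_isSimpleAt (h.lt.trans h.lt_period) h.simple_left
    exact eq_of_degA_apply_eq_one (hQ ▸ hdeg) hn (Sym2.mem_mk_left _ _) hpos h.pos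
  · have hdeg := degA_plus_apply_of_isSimpleAt h.lt_period h.simple_right
    exact eq_of_degA_apply_eq_one (hQ ▸ hdeg) hn (Sym2.mem_mk_right _ _) hpos h.pos

theorem IsChordIn.exists_isCrossingIn {i j x : ℕ} (hij : c.IsChordIn Q i j)
    (hmin : ∀ p q, c.IsChordIn Q p q → j - i ≤ q - p) (hix : i < x) (hxj : x < j)
    (hodd : Odd (i + x)) (hpq : c.IsChordIn Q p q)
    (hx : c.vert x = c.vert p ∨ c.vert x = c.vert q) :
    ∃ p r q t, c.IsCrossingIn Q p r q t := by
  have hle := hmin p q hpq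
  have hjlt := hij.lt_period
  have hqlt := hpq.lt_period
  have hlt := hpq.lt
  have heven := hpq.even
  rcases hx with hx | hx
  · obtain rfl := hpq.simple_left.eq (by omega) (by omega) hx
    exact ⟨i, x, j, q, hix, hxj, by grind, hodd, hij, hpq⟩
  · obtain rfl := hpq.simple_right.eq (by omega) (by omega) hx
    exact ⟨p, i, x, j, by grind, hix, hxj, by grind, hpq, hij⟩

/-- A shortest chord in `Q` has an edge of `N` at one of its ends; the other end of that edge
carries a second chord in `Q`, which cannot be nested inside the first. -/
theorem Realizes.exists_isCrossingIn (h : c.Realizes M N) (hG : CondSharp G)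
    (hM : IsCritical (edgeVec G) M) (hNM : N ≠ M) (hQ : degA (edgeVec G) Q = degA (edgeVec G) M)
    (hQM : Q ≠ M) (hQN : Q ≠ N) : ∃ p r q t, c.IsCrossingIn Q p r q t := by
  obtain ⟨p, q, hpq⟩ := h.exists_isChordIn hG hM hNM hQ hQM hQN
  obtain ⟨i, j, hij, hmin⟩ := hpq.exists_isShortest
  have hlt := hij.lt
  have heven := hij.even
  have hj := hij.lt_period
  have hQ' : degA (edgeVec G) Q = degA (edgeVec G) c.plus := hQ.trans h.degA_plus.symm
  obtain ⟨k, rfl⟩ : ∃ k, j = k + 1 := ⟨j - 1, by omega⟩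
  rcases h.pos_or_pos_of_odd (m := i) (n := k) (by omega) (by omega) (by grind) with hN | hN
  · have hQi := hij.eq_zero_of_mem_edge hQ' (n := i) (Or.inl (Sym2.mem_mk_left _ _))
    obtain ⟨p, q, hpq, hx⟩ := h.exists_isChordIn_at hG hM hNM hQ hQM hN hQi (Sym2.mem_mk_right _ _)
    exact hij.exists_isCrossingIn hmin i.lt_succ_self (by grind) ⟨i, by omega⟩ hpq hx
  · have hQk := hij.eq_zero_of_mem_edge hQ' (n := k) (Or.inr (Sym2.mem_mk_right _ _))
    obtain ⟨p, q, hpq, hx⟩ := h.exists_isChordIn_at hG hM hNM hQ hQM hN hQk (Sym2.mem_mk_left _ _)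
    exact hij.exists_isCrossingIn hmin (by grind) k.lt_succ_self (by grind) hpq hx

theorem IsCrossingIn.altDeg (h : c.IsCrossingIn Q p r q t) :
    c.altDeg (Finset.Ico p r ∪ Finset.Ico q t)
      = (-1) ^ p *
        (edgeVec G ⟨s(_, _), h.isChordIn.adj⟩ + edgeVec G ⟨s(_, _), h.isChordIn'.adj⟩) := by
  rw [c.altDeg_Ico_union_Ico h.left_lt.le h.lt.le h.lt_right.le, edgeVec_mk, edgeVec_mk,
    neg_one_pow_congr (m := q) (n := p) (by grind [h.isChordIn.even]),
    neg_one_pow_congr (m := t) (n := r) (by grind [h.isChordIn'.even]),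
    neg_one_pow_eq_neg_of_odd_add h.odd]
  ring

theorem IsCrossingIn.pos_of_mem_or_pos_of_mem_sdiff (h : c.IsCrossingIn Q p r q t)
    (hR : c.Realizes M N) (hM : IsCritical (edgeVec G) M) :
    (∀ n ∈ Finset.Ico p r ∪ Finset.Ico q t, 0 < N (c.edge n)) ∨
      ∀ n ∈ c.period \ (Finset.Ico p r ∪ Finset.Ico q t), 0 < N (c.edge n) := by
  have hS : Finset.Ico p r ∪ Finset.Ico q t ⊆ c.period := by
    have := h.isChordIn.lt_period
    have := h.isChordIn'.lt_period
    have := h.lt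
    exact Finset.union_subset (c.Ico_subset_period (by omega)) (c.Ico_subset_period (by omega))
  have hf := h.isChordIn.edge_ne
  have halt := h.altDeg
  rcases Nat.even_or_odd p with hp | hp <;> rw [hp.neg_one_pow] at halt
  · rw [one_mul] at halt
    exact (hR.pos_of_mem_sdiff_or_pos_of_mem hM hS hf halt).symm
  · have halt' := c.altDeg_sdiff hS
    rw [halt, neg_one_mul, neg_neg] at halt'
    rw [← Finset.sdiff_sdiff_eq_self hS]
    convert hR.pos_of_mem_sdiff_or_pos_of_mem hM Finset.sdiff_subset hf halt' using 5
    rw [Finset.sdiff_sdiff_eq_self hS]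

theorem Realizes.not_pos_succ (h : c.Realizes M N) (hP : c.IsPrimitive) {n : ℕ}
    (hn : n + 1 < 2 * c.half) (hpos : 0 < N (c.edge n)) : ¬ 0 < N (c.edge (n + 1)) := by
  intro hpos'
  have := h.even_add_of_pos hP (by omega) hn hpos hpos'
  grind

/-- Otherwise `N` would contain two consecutive edges of the walk. -/
theorem IsCrossingIn.consecutive (h : c.IsCrossingIn Q p r q t) (hR : c.Realizes M N)
    (hM : IsCritical (edgeVec G) M) (hNM : N ≠ M) :
    (r = p + 1 ∧ t = q + 1 ∧ 0 < N (c.edge p) ∧ 0 < N (c.edge q)) ∨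
      (q = r + 1 ∧ p = 0 ∧ t + 1 = 2 * c.half ∧ 0 < N (c.edge r) ∧ 0 < N (c.edge t)) := by
  have hsucc {n : ℕ} (hn : n + 1 < 2 * c.half) := hR.not_pos_succ (hR.isPrimitive hM hNM) hn
  have hmem (n : ℕ) :
      n ∈ Finset.Ico p r ∪ Finset.Ico q t ↔ (p ≤ n ∧ n < r) ∨ (q ≤ n ∧ n < t) := by
    rw [Finset.mem_union, Finset.mem_Ico, Finset.mem_Ico]
  have ht := h.isChordIn'.lt_period
  obtain ⟨hpr, hrq, hqt, hodd, hpq, hrt⟩ := id h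
  rcases h.pos_of_mem_or_pos_of_mem_sdiff hR hM with hN | hN
  · have hN' (n : ℕ) (hn : (p ≤ n ∧ n < r) ∨ (q ≤ n ∧ n < t)) := hN n ((hmem n).2 hn)
    refine Or.inl ⟨?_, ?_, hN' p (by omega), hN' q (by omega)⟩
    · by_contra hne
      exact hsucc (by omega) (hN' p (by omega)) (hN' (p + 1) (by omega))
    · by_contra hne
      exact hsucc (by omega) (hN' q (by omega)) (hN' (q + 1) (by omega))
  · have hN' (n : ℕ) (hn : n < 2 * c.half) (hn' : ¬ ((p ≤ n ∧ n < r) ∨ (q ≤ n ∧ n < t))) :=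
      hN n (Finset.mem_sdiff.2 ⟨Finset.mem_range.2 hn, (hmem n).not.2 hn'⟩)
    have hqr : q = r + 1 := by
      by_contra hne
      exact hsucc (by omega) (hN' r (by omega) (by omega)) (hN' (r + 1) (by omega) (by omega))
    have hlast : t + 1 = 2 * c.half := by
      by_contra hne
      exact hsucc (by omega) (hN' t (by omega) (by omega)) (hN' (t + 1) (by omega) (by omega))
    refine Or.inr ⟨hqr, ?_, hlast, hN' r (by omega) (by omega), hN' t (by omega) (by omega)⟩
    by_contra hne
    obtain ⟨m, rfl⟩ : ∃ m, p = m + 2 := ⟨p - 2, by grind [hrt.even]⟩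
    exact hsucc (by omega) (hN' m (by omega) (by omega)) (hN' (m + 1) (by omega) (by omega))

end CrossingPairs

end ClosedSeq

section ThirdMonomial

variable {σ ι : Type*} {A : σ → ι → ℤ} {M N : σ →₀ ℕ}

theorem IsCritical.exists_third_of_not_isCritical (hM : IsCritical A M) (hd : degA A N = degA A M)
    (hNM : N ≠ M) (hN : ¬ IsCritical A N) : ∃ Q, degA A Q = degA A M ∧ Q ≠ M ∧ Q ≠ N := by
  obtain ⟨N₀, hle, hN₀⟩ := exists_isCritical_le (not_isRigid_of_degA_eq hd hNM)
  obtain ⟨N₁, hdeg, hne⟩ := not_isRigid_iff.1 hN₀.not_isRigid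
  have hlt : N₀ < N := hle.lt_of_ne fun h => hN (h ▸ hN₀)
  refine ⟨N₁ + (N - N₀), ?_, fun h => ?_, fun h => ?_⟩
  · rw [degA_add, degA_sub hle, hdeg, ← hd, add_sub_cancel]
  · obtain ⟨e, he⟩ : ∃ e, N₀ e < N e := by
      by_contra! hge
      exact hlt.not_ge hge
    have := DFunLike.congr_fun h e
    rw [Finsupp.add_apply, Finsupp.tsub_apply] at this
    rcases hM.eq_zero_or_eq_zero hd hNM e with h0 | h0 <;> omega
  · exact hne (add_right_cancel (h.trans (add_tsub_cancel_of_le hle).symm))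

end ThirdMonomial

section Squares

variable {V : Type*} {G : SimpleGraph V} {M N Q : G.edgeSet →₀ ℕ}

theorem not_isRigid_of_square {e e' f f' : G.edgeSet}
    (h : edgeVec G f + edgeVec G f' = edgeVec G e + edgeVec G e') (hef : e ≠ f) (hef' : e ≠ f') :
    ¬ IsRigid (edgeVec G) (Finsupp.single e 1 + Finsupp.single e' 1) := by
  refine not_isRigid_iff.2 ⟨Finsupp.single f 1 + Finsupp.single f' 1, ?_, fun heq => ?_⟩
  · simp only [degA_add, degA_single, one_smul, h]
  · have := DFunLike.congr_fun heq e
    rw [Finsupp.add_apply, Finsupp.add_apply, Finsupp.single_eq_of_ne hef,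
      Finsupp.single_eq_of_ne hef', Finsupp.single_eq_same] at this
    omega

theorem edgeVec_add_edgeVec_of_edges_eq {x : V} {ξ : G.Walk x x} {e f e' f' : G.edgeSet}
    (h : ξ.edges = [(e : Sym2 V), (f : Sym2 V), (e' : Sym2 V), (f' : Sym2 V)]) :
    edgeVec G f + edgeVec G f' = edgeVec G e + edgeVec G e' := by
  match ξ, h with
  | .nil, h | .cons _ .nil, h | .cons _ (.cons _ .nil), h
  | .cons _ (.cons _ (.cons _ .nil)), h => simp at h
  | .cons _ (.cons _ (.cons _ (.cons _ (.cons _ _)))), h => simp at h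
  | .cons h₁ (.cons h₂ (.cons h₃ (.cons h₄ .nil))), h =>
    simp only [SimpleGraph.Walk.edges_cons, SimpleGraph.Walk.edges_nil, List.cons.injEq,
      and_true] at h
    obtain ⟨he, hf, he', hf'⟩ := h
    obtain rfl : e = ⟨_, h₁⟩ := Subtype.ext he.symm
    obtain rfl : f = ⟨_, h₂⟩ := Subtype.ext hf.symm
    obtain rfl : e' = ⟨_, h₃⟩ := Subtype.ext he'.symm
    obtain rfl : f' = ⟨_, h₄⟩ := Subtype.ext hf'.symm
    rw [edgeVec_mk, edgeVec_mk, edgeVec_mk, edgeVec_mk]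
    abel

theorem evenPart_pos {x y : V} {w : G.Walk x y} {i : Fin w.length} (hi : Even i.val) :
    0 < evenPart w (edgeAt w i) := by
  have hle : Finsupp.single (edgeAt w i) 1 ≤ evenPart w :=
    Finset.single_le_sum (f := fun i => Finsupp.single (edgeAt w i) 1) (fun _ _ => zero_le)
      (Finset.mem_filter.2 ⟨Finset.mem_univ i, hi⟩)
  exact Finsupp.single_le_iff.1 hle

theorem oddPart_pos {x y : V} {w : G.Walk x y} {i : Fin w.length} (hi : Odd i.val) :
    0 < oddPart w (edgeAt w i) := by
  have hle : Finsupp.single (edgeAt w i) 1 ≤ oddPart w :=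
    Finset.single_le_sum (f := fun i => Finsupp.single (edgeAt w i) 1) (fun _ _ => zero_le)
      (Finset.mem_filter.2 ⟨Finset.mem_univ i, hi⟩)
  exact Finsupp.single_le_iff.1 hle

theorem HasF4.exists_not_isRigid {u : V} {w : G.Walk u u} (h : HasF4 w) :
    ∃ D : G.edgeSet →₀ ℕ, D.degree = 2 ∧ ¬ IsRigid (edgeVec G) D ∧
      (D ≤ evenPart w ∨ D ≤ oddPart w) := by
  obtain ⟨i, i', t, j, t', j', a, ξ, hpar, ⟨-, -, hadj, -⟩, ⟨-, -, hadj', -⟩, -, hcyc, hedges⟩ := h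
  have hnodup := hcyc.edges_nodup
  rw [hedges] at hnodup
  simp only [List.nodup_cons, List.mem_cons, List.not_mem_nil, or_false, not_or] at hnodup
  obtain ⟨⟨hif, hii', hif'⟩, -⟩ := hnodup
  have hne : edgeAt w i ≠ edgeAt w i' := fun h => hii' (congrArg Subtype.val h)
  have hsquare := edgeVec_add_edgeVec_of_edges_eq (e := edgeAt w i) (e' := edgeAt w i')
    (f := ⟨s(_, _), hadj⟩) (f' := ⟨s(_, _), hadj'⟩) hedges
  refine ⟨Finsupp.single (edgeAt w i) 1 + Finsupp.single (edgeAt w i') 1,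
    by rw [map_add, Finsupp.degree_single, Finsupp.degree_single],
    not_isRigid_of_square hsquare (fun h => hif (congrArg Subtype.val h))
      (fun h => hif' (congrArg Subtype.val h)), ?_⟩
  by_cases hi : Even i.val
  · exact Or.inl (single_add_single_le hne (evenPart_pos hi) (evenPart_pos (hpar.1 hi)))
  · have hi' := hpar.not.1 hi
    rw [Nat.not_even_iff_odd] at hi hi'
    exact Or.inr (single_add_single_le hne (oddPart_pos hi) (oddPart_pos hi'))

theorem isCycle_of_square {x y z t : V} (h₁ : G.Adj x y) (h₂ : G.Adj y z) (h₃ : G.Adj z t)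
    (h₄ : G.Adj t x) (hxz : x ≠ z) (hyt : y ≠ t) :
    (SimpleGraph.Walk.cons h₁ (.cons h₂ (.cons h₃ (.cons h₄ .nil)))).IsCycle := by
  rw [SimpleGraph.Walk.cons_isCycle_iff]
  constructor
  · simp [SimpleGraph.Walk.isPath_def, h₂.ne, h₃.ne, h₄.ne, hyt, h₁.ne.symm, hxz.symm]
  · simp [h₁.ne, hxz, hyt, h₄.ne.symm]

namespace ClosedSeq

variable {c : ClosedSeq G} {i j a b p r q t : ℕ}

/-- The vertices `v_i`, `v_{i+1}`, `v_{j+1}`, `v_j` form a square. Its sides `e_i` and `e_j` are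
edges of `N`, and its other two sides are effectively crossing chords in `Q`, the second of which
joins the positions `a < b`. -/
structure IsSquareIn (c : ClosedSeq G) (N Q : G.edgeSet →₀ ℕ) (i j a b : ℕ) : Prop where
  pos_left : 0 < N (c.edge i)
  pos_right : 0 < N (c.edge j)
  isChordIn : c.IsChordIn Q i j
  isChordIn' : c.IsChordIn Q a b
  odd : Odd (a + i)
  cross : (a < i ∧ i < b ∧ b < j) ∨ (i < a ∧ a < j ∧ j < b)
  eq : s(c.vert a, c.vert b) = s(c.vert (i + 1), c.vert (j + 1))

theorem IsCrossingIn.exists_isSquareIn (h : c.IsCrossingIn Q p r q t) (hR : c.Realizes M N)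
    (hM : IsCritical (edgeVec G) M) (hNM : N ≠ M) : ∃ i j a b, c.IsSquareIn N Q i j a b := by
  obtain ⟨hpr, hrq, hqt, hodd, hpq, hrt⟩ := id h
  rcases h.consecutive hR hM hNM with ⟨rfl, rfl, hNp, hNq⟩ | ⟨rfl, rfl, hlast, hNr, hNt⟩
  · exact ⟨p, q, p + 1, q + 1, hNp, hNq, hpq, hrt, by rwa [add_comm], Or.inr (by omega), rfl⟩
  · refine ⟨r, t, 0, r + 1, hNr, hNt, hrt, hpq, hodd, Or.inl (by omega), ?_⟩
    rw [hlast, ← zero_add (2 * c.half), c.periodic, Sym2.eq_swap]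

theorem IsSimpleAt.vert_ne_of_odd (h : c.IsSimpleAt p) (hodd : Odd (p + q)) :
    c.vert p ≠ c.vert q := by
  intro heq
  have hmod := (h q heq.symm).of_mul_right c.half
  rw [Nat.ModEq] at hmod
  grind

theorem IsSquareIn.adj (h : c.IsSquareIn N Q i j a b) :
    G.Adj (c.vert (i + 1)) (c.vert (j + 1)) := by
  rw [← SimpleGraph.mem_edgeSet, ← h.eq]
  exact h.isChordIn'.adj

theorem IsSquareIn.vert_ne (h : c.IsSquareIn N Q i j a b) :
    c.vert i ≠ c.vert (j + 1) ∧ c.vert (i + 1) ≠ c.vert j :=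
  ⟨h.isChordIn.simple_left.vert_ne_of_odd (by grind [h.isChordIn.even]),
    (h.isChordIn.simple_right.vert_ne_of_odd (by grind [h.isChordIn.even])).symm⟩

theorem IsSquareIn.edge_ne (h : c.IsSquareIn N Q i j a b) : c.edge i ≠ c.edge j := by
  intro heq
  have hmem : c.vert i ∈ (c.edge j : Sym2 V) := heq ▸ Sym2.mem_mk_left _ _
  rcases Sym2.mem_iff.1 hmem with hij | hij
  · exact h.isChordIn.adj.ne hij
  · exact h.vert_ne.1 hij

theorem IsSquareIn.degree_eq_two (h : c.IsSquareIn N Q i j a b) (hN : IsCritical (edgeVec G) N) :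
    N.degree = 2 := by
  have hsquare : edgeVec G ⟨s(_, _), h.isChordIn.adj⟩ + edgeVec G ⟨s(_, _), h.isChordIn'.adj⟩
      = edgeVec G (c.edge i) + edgeVec G (c.edge j) := by
    have heq : (⟨s(_, _), h.isChordIn'.adj⟩ : G.edgeSet) = ⟨s(_, _), h.adj⟩ := Subtype.ext h.eq
    rw [heq, edge, edge, edgeVec_mk, edgeVec_mk, edgeVec_mk, edgeVec_mk]
    abel
  have hnr := not_isRigid_of_square hsquare (h.isChordIn.edge_ne i) (h.isChordIn'.edge_ne i)
  rw [← hN.eq_of_le hnr (single_add_single_le h.edge_ne h.pos_left h.pos_right), map_add,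
    Finsupp.degree_single, Finsupp.degree_single]

section OfWalk

variable {u : V} {w : G.Walk u u} {heven : Even w.length} {hpos : 0 < w.length}

theorem isOddChord_of_isChordIn (hG : CondSharp G) (hP : (ofWalk w heven hpos).IsPrimitive)
    (hS : ¬ HasSplit (ofWalk w heven hpos).plus (ofWalk w heven hpos).minus)
    (h : (ofWalk w heven hpos).IsChordIn Q p q) : IsOddChord w p q := by
  obtain ⟨hpq, hq, hsp, hsq, he, hadj, -⟩ := id h
  rw [ofWalk_two_mul_half] at hq
  have hvp := ofWalk_vert (heven := heven) (hpos := hpos) (hpq.trans hq).le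
  have hvq := ofWalk_vert (heven := heven) (hpos := hpos) hq.le
  rw [hvp, hvq] at hadj
  refine ⟨hpq, hq, hadj, fun hmem => ?_,
    not_isBridgeAt hG hP hS (by grind) hq hsp hsq hadj, by grind, by grind⟩
  rw [← SimpleGraph.Walk.adj_toSubgraph_iff_mem_edges,
    toSubgraph_adj_iff_exists (heven := heven) (hpos := hpos)] at hmem
  obtain ⟨n, hn⟩ := hmem
  exact h.edge_ne n (Subtype.ext (hn.trans (congrArg₂ (s(·, ·)) hvp.symm hvq.symm)))

theorem IsSquareIn.hasF4 (h : (ofWalk w heven hpos).IsSquareIn N Q i j a b) (hG : CondSharp G)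
    (hP : (ofWalk w heven hpos).IsPrimitive)
    (hS : ¬ HasSplit (ofWalk w heven hpos).plus (ofWalk w heven hpos).minus) : HasF4 w := by
  have hij := isOddChord_of_isChordIn hG hP hS h.isChordIn
  have hab := isOddChord_of_isChordIn hG hP hS h.isChordIn'
  have hj := hij.2.1
  have hi := hij.1.trans hj
  have hvert {n : ℕ} (hn : n ≤ w.length) := ofWalk_vert (heven := heven) (hpos := hpos) hn
  have hadj := h.adj
  have hne := h.vert_ne
  have heq := h.eq
  rw [hvert hi, hvert hj] at hadj
  rw [hvert hi, hvert hj, hvert hi.le, hvert hj.le] at hne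
  rw [hvert hi, hvert hj, hvert hab.2.1.le, hvert (hab.1.trans hab.2.1).le] at heq
  refine ⟨⟨i, hi⟩, ⟨j, hj⟩, a, b, i, j, w.getVert i, _, by grind [h.isChordIn.even], hab, hij,
    ⟨?_, h.cross⟩, isCycle_of_square (w.adj_getVert_succ hi) hadj (w.adj_getVert_succ hj).symm
      hij.2.2.1.symm hne.1 hne.2, ?_⟩
  · have := h.odd
    rw [Int.odd_sub, Int.odd_coe_nat, Int.even_coe_nat]
    grind
  · rw [SimpleGraph.Walk.edges_cons, SimpleGraph.Walk.edges_cons, SimpleGraph.Walk.edges_cons,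
      SimpleGraph.Walk.edges_cons, SimpleGraph.Walk.edges_nil, heq,
      Sym2.eq_swap (a := w.getVert (j + 1)), Sym2.eq_swap (a := w.getVert j) (b := w.getVert i)]
    rfl

end OfWalk

end ClosedSeq

theorem IsCritical.hasF4_of_not_isCritical (hM : IsCritical (edgeVec G) M) (hG : CondSharp G)
    {u : V} {w : G.Walk u u} (heven : Even w.length) (hpos : 0 < w.length)
    (hw : (evenPart w = M ∧ oddPart w = N) ∨ (evenPart w = N ∧ oddPart w = M)) (hNM : N ≠ M)
    (hN : ¬ IsCritical (edgeVec G) N) : HasF4 w := by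
  have hR : (ClosedSeq.ofWalk w heven hpos).Realizes M N := by
    rwa [ClosedSeq.Realizes, ClosedSeq.ofWalk_plus, ClosedSeq.ofWalk_minus]
  obtain ⟨Q, hQ, hQM, hQN⟩ := hM.exists_third_of_not_isCritical hR.degA_eq hNM hN
  obtain ⟨p, r, q, t, hcross⟩ := hR.exists_isCrossingIn hG hM hNM hQ hQM hQN
  obtain ⟨i, j, a, b, hsquare⟩ := hcross.exists_isSquareIn hR hM hNM
  exact hsquare.hasF4 hG (hR.isPrimitive hM hNM) (hR.not_hasSplit hM)

/-- The walk of `M` and `N` has length `4`, so it has a single chord through its first vertex, and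
two critical monomials cannot share it. -/
theorem IsCritical.eq_or_eq_or_eq_of_degA_eq (hG : CondSharp G) {Q' : G.edgeSet →₀ ℕ}
    (hM : IsCritical (edgeVec G) M) (hN : IsCritical (edgeVec G) N)
    (hQ : IsCritical (edgeVec G) Q) (hd : degA (edgeVec G) N = degA (edgeVec G) M)
    (hQd : degA (edgeVec G) Q = degA (edgeVec G) M)
    (hQd' : degA (edgeVec G) Q' = degA (edgeVec G) M) (hNM : N ≠ M) (hQM : Q ≠ M) (hQN : Q ≠ N) :
    Q' = M ∨ Q' = N ∨ Q' = Q := by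
  by_contra! ⟨hQM', hQN', hne⟩
  obtain ⟨c, hc, hc', -⟩ := hM.exists_closedSeq hd hNM
  have hR : c.Realizes M N := Or.inl ⟨hc, hc'⟩
  obtain ⟨p, r, q, t, h⟩ := hR.exists_isCrossingIn hG hM hNM hQd hQM hQN
  obtain ⟨p', r', q', t', h'⟩ := hR.exists_isCrossingIn hG hM hNM hQd' hQM' hQN'
  obtain ⟨i, j, a, b, hsquare⟩ := h.exists_isSquareIn hR hM hNM
  have hhalf : c.half = 2 := by
    rw [← c.degree_plus, hc, ← degree_eq_of_degA_eq hd, hsquare.degree_eq_two hN]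
  obtain ⟨hpr, hrq, hqt, -, hpq, hrt⟩ := h
  obtain ⟨hpr', hrq', hqt', -, hpq', hrt'⟩ := h'
  have ht := hrt.lt_period
  have ht' := hrt'.lt_period
  obtain ⟨rfl, rfl, rfl, rfl⟩ : p = 0 ∧ q = 2 ∧ p' = 0 ∧ q' = 2 := by omega
  rcases hQ.eq_zero_or_eq_zero (hQd'.trans hQd.symm) hne _ with h0 | h0
  · exact hpq.pos.ne' h0
  · exact hpq'.pos.ne' h0

end Squares

theorem simplexOn_injective {α : Type*} : Function.Injective (simplexOn (α := α)) := by
  have hsub {s t : Finset α} (h : simplexOn s = simplexOn t) : s ⊆ t := by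
    intro x hx
    have hmem : {x} ∈ (simplexOn s).faces :=
      ⟨Finset.singleton_nonempty x, Finset.singleton_subset_iff.2 hx⟩
    rw [h] at hmem
    exact Finset.singleton_subset_iff.1 hmem.2
  exact fun s t h => (hsub h).antisymm (hsub h.symm)

/-! ### Components of `Γ_G` -/

section Components

variable {V : Type*} {G : SimpleGraph V} {M N : G.edgeSet →₀ ℕ}

theorem IsCritical.eq_of_support_subset (hG : CondSharp G) (hM : IsCritical (edgeVec G) M)
    (hN : IsCritical (edgeVec G) N) (h : N.support ⊆ M.support) : N = M :=
  hM.eq_of_le hN.not_isRigid (GraphToric.le_of_support_subset (hN.le_one hG) h)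

theorem isIndispensableMonomial_edgeVec_iff (K : Type*) [Field K] :
    IsIndispensableMonomial (toricIdeal K (edgeVec G)) M ↔ IsCritical (edgeVec G) M :=
  isIndispensableMonomial_iff eq_zero_of_degA_edgeVec_eq_zero

theorem mem_minimalSupports_iff (K : Type*) [Field K] (hG : CondSharp G) {E : Finset G.edgeSet} :
    E ∈ minimalSupports (toricIdeal K (edgeVec G)) ↔
      ∃ M, IsCritical (edgeVec G) M ∧ M.support = E := by
  constructor
  · rintro ⟨⟨M, hM, rfl⟩, -⟩
    exact ⟨M, (isIndispensableMonomial_edgeVec_iff K).1 hM, rfl⟩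
  · rintro ⟨M, hM, rfl⟩
    refine ⟨⟨M, (isIndispensableMonomial_edgeVec_iff K).2 hM, rfl⟩, ?_⟩
    rintro _ ⟨N, hN, rfl⟩ hle
    rw [isIndispensableMonomial_edgeVec_iff] at hN
    rw [hM.eq_of_support_subset hG hN hle]

/-- The supports of the critical monomials of the same degree as `M`: for critical `M`, the vertex
set of the connected component of `Γ_G` through the support of `M`. -/
def fibreSupports (M : G.edgeSet →₀ ℕ) : Set (Finset G.edgeSet) :=
  {E | ∃ N, IsCritical (edgeVec G) N ∧ degA (edgeVec G) N = degA (edgeVec G) M ∧ N.support = E}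

theorem support_mem_fibreSupports (hM : IsCritical (edgeVec G) M) :
    M.support ∈ fibreSupports M :=
  ⟨M, hM, rfl, rfl⟩

theorem IsCritical.degA_eq_of_support_mem_fibreSupports (hG : CondSharp G)
    (hN : IsCritical (edgeVec G) N) (h : N.support ∈ fibreSupports M) :
    degA (edgeVec G) N = degA (edgeVec G) M := by
  obtain ⟨N', hN', hd, hsupp⟩ := h
  rw [← hN.eq_of_support_subset hG hN' hsupp.le, hd]

theorem mem_faces_gammaGraph_iff (K : Type*) [Field K] (hG : CondSharp G)
    {T : Finset (Finset G.edgeSet)} :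
    T ∈ (gammaGraph K G).faces ↔
      T.Nonempty ∧ ∃ M, IsCritical (edgeVec G) M ∧ ↑T ⊆ fibreSupports M := by
  constructor
  · rintro ⟨hT, hmin, u, hu, hdeg⟩
    refine ⟨hT, ?_⟩
    obtain ⟨E₀, hE₀⟩ := hT
    obtain ⟨M, hM, hME⟩ := (mem_minimalSupports_iff K hG).1 (hmin E₀ hE₀)
    refine ⟨M, hM, fun E hE => ?_⟩
    obtain ⟨N, hN, rfl⟩ := (mem_minimalSupports_iff K hG).1 (hmin E hE)
    exact ⟨N, hN, hN.degA_eq_of_support hG hM (hu _ hE) ((hu _ hE₀).trans hME.symm)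
      (hdeg _ hE _ hE₀), rfl⟩
  · rintro ⟨hT, M, -, hsub⟩
    have hsub' (E : Finset G.edgeSet) (hE : E ∈ T) : ∃ N, IsCritical (edgeVec G) N ∧
        degA (edgeVec G) N = degA (edgeVec G) M ∧ N.support = E := hsub hE
    choose! f hcrit hdeg hsupp using hsub'
    exact ⟨hT, fun E hE => (mem_minimalSupports_iff K hG).2 ⟨f E, hcrit E hE, hsupp E hE⟩,
      f, hsupp, fun E hE E' hE' => (hdeg E hE).trans (hdeg E' hE').symm⟩

theorem mem_fibreSupports_of_reachable (K : Type*) [Field K] (hG : CondSharp G)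
    (hM : IsCritical (edgeVec G) M) {E : Finset G.edgeSet}
    (h : Relation.ReflTransGen (CommonFace (gammaGraph K G)) M.support E) :
    E ∈ fibreSupports M := by
  induction h with
  | refl => exact support_mem_fibreSupports hM
  | tail _ hcf ih =>
    obtain ⟨T, hT, hb, hc⟩ := hcf
    obtain ⟨-, P, -, hTP⟩ := (mem_faces_gammaGraph_iff K hG).1 hT
    obtain ⟨N, hN, hNM, rfl⟩ := ih
    obtain ⟨Q, hQ, hQP, rfl⟩ := hTP hc
    have hNP := hN.degA_eq_of_support_mem_fibreSupports hG (hTP hb)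
    exact ⟨Q, hQ, hQP.trans (hNP.symm.trans hNM), rfl⟩

theorem componentAt_support (K : Type*) [Field K] (hG : CondSharp G)
    (hM : IsCritical (edgeVec G) M) {s : Finset (Finset G.edgeSet)} (hs : ↑s = fibreSupports M) :
    componentAt (gammaGraph K G) M.support = simplexOn s := by
  classical
  refine PreAbstractSimplicialComplex.ext (Set.ext fun T => ⟨?_, ?_⟩)
  · rintro ⟨hT, hr⟩
    refine ⟨((mem_faces_gammaGraph_iff K hG).1 hT).1, fun E hE => ?_⟩
    rw [← Finset.mem_coe, hs]
    exact mem_fibreSupports_of_reachable K hG hM (hr E hE)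
  · rintro ⟨hT, hTs⟩
    have hsub : ↑T ⊆ fibreSupports M := by rwa [← hs, Finset.coe_subset]
    refine ⟨(mem_faces_gammaGraph_iff K hG).2 ⟨hT, M, hM, hsub⟩, fun E hE => .single ?_⟩
    refine ⟨{M.support, E}, (mem_faces_gammaGraph_iff K hG).2 ⟨by simp, M, hM, ?_⟩, by simp,
      by simp⟩
    rw [Finset.coe_pair]
    exact Set.pair_subset (support_mem_fibreSupports hM) (hsub hE)

theorem exists_coe_eq_fibreSupports (hG : CondSharp G) (hM : IsCritical (edgeVec G) M) :
    ∃ s : Finset (Finset G.edgeSet),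
      (s.card = 1 ∨ s.card = 2 ∨ s.card = 3) ∧ ↑s = fibreSupports M := by
  classical
  have hsupp {A B : G.edgeSet →₀ ℕ} (hA : IsCritical (edgeVec G) A)
      (hB : IsCritical (edgeVec G) B) (hne : A ≠ B) : A.support ≠ B.support :=
    fun h => hne (hB.eq_of_support_subset hG hA h.le)
  have hcoe {s : Finset (Finset G.edgeSet)} (hmem : ∀ E ∈ s, E ∈ fibreSupports M)
      (hall : ∀ N, IsCritical (edgeVec G) N → degA (edgeVec G) N = degA (edgeVec G) M →
        N.support ∈ s) : ↑s = fibreSupports M :=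
    Set.Subset.antisymm hmem (by rintro _ ⟨N, hN, hd, rfl⟩; exact hall N hN hd)
  have hM' := support_mem_fibreSupports hM
  by_cases! hone : ∀ N, IsCritical (edgeVec G) N → degA (edgeVec G) N = degA (edgeVec G) M → N = M
  · exact ⟨{M.support}, by simp, hcoe (by simpa using hM') fun N hN hd => by simp [hone N hN hd]⟩
  obtain ⟨N, hN, hNd, hNM⟩ := hone
  have hN' : N.support ∈ fibreSupports M := ⟨N, hN, hNd, rfl⟩
  by_cases! htwo : ∀ Q, IsCritical (edgeVec G) Q → degA (edgeVec G) Q = degA (edgeVec G) M →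
    Q = M ∨ Q = N
  · refine ⟨{M.support, N.support}, .inr (.inl (Finset.card_pair (hsupp hM hN hNM.symm))),
      hcoe (by simp [hM', hN']) fun Q hQ hd => ?_⟩
    rcases htwo Q hQ hd with rfl | rfl <;> simp
  obtain ⟨Q, hQ, hQd, hQM, hQN⟩ := htwo
  have hQ' : Q.support ∈ fibreSupports M := ⟨Q, hQ, hQd, rfl⟩
  refine ⟨{M.support, N.support, Q.support}, .inr (.inr (Finset.card_eq_three.2 ⟨_, _, _,
    hsupp hM hN hNM.symm, hsupp hM hQ hQM.symm, hsupp hN hQ hQN.symm, rfl⟩)),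
    hcoe (by simp [hM', hN', hQ']) fun Q' _ hd => ?_⟩
  rcases hM.eq_or_eq_or_eq_of_degA_eq hG hN hQ hNd hQd hd hNM hQM hQN with rfl | rfl | rfl <;> simp

theorem isConnectedComponent_gammaGraph_iff (K : Type*) [Field K] (hG : CondSharp G)
    {H : PreAbstractSimplicialComplex (Finset G.edgeSet)} :
    IsConnectedComponent (gammaGraph K G) H ↔
      ∃ M, ∃ s : Finset (Finset G.edgeSet),
        IsCritical (edgeVec G) M ∧ ↑s = fibreSupports M ∧ H = simplexOn s := by
  constructor
  · rintro ⟨E, hE, rfl⟩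
    obtain ⟨-, P, -, hEP⟩ := (mem_faces_gammaGraph_iff K hG).1 hE
    obtain ⟨M, hM, -, rfl⟩ := hEP (Finset.mem_singleton_self E)
    obtain ⟨s, -, hs⟩ := exists_coe_eq_fibreSupports hG hM
    exact ⟨M, s, hM, hs, componentAt_support K hG hM hs⟩
  · rintro ⟨M, s, hM, hs, rfl⟩
    refine ⟨M.support, (mem_faces_gammaGraph_iff K hG).2 ⟨Finset.singleton_nonempty _, M, hM, ?_⟩,
      (componentAt_support K hG hM hs).symm⟩
    rw [Finset.coe_singleton, Set.singleton_subset_iff]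
    exact support_mem_fibreSupports hM

theorem isConnectedComponent_singleton_iff (K : Type*) [Field K] (hG : CondSharp G)
    (hM : IsCritical (edgeVec G) M) :
    IsConnectedComponent (gammaGraph K G) (simplexOn {M.support}) ↔
      ∀ N, IsCritical (edgeVec G) N → degA (edgeVec G) N = degA (edgeVec G) M → N = M := by
  rw [isConnectedComponent_gammaGraph_iff K hG]
  constructor
  · rintro ⟨P, s, -, hs, heq⟩ N hN hNM
    rw [← simplexOn_injective heq, Finset.coe_singleton] at hs
    have hMP := hM.degA_eq_of_support_mem_fibreSupports hG (hs ▸ Set.mem_singleton _)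
    have hN' : N.support ∈ fibreSupports P := ⟨N, hN, hNM.trans hMP, rfl⟩
    rw [← hs, Set.mem_singleton_iff] at hN'
    exact hM.eq_of_support_subset hG hN hN'.le
  · intro h
    refine ⟨M, {M.support}, hM, ?_, rfl⟩
    rw [Finset.coe_singleton, eq_comm, Set.eq_singleton_iff_unique_mem]
    refine ⟨support_mem_fibreSupports hM, ?_⟩
    rintro _ ⟨N, hN, hNM, rfl⟩
    rw [h N hN hNM]

theorem mem_support_walkBinomial_iff (K : Type*) [Field K] {u : V} {w : G.Walk u u} :
    M ∈ (walkBinomial K w).support ↔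
      evenPart w ≠ oddPart w ∧ (M = evenPart w ∨ M = oddPart w) := by
  rw [walkBinomial_eq, mem_support_monomial_sub]

theorem IsCritical.hasF4_of_forall_eq (K : Type*) [Field K] (hG : CondSharp G)
    (hM : IsCritical (edgeVec G) M)
    (h : ∀ N, IsCritical (edgeVec G) N → degA (edgeVec G) N = degA (edgeVec G) M → N = M)
    {u : V} {w : G.Walk u u} (heven : Even w.length) (hmem : M ∈ (walkBinomial K w).support) :
    HasF4 w := by
  obtain ⟨hne, hor⟩ := (mem_support_walkBinomial_iff K).1 hmem
  have hd := degA_evenPart_eq_degA_oddPart heven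
  have hpos : 0 < w.length := by
    by_contra hzero
    have hsum := degree_evenPart_add_degree_oddPart w
    have heven0 : (evenPart w).degree = 0 := by lia
    have hodd0 : (oddPart w).degree = 0 := by lia
    rw [Finsupp.degree_eq_zero_iff] at heven0 hodd0
    exact hne (heven0.trans hodd0.symm)
  rcases hor with rfl | rfl
  · exact hM.hasF4_of_not_isCritical hG heven hpos (Or.inl ⟨rfl, rfl⟩) hne.symm
      fun hN => hne (h _ hN hd.symm).symm
  · exact hM.hasF4_of_not_isCritical hG heven hpos (Or.inr ⟨rfl, rfl⟩) hne
      fun hN => hne (h _ hN hd)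

/-- The quadratic monomial given by an `𝓕₄` is not rigid, so it divides no critical monomial of
higher degree. -/
theorem IsCritical.eq_of_forall_hasF4 (K : Type*) [Field K] (hM : IsCritical (edgeVec G) M)
    (hdeg : M.degree ≠ 2) (h : ∀ (u : V) (w : G.Walk u u), Even w.length →
      M ∈ (walkBinomial K w).support → HasF4 w)
    (hN : IsCritical (edgeVec G) N) (hNM : degA (edgeVec G) N = degA (edgeVec G) M) : N = M := by
  by_contra hne
  obtain ⟨u, w, heven, -, hw⟩ := (hM.isPrimitivePair_edgeVec hNM hne).exists_walk hM.ne_zero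
  have hF : HasF4 w := h u w heven ((mem_support_walkBinomial_iff K).2 (by grind))
  obtain ⟨D, hD, hnr, hle⟩ := hF.exists_not_isRigid
  have hle' : D ≤ M ∨ D ≤ N := by grind
  rcases hle' with hle' | hle'
  · exact hdeg (hM.eq_of_le hnr hle' ▸ hD)
  · rw [← degree_eq_of_degA_eq hNM] at hdeg
    exact hdeg (hN.eq_of_le hnr hle' ▸ hD)

end Components

end GraphToric
end

theorem theorem3p11_general {V : Type*} (K : Type*) [Field K] (G : SimpleGraph V)
    (hsharp : GraphToric.CondSharp G) :
    (∀ M : G.edgeSet →₀ ℕ,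
      GraphToric.IsIndispensableMonomial (GraphToric.toricIdeal K (GraphToric.edgeVec G)) M →
      M.degree ≠ 2 →
      (GraphToric.IsConnectedComponent (GraphToric.gammaGraph K G)
          (GraphToric.simplexOn {M.support}) ↔
        ∀ (u : V) (w : G.Walk u u), Even w.length →
          M ∈ (GraphToric.walkBinomial K w).support → GraphToric.HasF4 w)) ∧
    (∀ H : PreAbstractSimplicialComplex (Finset G.edgeSet),
      GraphToric.IsConnectedComponent (GraphToric.gammaGraph K G) H →
      ∃ s : Finset (Finset G.edgeSet),
        (s.card = 1 ∨ s.card = 2 ∨ s.card = 3) ∧ H = GraphToric.simplexOn s) := by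
  refine ⟨fun M hM hdeg => ?_, fun H hH => ?_⟩
  · rw [GraphToric.isIndispensableMonomial_edgeVec_iff] at hM
    rw [GraphToric.isConnectedComponent_singleton_iff K hsharp hM]
    exact ⟨fun h _ _ heven hmem => hM.hasF4_of_forall_eq K hsharp h heven hmem,
      fun h _ hN hNM => hM.eq_of_forall_hasF4 K hdeg h hN hNM⟩
  · obtain ⟨M, t, hM, ht, rfl⟩ := (GraphToric.isConnectedComponent_gammaGraph_iff K hsharp).1 hH
    obtain ⟨s, hcard, hs⟩ := GraphToric.exists_coe_eq_fibreSupports hsharp hM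
    rw [Finset.coe_injective (ht.trans hs.symm)]
    exact ⟨s, hcard, rfl⟩

theorem theorem3p11 {V : Type*} [Fintype V] (K : Type*) [Field K] (G : SimpleGraph V)
    (hconn : G.Connected) (hsharp : GraphToric.CondSharp G) :
    (∀ M : G.edgeSet →₀ ℕ,
      GraphToric.IsIndispensableMonomial (GraphToric.toricIdeal K (GraphToric.edgeVec G)) M →
      M.degree ≠ 2 →
      (GraphToric.IsConnectedComponent (GraphToric.gammaGraph K G)
          (GraphToric.simplexOn {M.support}) ↔
        ∀ (u : V) (w : G.Walk u u), Even w.length →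
          M ∈ (GraphToric.walkBinomial K w).support → GraphToric.HasF4 w)) ∧
    (∀ H : PreAbstractSimplicialComplex (Finset G.edgeSet),
      GraphToric.IsConnectedComponent (GraphToric.gammaGraph K G) H →
      ∃ s : Finset (Finset G.edgeSet),
        (s.card = 1 ∨ s.card = 2 ∨ s.card = 3) ∧ H = GraphToric.simplexOn s) :=
  theorem3p11_general K G hsharp
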